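/- Let $p$ be a prime and let $R$ be a commutative ring with an element $\rho$ that is a root of the $p$-th cyclotomic polynomial (equivalently, $R$ is a $\mathbb{Z}[\rho]$-algebra; $\rho=-1$ if $p=2$), such that $\eta=\rho-1$ is not a zero divisor in $R$ (for instance, $R$ is flat over $\mathbb{Z}[\rho]$). Let $G\supset C$ be cyclic groups of orders $p^{r+1}$ and $p$, $r\ge 0$, let $\sigma$ be a generator of $G$, and put $\tau=\sigma^{p^r}$, a generator of $C$. Let $S/R$ be a Galois extension of commutative rings with group $G/C$. For $B=R$ or $S$ put $B[C](1)=B[C]/(\tau-\rho)(\tau-1)B[C]$, let $\tilde\rho\in R[C](1)$ be the image of $\tau$, and let $A(1)=\Delta(S[C](1)/R[C](1),\tilde\rho)$ be the cyclic crossed product, i.e. the $R[C](1)$-algebra generated by $S[C](1)$ and an element $u$ with $ub=\sigma(b)u$ for $b\in S[C](1)$ ($\sigma$ acting on the coefficients) and $u^{p^r}=\tilde\rho$. An $A(1)$-module is thus an $S$-module with a compatible semilinear action of $G$, where $\sigma$ acts as $u$. A splitting module for $A(1)$ is an $A(1)$-module $P(1)$, finitely generated and projective over $R[C](1)$, such that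 the action induces an isomorphism $A(1)\cong\operatorname{End}_{R[C](1)}(P(1))$. Put $P_0=P(1)/(\tau-1)P(1)$ and $P_1=P(1)/(\tau-\rho)P(1)$; $P(1)$ is normalized if it is equipped with an isomorphism $P_0\cong S$ of $A(1)$-modules (on $S$, $u$ acts as $\sigma$). For a normalized splitting module let $S'=S(1/\eta)$, $P_1'=P_1\otimes_S S'$, and let $U'=S'[P_1']=S'\oplus P_1'\oplus P_1'^{2}\oplus\cdots$ with the induced $G$-action. View $P(1)\subset U'$ by sending $x$ with images $s\in S\cong P_0$ and $\theta\in P_1$ to $(\theta-s)/\eta$, let $P(p)\subset U'$ be the $S$-submodule generated by all $p$-fold products of elements of $P(1)$, and let $P(p)^G\subset P_1'^{p}\oplus S'$ be its $G$-invariants. It is a module over the fibre product ring $R*_pR=\{(a,b)\in R\times R: a\equiv b \bmod \eta^pR\}$, where $(a,b)$ acts as $a$ on $P_1'^{p}$ and as $b$ on $S'$. Then the following are equivalent: 1. $S/R$ extends to a $G$-Galois extension $T/R$, i.e. there is a Galois extension $T/R$ with group $G$ and $T\supset S\supset R$ such that $T^C=S$ and the $G$-action on $T$ induces the given action of $G/C$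 on $S$. 2. $A(1)$ is a split Azumaya algebra over $R[C](1)$, and there is a normalized splitting module $P(1)$ for $A(1)$ with $P(p)^G\cong R*_pR$ as $R*_pR$-modules. -/

import Mathlib

universe u v

namespace AlbertCriterion

noncomputable section

/-! ### Galois extensions of commutative rings -/

/-- `S / R` is a Galois extension of commutative rings with (finite) group `G`: the group `G` acts
on `S` by `R`-algebra automorphisms, `R` embeds in `S` with image the fixed ring `S ^ G`, and there
are Galois coordinates `x i, y i` with `∑ i, x i * g (y i) = δ_{g,1}`
(Chase–Harrison–Rosenberg). -/
structure IsGaloisExtension (G R S : Type*) [Group G] [CommRing R] [CommRing S] [Algebra R S]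
    [MulSemiringAction G S] [SMulCommClass G R S] : Prop where
  finite : Finite G
  injective : Function.Injective (algebraMap R S)
  fixed : ∀ s : S, (∀ g : G, g • s = s) → s ∈ Set.range (algebraMap R S)
  coordinates : ∃ (n : ℕ) (x y : Fin n → S),
    (∑ i, x i * y i = 1) ∧ ∀ g : G, g ≠ 1 → ∑ i, x i * g • y i = 0

/-- A `G ⧸ C`-Galois extension `S / R` extends to a `G`-Galois extension: there is `T ⊇ S ⊇ R` with
`T / R` Galois with group `G`, such that `S = T ^ C` and the action of `G` on `T` induces the given
action of `G ⧸ C` on `S`. -/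
def ExtendsToGalois {G : Type v} [CommGroup G] (C : Subgroup G) (R S : Type u) [CommRing R]
    [CommRing S] [Algebra R S] [MulSemiringAction (G ⧸ C) S] : Prop :=
  ∃ (T : Type u) (_ : CommRing T) (_ : Algebra R T) (_ : Algebra S T) (_ : IsScalarTower R S T)
    (_ : MulSemiringAction G T) (_ : SMulCommClass G R T),
    IsGaloisExtension G R T ∧
    Function.Injective (algebraMap S T) ∧
    Set.range (algebraMap S T) = {t : T | ∀ c ∈ C, c • t = t} ∧
    ∀ (g : G) (s : S), g • algebraMap S T s = algebraMap S T ((g : G ⧸ C) • s)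

/-! ### Cyclic crossed products, split algebras -/

/-- The defining relations of the cyclic crossed product: the generators `some b` form a copy of
the `K`-algebra `B`, and the generator `none` (written `u`) satisfies `u b = φ(b) u`
and `u ^ n = a`. -/
inductive CrossedRel (K B : Type*) [CommRing K] [CommRing B] [Algebra K B] (φ : B →ₐ[K] B)
    (n : ℕ) (a : K) : FreeAlgebra K (Option B) → FreeAlgebra K (Option B) → Prop
  | add (b c : B) : CrossedRel K B φ n a
      (FreeAlgebra.ι K (some (b + c))) (FreeAlgebra.ι K (some b) + FreeAlgebra.ι K (some c))
  | mul (b c : B) : CrossedRel K B φ n a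
      (FreeAlgebra.ι K (some (b * c))) (FreeAlgebra.ι K (some b) * FreeAlgebra.ι K (some c))
  | base (k : K) : CrossedRel K B φ n a
      (FreeAlgebra.ι K (some (algebraMap K B k))) (algebraMap K _ k)
  | skew (b : B) : CrossedRel K B φ n a
      (FreeAlgebra.ι K none * FreeAlgebra.ι K (some b))
      (FreeAlgebra.ι K (some (φ b)) * FreeAlgebra.ι K none)
  | pow : CrossedRel K B φ n a (FreeAlgebra.ι K none ^ n) (algebraMap K _ a)

/-- The cyclic crossed product `Δ(B/K, a)`, where `B / K` is cyclic of degree `n` with group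
generated by `φ`: the `K`-algebra generated by `B` and an element `u` subject to `u b = φ(b) u`
and `u ^ n = a`. -/
abbrev CrossedProduct (K B : Type*) [CommRing K] [CommRing B] [Algebra K B] (φ : B →ₐ[K] B)
    (n : ℕ) (a : K) : Type _ :=
  RingQuot (CrossedRel K B φ n a)

section CrossedProduct

variable {K B : Type*} [CommRing K] [CommRing B] [Algebra K B] (φ : B →ₐ[K] B) (n : ℕ) (a : K)

/-- The element `u` of `Δ(B/K, a)`. -/
def CrossedProduct.u : CrossedProduct K B φ n a :=
  RingQuot.mkAlgHom K (CrossedRel K B φ n a) (FreeAlgebra.ι K none)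

/-- The structure map `B → Δ(B/K, a)`. -/
def CrossedProduct.ofBase : B →ₐ[K] CrossedProduct K B φ n a :=
  have hK (k : K) : RingQuot.mkAlgHom K (CrossedRel K B φ n a)
      (FreeAlgebra.ι K (some (algebraMap K B k))) = algebraMap K _ k := by
    rw [RingQuot.mkAlgHom_rel K (CrossedRel.base k), AlgHom.commutes]
  { toFun b := RingQuot.mkAlgHom K (CrossedRel K B φ n a) (FreeAlgebra.ι K (some b))
    map_one' := by simpa using hK 1
    map_mul' b c := by rw [RingQuot.mkAlgHom_rel K (CrossedRel.mul b c), map_mul]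
    map_zero' := by simpa using hK 0
    map_add' b c := by rw [RingQuot.mkAlgHom_rel K (CrossedRel.add b c), map_add]
    commutes' := hK }

theorem CrossedProduct.u_mul_ofBase (b : B) :
    u φ n a * ofBase φ n a b = ofBase φ n a (φ b) * u φ n a := by
  have h := RingQuot.mkAlgHom_rel K (CrossedRel.skew (φ := φ) (n := n) (a := a) b)
  rwa [map_mul, map_mul] at h

end CrossedProduct

/-- `P` is a splitting module for the `K`-algebra `A`: it is a finitely generated projective
`K`-module, and the action of `A` on it induces an isomorphism `A ≅ End_K(P)`. -/
def IsSplittingModule (K A P : Type*) [CommRing K] [Ring A] [Algebra K A] [AddCommGroup P]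
    [Module K P] [Module A P] [IsScalarTower K A P] : Prop :=
  Module.Finite K P ∧ Module.Projective K P ∧
    Function.Bijective (Algebra.lsmul K K P : A →ₐ[K] Module.End K P)

/-- `A` is a split Azumaya algebra over `K`: it is Azumaya, and isomorphic to `End_K(Q)` for some
faithful finitely generated projective `K`-module `Q`. -/
def IsSplitAzumaya (K : Type u) (A : Type*) [CommRing K] [Ring A] [Algebra K A] : Prop :=
  IsAzumaya K A ∧ ∃ (Q : Type u) (_ : AddCommGroup Q) (_ : Module K Q),
    Module.Finite K Q ∧ Module.Projective K Q ∧ FaithfulSMul K Q ∧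
      Nonempty (A ≃ₐ[K] Module.End K Q)

/-! ### The rings `R[C](1)` and `S[C](1)` and the algebra `A(1)` -/

/-- The ring `A[C](1) = A[C] / (τ - ρ)(τ - 1) A[C]`. -/
abbrev GroupRingOne (A : Type*) {C : Type*} [CommRing A] [CommGroup C] (τ : C) (ρ : A) : Type _ :=
  MonoidAlgebra A C ⧸ Ideal.span
    {(MonoidAlgebra.of A C τ - algebraMap A (MonoidAlgebra A C) ρ) * (MonoidAlgebra.of A C τ - 1)}

/-- The image of `τ` in `A[C](1)`. -/
def tauOne {A C : Type*} [CommRing A] [CommGroup C] (τ : C) (ρ : A) : GroupRingOne A τ ρ :=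
  Ideal.Quotient.mk _ (MonoidAlgebra.of A C τ)

/-- The ring homomorphism `A[C](1) → B[C](1)` induced by `f : A → B`, where `f ρ = ρ'`. -/
def groupRingOneMap {A B C : Type*} [CommRing A] [CommRing B] [CommGroup C] (τ : C) {ρ : A}
    {ρ' : B} (f : A →+* B) (hf : f ρ = ρ') : GroupRingOne A τ ρ →+* GroupRingOne B τ ρ' :=
  Ideal.quotientMap _ (MonoidAlgebra.mapRingHom C f) (by
    rw [Ideal.span_le, Set.singleton_subset_iff]
    refine Ideal.mem_comap.2 (Ideal.subset_span ?_)
    subst hf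
    simp [MonoidAlgebra.of_apply, MonoidAlgebra.one_def])

section AOne

variable {R S C : Type*} [CommRing R] [CommRing S] [Algebra R S] [CommGroup C]
  (σ : S ≃ₐ[R] S) (τ : C) (ρ : R) (n : ℕ)

/-- `S[C](1)` is an `R[C](1)`-algebra. -/
instance groupRingOneAlgebra :
    Algebra (GroupRingOne R τ ρ) (GroupRingOne S τ (algebraMap R S ρ)) :=
  (groupRingOneMap τ (algebraMap R S) rfl).toAlgebra

/-- The automorphism `σ` of `S / R` acting on the coefficients of `S[C](1)`. -/
def sigmaOne : GroupRingOne S τ (algebraMap R S ρ) →ₐ[GroupRingOne R τ ρ]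
    GroupRingOne S τ (algebraMap R S ρ) :=
  { groupRingOneMap τ (σ : S →+* S) (by simp) with
    commutes' x := by
      obtain ⟨x, rfl⟩ := Ideal.Quotient.mk_surjective x
      have h : (MonoidAlgebra.mapRingHom C (σ : S →+* S)).comp
          (MonoidAlgebra.mapRingHom C (algebraMap R S)) =
            MonoidAlgebra.mapRingHom C (algebraMap R S) := by
        ext <;> simp
      exact congrArg (Ideal.Quotient.mk _) (RingHom.congr_fun h x) }

/-- `A(1) = Δ(S[C](1) / R[C](1), τ)`, where `S / R` is cyclic of degree `n` with group generated
by `σ`. -/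
abbrev AOne : Type _ :=
  CrossedProduct (GroupRingOne R τ ρ) (GroupRingOne S τ (algebraMap R S ρ))
    (sigmaOne σ τ ρ) n (tauOne τ ρ)

end AOne

/-! ### Semilinear maps and symmetric algebras -/

/-- The ring `A`, regarded as an `S`-algebra through `σ : S → S`. -/
def Twist {S : Type*} [CommRing S] (_ : S →+* S) (A : Type*) : Type _ := A

instance {S A : Type*} [CommRing S] [CommRing A] (σ : S →+* S) : CommRing (Twist σ A) :=
  inferInstanceAs (CommRing A)

instance {S A : Type*} [CommRing S] [CommRing A] [Algebra S A] (σ : S →+* S) :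
    Algebra S (Twist σ A) :=
  RingHom.toAlgebra (S := Twist σ A) ((algebraMap S A).comp σ)

section SymMap

variable {S M : Type*} [CommRing S] [AddCommGroup M] [Module S M] (σ : S →+* S) (g : M →ₛₗ[σ] M)

/-- A `σ`-semilinear endomorphism `g` of an `S`-module `M` extends to a ring endomorphism of the
symmetric algebra `S[M]` which is `σ` on `S` and `g` on `M`. -/
def symMap : SymmetricAlgebra S M →+* SymmetricAlgebra S M :=
  let l : M →ₗ[S] Twist σ (SymmetricAlgebra S M) :=
    { toFun x := SymmetricAlgebra.ι S M (g x)
      map_add' x y := by rw [map_add, map_add]; rfl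
      map_smul' s x := by
        rw [map_smulₛₗ, map_smul, Algebra.smul_def]; rfl }
  (SymmetricAlgebra.lift l : SymmetricAlgebra S M →ₐ[S] Twist σ (SymmetricAlgebra S M)).toRingHom

theorem symMap_algebraMap (s : S) :
    symMap σ g (algebraMap S _ s) = algebraMap S (SymmetricAlgebra S M) (σ s) :=
  AlgHom.commutes (SymmetricAlgebra.lift _ : SymmetricAlgebra S M →ₐ[S]
    Twist σ (SymmetricAlgebra S M)) s

theorem symMap_ι (x : M) :
    symMap σ g (SymmetricAlgebra.ι S M x) = SymmetricAlgebra.ι S M (g x) :=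
  SymmetricAlgebra.lift_ι_apply (A := Twist σ (SymmetricAlgebra S M)) _ x

end SymMap

/-! ### The graded ring `S'[M']` -/

section SymLoc

variable {S : Type*} [CommRing S] (M : Type*) [AddCommGroup M] [Module S M] (e : S)

/-- The ring `S'[M'] = S' ⊕ M' ⊕ M'² ⊕ ⋯`, where `S' = S(1/e)` and `M' = M ⊗ S'`, in the form
`S[M](1/e)`. -/
def SymLoc : Type _ := Localization.Away (algebraMap S (SymmetricAlgebra S M) e)

instance : CommRing (SymLoc M e) :=
  inferInstanceAs (CommRing (Localization.Away (algebraMap S (SymmetricAlgebra S M) e)))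

instance : Algebra (SymmetricAlgebra S M) (SymLoc M e) :=
  inferInstanceAs (Algebra (SymmetricAlgebra S M)
    (Localization.Away (algebraMap S (SymmetricAlgebra S M) e)))

instance : IsLocalization.Away (algebraMap S (SymmetricAlgebra S M) e) (SymLoc M e) :=
  inferInstanceAs (IsLocalization.Away (algebraMap S (SymmetricAlgebra S M) e)
    (Localization.Away (algebraMap S (SymmetricAlgebra S M) e)))

instance : Algebra S (SymLoc M e) :=
  ((algebraMap (SymmetricAlgebra S M) (SymLoc M e)).comp
    (algebraMap S (SymmetricAlgebra S M))).toAlgebra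

instance : IsScalarTower S (SymmetricAlgebra S M) (SymLoc M e) :=
  IsScalarTower.of_algebraMap_eq fun _ => rfl

/-- The element `1/e` of `S'[M']`. -/
def SymLoc.inv : SymLoc M e :=
  IsLocalization.Away.invSelf (algebraMap S (SymmetricAlgebra S M) e)

theorem SymLoc.inv_mul : SymLoc.inv M e * algebraMap S (SymLoc M e) e = 1 := by
  rw [mul_comm, IsScalarTower.algebraMap_apply S (SymmetricAlgebra S M) (SymLoc M e)]
  exact IsLocalization.Away.mul_invSelf _

theorem SymLoc.algebraMap_smul (s : S) (w : SymmetricAlgebra S M) :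
    algebraMap (SymmetricAlgebra S M) (SymLoc M e) (s • w) =
      s • algebraMap (SymmetricAlgebra S M) (SymLoc M e) w :=
  map_smul (IsScalarTower.toAlgHom S (SymmetricAlgebra S M) (SymLoc M e)) s w

/-- The degree `d` part `M' ^ d` of `S'[M']`. -/
def SymLoc.degreePart (d : ℕ) : Submodule S (SymLoc M e) where
  carrier := {z | ∃ w ∈ LinearMap.range (SymmetricAlgebra.ι S M) ^ d, ∃ k : ℕ,
    z = SymLoc.inv M e ^ k * algebraMap (SymmetricAlgebra S M) (SymLoc M e) w}
  zero_mem' := ⟨0, zero_mem _, 0, by simp⟩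
  add_mem' := by
    rintro _ _ ⟨w, hw, k, rfl⟩ ⟨w', hw', k', rfl⟩
    refine ⟨e ^ k' • w + e ^ k • w',
      add_mem (Submodule.smul_mem _ _ hw) (Submodule.smul_mem _ _ hw'), k + k', ?_⟩
    have h1 := congrArg (· ^ k) (SymLoc.inv_mul M e)
    have h2 := congrArg (· ^ k') (SymLoc.inv_mul M e)
    simp only [mul_pow, one_pow] at h1 h2
    rw [map_add, SymLoc.algebraMap_smul, SymLoc.algebraMap_smul, Algebra.smul_def,
      Algebra.smul_def, map_pow, map_pow]
    linear_combination (-SymLoc.inv M e ^ k * algebraMap _ (SymLoc M e) w) * h2 -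
      (SymLoc.inv M e ^ k' * algebraMap _ (SymLoc M e) w') * h1
  smul_mem' := by
    rintro s _ ⟨w, hw, k, rfl⟩
    refine ⟨s • w, Submodule.smul_mem _ _ hw, k, ?_⟩
    rw [SymLoc.algebraMap_smul, mul_smul_comm]

variable {M e}

/-- The ring endomorphism of `S'[M']` which is `σ` on `S` and `g` on `M`, where `σ` fixes `e`. -/
def SymLoc.map (σ : S →+* S) (g : M →ₛₗ[σ] M) (he : σ e = e) : SymLoc M e →+* SymLoc M e :=
  IsLocalization.map (M := Submonoid.powers (algebraMap S (SymmetricAlgebra S M) e))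
    (T := Submonoid.powers (algebraMap S (SymmetricAlgebra S M) e)) (SymLoc M e) (symMap σ g) (by
      rw [Submonoid.powers_le]
      exact ⟨1, by simp [symMap_algebraMap, he]⟩)

end SymLoc

/-! ### The fibre product ring `R *ₚ R` -/

/-- `R *ₚ R`, the fibre product of two copies of `R` over `R / η ^ p R`. -/
abbrev FiberRing (R : Type*) [CommRing R] (η : R) (p : ℕ) : Subring (R × R) :=
  RingHom.eqLocus ((Ideal.Quotient.mk (Ideal.span {η ^ p})).comp (RingHom.fst R R))
    ((Ideal.Quotient.mk (Ideal.span {η ^ p})).comp (RingHom.snd R R))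

/-! ### From `P(1)` to `P(p) ^ G` -/

/-- The actions of `σ` and of `τ` on an `S`-module `P` that come with an `A(1)`-module structure:
`act` is the (`σ`-semilinear) action of `σ`, and `tau` the (linear) action of `τ`. -/
structure SemilinearAction {R S : Type*} [CommRing R] [CommRing S] [Algebra R S] (σ : S ≃ₐ[R] S)
    (P : Type*) [AddCommGroup P] [Module S P] where
  act : P →ₛₗ[(σ : S →+* S)] P
  tau : P →ₗ[S] P
  act_tau : ∀ x, act (tau x) = tau (act x)

namespace SemilinearAction

variable {R S P : Type*} [CommRing R] [CommRing S] [Algebra R S] {σ : S ≃ₐ[R] S}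
  [AddCommGroup P] [Module S P] (D : SemilinearAction σ P) (ρ : R)

/-- `P₀ = P(1) / (τ - 1) P(1)`. -/
abbrev PZero : Type _ := P ⧸ LinearMap.range (D.tau - LinearMap.id)

/-- `P₁ = P(1) / (τ - ρ) P(1)`. -/
abbrev POne : Type _ := P ⧸ LinearMap.range (D.tau - algebraMap R S ρ • LinearMap.id)

/-- The action of `σ` on `P₁`. -/
def actOne : D.POne ρ →ₛₗ[(σ : S →+* S)] D.POne ρ :=
  Submodule.mapQ _ _ D.act (by
    rintro _ ⟨x, rfl⟩
    refine ⟨D.act x, ?_⟩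
    simp [D.act_tau])

/-- A normalization of `P(1)`: an isomorphism `P₀ ≅ S` of `S`-modules which respects the actions
of `σ`, that is, an isomorphism of `A(1)`-modules. -/
structure Normalization where
  equiv : D.PZero ≃ₗ[S] S
  map_act : ∀ x : P, equiv (Submodule.Quotient.mk (D.act x)) =
    σ (equiv (Submodule.Quotient.mk x))

/-- The ring `U' = S'[P₁']`, where `S' = S(1/η)`, `P₁' = P₁ ⊗ S'` and `η = ρ - 1`. -/
abbrev UPrime : Type _ := SymLoc (D.POne ρ) (algebraMap R S (ρ - 1))

/-- The action of `σ` on `U'`. -/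
def actU : D.UPrime ρ →+* D.UPrime ρ :=
  SymLoc.map (σ : S →+* S) (D.actOne ρ) (by simp)

/-- The degree `d` part `P₁' ^ d` of `U'`. -/
abbrev degreePart (d : ℕ) : Submodule S (D.UPrime ρ) :=
  SymLoc.degreePart (D.POne ρ) (algebraMap R S (ρ - 1)) d

variable {D}

/-- The embedding `P(1) ⊆ (1/η) S ⊕ (1/η) P₁ ⊆ U'` attached to a normalization. An element of
`P(1)` with image `s` in `P₀ ≅ S` and image `θ` in `P₁` goes to `(θ - s) / η`. This is the identity
on `P₁ ≅ (τ - 1) P(1)` and on `S ≅ P₀ ≅ (τ - ρ) P(1)`. -/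
def embed (ν : D.Normalization) : P →ₗ[S] D.UPrime ρ :=
  LinearMap.mulLeft S (SymLoc.inv (D.POne ρ) (algebraMap R S (ρ - 1))) ∘ₗ
    (IsScalarTower.toAlgHom S (SymmetricAlgebra S (D.POne ρ)) (D.UPrime ρ)).toLinearMap ∘ₗ
      (SymmetricAlgebra.ι S (D.POne ρ) ∘ₗ Submodule.mkQ _ -
        Algebra.linearMap S (SymmetricAlgebra S (D.POne ρ)) ∘ₗ ν.equiv.toLinearMap ∘ₗ
          Submodule.mkQ _)

/-- `P(p) ⊆ U'`, the `S`-submodule generated by all `p`-fold products of elements of `P(1)`. -/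
def power (ν : D.Normalization) (p : ℕ) : Submodule S (D.UPrime ρ) :=
  LinearMap.range (embed ρ ν) ^ p

/-- `P(p) ^ G`. The group `G` is generated by `σ`. -/
def powerInvariants (ν : D.Normalization) (p : ℕ) : Set (D.UPrime ρ) :=
  {z | z ∈ power ρ ν p ∧ D.actU ρ z = z}

variable (D)

/-- The module `P₁' ^ p ⊕ S'`. -/
def DegreePZero (p : ℕ) : Type _ := D.degreePart ρ p × D.degreePart ρ 0

instance (p : ℕ) : AddCommGroup (D.DegreePZero ρ p) :=
  inferInstanceAs (AddCommGroup (D.degreePart ρ p × D.degreePart ρ 0))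

/-- `P₁' ^ p ⊕ S'` as a module over `R *ₚ R`: a pair `(a, b)` acts as `a` on `P₁' ^ p` and as `b`
on `S'`. -/
instance (p : ℕ) : Module (FiberRing R (ρ - 1) p) (D.DegreePZero ρ p) :=
  letI : Module (FiberRing R (ρ - 1) p) (D.degreePart ρ p) :=
    Module.compHom _ ((algebraMap R S).comp
      ((RingHom.fst R R).comp (FiberRing R (ρ - 1) p).subtype))
  letI : Module (FiberRing R (ρ - 1) p) (D.degreePart ρ 0) :=
    Module.compHom _ ((algebraMap R S).comp
      ((RingHom.snd R R).comp (FiberRing R (ρ - 1) p).subtype))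
  inferInstanceAs (Module (FiberRing R (ρ - 1) p) (D.degreePart ρ p × D.degreePart ρ 0))

/-- The map `P₁' ^ p ⊕ S' → U'`. -/
def DegreePZero.toU {p : ℕ} (z : D.DegreePZero ρ p) : D.UPrime ρ :=
  (z.1 : D.UPrime ρ) + (z.2 : D.UPrime ρ)

variable {D}

/-- `P(p) ^ G ≅ R *ₚ R`: the group `P(p) ^ G ⊆ P₁' ^ p ⊕ S' ⊆ U'` is an `R *ₚ R`-submodule `N` of
`P₁' ^ p ⊕ S'`, and `N` is isomorphic to `R *ₚ R` as an `R *ₚ R`-module. -/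
def PowerInvariantsTrivial (ν : D.Normalization) (p : ℕ) : Prop :=
  ∃ N : Submodule (FiberRing R (ρ - 1) p) (D.DegreePZero ρ p),
    powerInvariants ρ ν p = DegreePZero.toU D ρ '' (N : Set (D.DegreePZero ρ p)) ∧
    Nonempty (FiberRing R (ρ - 1) p ≃ₗ[FiberRing R (ρ - 1) p] N)

end SemilinearAction

/-! ### `A(1)`-modules -/

section AOneModule

variable {R S C : Type*} [CommRing R] [CommRing S] [Algebra R S] [CommGroup C]
  (σ : S ≃ₐ[R] S) (τ : C) (ρ : R) (n : ℕ)

/-- The inclusion of `S` in `A(1)`. -/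
def AOne.ofS : S →+* AOne σ τ ρ n :=
  (CrossedProduct.ofBase (sigmaOne σ τ ρ) n (tauOne τ ρ)).toRingHom.comp
    ((Ideal.Quotient.mk _).comp (algebraMap S (MonoidAlgebra S C)))

/-- The element of `A(1)` that induces `σ` on `S`. -/
def AOne.u : AOne σ τ ρ n := CrossedProduct.u (sigmaOne σ τ ρ) n (tauOne τ ρ)

/-- The image of `τ` in `A(1)`. -/
def AOne.tau : AOne σ τ ρ n := algebraMap (GroupRingOne R τ ρ) _ (tauOne τ ρ)

theorem AOne.u_mul_ofS (s : S) :
    AOne.u σ τ ρ n * AOne.ofS σ τ ρ n s = AOne.ofS σ τ ρ n (σ s) * AOne.u σ τ ρ n := by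
  have h := CrossedProduct.u_mul_ofBase (sigmaOne σ τ ρ) n (tauOne τ ρ)
    (Ideal.Quotient.mk _ (algebraMap S (MonoidAlgebra S C) s))
  have h2 : sigmaOne σ τ ρ (Ideal.Quotient.mk _ (algebraMap S (MonoidAlgebra S C) s)) =
      Ideal.Quotient.mk _ (algebraMap S (MonoidAlgebra S C) (σ s)) := by
    refine congrArg (Ideal.Quotient.mk _) (?_ : MonoidAlgebra.mapRingHom C (σ : S →+* S) _ = _)
    simp
  rw [h2] at h
  exact h

variable (P : Type*) [AddCommGroup P] [Module (AOne σ τ ρ n) P]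

/-- An `A(1)`-module is an `S`-module. -/
abbrev AOne.moduleS : Module S P := Module.compHom P (AOne.ofS σ τ ρ n)

/-- The actions of `σ` and `τ` on an `A(1)`-module. -/
def AOne.action : letI := AOne.moduleS σ τ ρ n P; SemilinearAction σ P :=
  letI := AOne.moduleS σ τ ρ n P
  { act :=
      { toFun x := AOne.u σ τ ρ n • x
        map_add' := smul_add _
        map_smul' s x := by
          change AOne.u σ τ ρ n • AOne.ofS σ τ ρ n s • x =
            AOne.ofS σ τ ρ n (σ s) • AOne.u σ τ ρ n • x
          rw [smul_smul, AOne.u_mul_ofS, mul_smul] }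
    tau :=
      { toFun x := AOne.tau σ τ ρ n • x
        map_add' := smul_add _
        map_smul' s x := by
          change AOne.tau σ τ ρ n • AOne.ofS σ τ ρ n s • x =
            AOne.ofS σ τ ρ n s • AOne.tau σ τ ρ n • x
          rw [smul_smul, smul_smul, AOne.tau, Algebra.commutes] }
    act_tau x := by
      change AOne.u σ τ ρ n • AOne.tau σ τ ρ n • x = AOne.tau σ τ ρ n • AOne.u σ τ ρ n • x
      rw [smul_smul, smul_smul, AOne.tau, Algebra.commutes] }

/-- The `A(1)`-module `P(1) = P` has a normalization for which `P(p) ^ G ≅ R *ₚ R`. -/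
def IsNormalizedWithTrivialPower (p : ℕ) : Prop :=
  letI := AOne.moduleS σ τ ρ n P
  ∃ ν : (AOne.action σ τ ρ n P).Normalization,
    SemilinearAction.PowerInvariantsTrivial ρ ν p

end AOneModule

end

end AlbertCriterion

/-! The criterion is Kummer theory carried out over a ring in which `η` need not be invertible. The
element `τ` acts on `P₁` as multiplication by `ρ`, so over `S(1/η)` the module `P₁` is the
`ρ`-eigenspace of a Kummer extension. An element of `P(1)` with images `s` and `θ` becomes `X = (θ -
s) / η`, so that `θ = s + η X` and `τ X = X + θ`. These `X` are the integral generators that the `θ`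
alone do not supply.

From a splitting module to an extension. An endomorphism of `P(1)` over `S[C](1)` is an element of
`A(1)` which centralizes `S[C](1)`, hence lies in `S[C](1)`. So `P(1)` has rank one over `S[C](1)`
(`IsSplittingModule.exists_rankOne`), and `P₁` has rank one over `S`. A generator of `P(p) ^ G` has
the form `w = (l + s) / η ^ p`. Because `η ^ (p - 1)` divides `p`, all elements `(θ ^ p - s ^ p) / η
^ p` lie in `P(p)` (`kummer_mem_power`). They are fixed by `τ`, and descent along `S / R` expresses
them through `w`. This forces `l` to generate `P₁ ^ p` and `s` to be a unit
(`exists_isKummerElement`).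

Let `T` be the subalgebra of `U'` generated by `P(1)`, modulo `w`. Division by `w` leaves a unique
remainder in `P(p - 1)`. There `τ` multiplies degree `d` by `ρ ^ d`, and `ρ ^ d - 1` is a unit times
`η` for `0 < d < p`, so the elements fixed by `τ` are those of `S`. Finally `τ ^ i X - X` is a unit
multiple of `θ`, hence the differences `t - τ ^ i t` generate an ideal containing `P₁`. It contains
the image `-s` of `l`, which is a unit, and this is the Galois condition
(`exists_ring_of_isKummerElement`, `exists_coordinates`).

From an extension to a splitting module. Take `T(1) = T / (τ - ρ)(τ - 1) T`. Traces and an element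
of trace one provide dual bases over the group rings, and `A(1)` acts as the full endomorphism ring
because `S[C](1)`-endomorphisms of `T(1)` are scalars (`exists_smul_of_linearMap`,
`lift_bijective`). The trace identifies `P₀` with `S`, and the twisted trace `∑ ρ ^ (p - 1 - i) τ ^
i` embeds `P₁` in the `ρ`-eigenspace of `T`. Both are instances of one cohomology vanishing
(`exists_of_sum_pow_smul_eq_zero`). The two traces agree modulo `η`, so `P(1)` maps into `T`.
Moreover `P₁ ^ p` is identified with `S`. If `e₀` is its element corresponding to `1`, the
invariants of `P(p)` are the elements `(a e₀ - b) / η ^ p` with `a ≡ b` modulo `η ^ p`, which is `R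
*ₚ R` (`powerInvariantsTrivial_of_algHom`). -/

namespace AlbertCriterion

open Finset

/-! ### Finitely generated projective modules -/

section DualBasis

variable {K P : Type*} [CommRing K] [AddCommGroup P] [Module K P]

theorem exists_dualBasis [Module.Finite K P] [Module.Projective K P] :
    ∃ (n : ℕ) (v : Fin n → P) (f : Fin n → P →ₗ[K] K), ∀ x, ∑ i, f i x • v i = x := by
  obtain ⟨n, g, hg⟩ := Module.Finite.exists_fin' K P
  obtain ⟨h, hh⟩ := Module.projective_lifting_property g LinearMap.id hg
  refine ⟨n, fun i => g (Pi.single i 1), fun i => LinearMap.proj i ∘ₗ h, fun x => ?_⟩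
  have h1 : g (h x) = x := LinearMap.congr_fun hh x
  conv_rhs => rw [← h1, pi_eq_sum_univ' (h x), map_sum]
  refine Finset.sum_congr rfl fun i _ => ?_
  rw [map_smul]
  rfl

theorem finite_of_dualBasis {ι : Type*} [Fintype ι] (v : ι → P) (f : ι → P →ₗ[K] K)
    (h : ∀ x, ∑ i, f i x • v i = x) : Module.Finite K P := by
  refine Module.Finite.of_surjective (Fintype.linearCombination K v) fun x => ?_
  exact ⟨fun i => f i x, by rw [Fintype.linearCombination_apply, h]⟩

theorem projective_of_dualBasis {ι : Type*} [Fintype ι] (v : ι → P) (f : ι → P →ₗ[K] K)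
    (h : ∀ x, ∑ i, f i x • v i = x) : Module.Projective K P := by
  classical
  refine Module.Projective.of_split (LinearMap.pi f) (Fintype.linearCombination K v) ?_
  ext x
  simp [Fintype.linearCombination_apply, h]

/-- The endomorphism ring of a faithful finitely generated projective module is Azumaya. -/
theorem isAzumaya_end [Module.Finite K P] [Module.Projective K P] [FaithfulSMul K P] :
    IsAzumaya K (Module.End K P) := by
  obtain ⟨n, v, f, hvf⟩ := exists_dualBasis (K := K) (P := P)
  -- The operators `E (v i) (f j)` take the place of matrix units.
  let E (x : P) (g : P →ₗ[K] K) : Module.End K P := g.smulRight x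
  have hE (a : Module.End K P) (x : P) (g : P →ₗ[K] K) : a * E x g = E (a x) g := by
    ext y; simp [E]
  have hE' (g h : P →ₗ[K] K) (x y : P) : E x g * E y h = g y • E x h := by
    ext z; simp [E, smul_smul, mul_comm]
  have hone : ∑ j, E (v j) (f j) = 1 := by
    ext x; simpa [E, LinearMap.sum_apply] using hvf x
  have hdecomp (a : Module.End K P) : ∑ ij : Fin n × Fin n, f ij.1 (a (v ij.2)) •
      E (v ij.1) (f ij.2) = a := by
    rw [Fintype.sum_prod_type, Finset.sum_comm]
    calc _ = ∑ j, a * E (v j) (f j) := Finset.sum_congr rfl fun j _ => by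
            rw [hE]
            conv_rhs => rw [← hvf (a (v j))]
            ext y
            simp [E, Finset.smul_sum, LinearMap.sum_apply, smul_smul, mul_comm]
      _ = a := by rw [← Finset.mul_sum, hone, mul_one]
  let F (ij : Fin n × Fin n) : Module.End K P →ₗ[K] K :=
    f ij.1 ∘ₗ LinearMap.applyₗ (v ij.2)
  have hF (a) : ∑ ij, F ij a • E (v ij.1) (f ij.2) = a := hdecomp a
  have h1 := finite_of_dualBasis _ F hF
  have h2 := projective_of_dualBasis _ F hF
  have h3 : FaithfulSMul K (Module.End K P) := ⟨fun {a b} hab => by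
    refine FaithfulSMul.eq_of_smul_eq_smul (α := P) fun x => ?_
    simpa using LinearMap.congr_fun (hab 1) x⟩
  have hscalar (a : Module.End K P) (i j : Fin n) :
      ∑ l, E (v l) (f i) * a * E (v j) (f l) = f i (a (v j)) • 1 := by
    rw [← hone, Finset.smul_sum]
    refine Finset.sum_congr rfl fun l _ => ?_
    rw [mul_assoc, hE, hE']
  refine { h1, h2, h3 with bij := ?_ }
  rw [Function.bijective_iff_has_inverse]
  -- The inverse is the one for matrix algebras. It works because, by `hscalar`, summing `E (v l) (f
  -- i) * a * E (v j) (f l)` over `l` extracts the matrix entry `f i (a (v j))` as a scalar.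
  refine ⟨fun ξ => ∑ i, ∑ j, ∑ l, E (v l) (f i) ⊗ₜ
    MulOpposite.op (E (v j) (f l) * ξ (E (v i) (f j))), fun z => ?_, fun ξ => ?_⟩
  · induction z using TensorProduct.induction_on with
    | zero => simp
    | add x y hx hy =>
      simp only [map_add, LinearMap.add_apply, mul_add, MulOpposite.op_add,
        TensorProduct.tmul_add, Finset.sum_add_distrib] at hx hy ⊢
      rw [hx, hy]
    | tmul a b =>
      simp only [AlgHom.mulLeftRight_apply]
      have h (i j l : Fin n) : E (v j) (f l) * (a * E (v i) (f j) * b.unop) =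
          f l (a (v i)) • (E (v j) (f j) * b.unop) := by
        rw [← mul_assoc, hE, hE', smul_mul_assoc]
      simp only [h, MulOpposite.op_smul, TensorProduct.tmul_smul]
      have h' (i : Fin n) : ∑ j, ∑ l, f l (a (v i)) •
          (E (v l) (f i) ⊗ₜ[K] MulOpposite.op (E (v j) (f j) * b.unop)) =
          (∑ l, f l (a (v i)) • E (v l) (f i)) ⊗ₜ[K] b := by
        rw [Finset.sum_comm, TensorProduct.sum_tmul]
        refine Finset.sum_congr rfl fun l _ => ?_
        rw [← Finset.smul_sum, ← TensorProduct.tmul_sum, ← TensorProduct.smul_tmul',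
          ← Finset.op_sum, ← Finset.sum_mul, hone, one_mul, MulOpposite.op_unop]
      rw [Finset.sum_congr rfl fun i _ => h' i, ← TensorProduct.sum_tmul]
      congr 1
      conv_rhs => rw [← hdecomp a, Fintype.sum_prod_type, Finset.sum_comm]
  · ext1 x
    simp only [map_sum, LinearMap.sum_apply, AlgHom.mulLeftRight_apply, MulOpposite.unop_op]
    have h (i j : Fin n) : ∑ l, E (v l) (f i) * x * (E (v j) (f l) * ξ (E (v i) (f j))) =
        f i (x (v j)) • ξ (E (v i) (f j)) := by
      simp_rw [← mul_assoc (_ * x)]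
      rw [← Finset.sum_mul, hscalar, smul_mul_assoc, one_mul]
    simp_rw [h]
    conv_rhs => rw [← hdecomp x, map_sum, Fintype.sum_prod_type]
    simp_rw [map_smul]

/-- A faithful finitely generated projective module all of whose endomorphisms are scalars has
rank one. -/
theorem rankOne_of_scalar_endomorphisms [FaithfulSMul K P]
    (hend : ∀ h : P →ₗ[K] P, ∃ k : K, ∀ x, h x = k • x)
    {ι : Type*} [Fintype ι] (v : ι → P) (f : ι → P →ₗ[K] K) (hvf : ∀ x, ∑ i, f i x • v i = x) :
    (∀ (g : P →ₗ[K] K) (x y : P), g x • y = g y • x) ∧ ∑ i, f i (v i) = 1 := by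
  have hinj {a b : K} (h : ∀ x : P, a • x = b • x) : a = b := FaithfulSMul.eq_of_smul_eq_smul h
  -- The scalar `e g z` by which `x ↦ g x • z` acts is a substitute for `g z`. The two differ by the
  -- trace `n` of the identity (`h4`), so they agree once `n = 1` is known.
  choose e he using fun (g : P →ₗ[K] K) (z : P) => hend (g.smulRight z)
  simp only [LinearMap.smulRight_apply] at he
  have h1 (g g' : P →ₗ[K] K) (z z' : P) : e g z * e g' z' = g z' * e g' z := hinj fun x => by
    rw [mul_smul, ← he, ← he, mul_smul, ← he, map_smul, smul_smul, smul_eq_mul, mul_comm, mul_smul]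
  have h2 (g g' : P →ₗ[K] K) (z z' : P) : g z' * e g' z = g' z * e g z' := by
    rw [← h1, ← h1, mul_comm]
  have h3 : ∑ i, e (f i) (v i) = 1 := hinj fun x => by
    rw [Finset.sum_smul, one_smul]
    simp_rw [← he]
    exact hvf x
  set n := ∑ i, f i (v i) with hn
  have h4 (g : P →ₗ[K] K) (z : P) : g z = n * e g z := by
    rw [hn, Finset.sum_mul]
    simp_rw [← h2 g]
    rw [← Finset.mul_sum, h3, mul_one]
  have h5 (g : P →ₗ[K] K) (y z : P) : g z • y = n • g y • z := by
    rw [h4, mul_smul, he]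
  -- The trace ideal `I` satisfies `P = I P`. By Nakayama some `t ≡ 1` modulo `I` kills `P`, and `t
  -- = 0` by faithfulness.
  have h6 : Ideal.span (Set.range fun gz : (P →ₗ[K] K) × P => gz.1 gz.2) = ⊤ := by
    set I := Ideal.span (Set.range fun gz : (P →ₗ[K] K) × P => gz.1 gz.2)
    have hfin : Module.Finite K P := finite_of_dualBasis v f hvf
    obtain ⟨t, ht, ht'⟩ := Submodule.exists_sub_one_mem_and_smul_eq_zero_of_fg_of_le_smul I
      (⊤ : Submodule K P) hfin.fg_top (fun x _ => by
        rw [← hvf x]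
        exact Submodule.sum_mem _ fun i _ => Submodule.smul_mem_smul
          (Ideal.subset_span ⟨(f i, x), rfl⟩) trivial)
    have : t = 0 := hinj fun x => by rw [ht' x trivial, zero_smul]
    rw [this, zero_sub] at ht
    rw [Ideal.eq_top_iff_one]
    simpa using I.neg_mem ht
  -- Applying `g` to `h5` with `y = z` shows that `1 - n` kills every square `(g z) ^ 2`; these
  -- squares generate the unit ideal along with the `g z`.
  have h7 : n = 1 := by
    have h8 := Ideal.span_pow_eq_top _ h6 2
    have h9 : ∀ a ∈ Ideal.span ((fun x : K => x ^ 2) ''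
        Set.range fun gz : (P →ₗ[K] K) × P => gz.1 gz.2), (1 - n) * a = 0 := by
      intro a ha
      refine Submodule.span_induction ?_ (mul_zero _) ?_ ?_ ha
      · rintro _ ⟨_, ⟨⟨g, z⟩, rfl⟩, rfl⟩
        have := congrArg g (h5 g z z)
        simp only [map_smul, smul_eq_mul] at this
        linear_combination this
      · intro a b _ _ ha hb
        rw [mul_add, ha, hb, add_zero]
      · intro c a _ ha
        rw [smul_eq_mul, mul_left_comm, ha, mul_zero]
    have := h9 1 (by rw [h8]; trivial)
    linear_combination -this
  refine ⟨fun g x y => ?_, h7⟩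
  rw [h5, h7, one_smul]

end DualBasis

/-! ### Cyclic crossed products -/

section Crossed

variable {K B : Type*} [CommRing K] [CommRing B] [Algebra K B] (φ : B →ₐ[K] B) (n : ℕ) (a : K)

theorem CrossedProduct.u_pow : u φ n a ^ n = algebraMap K _ a := by
  have h := RingQuot.mkAlgHom_rel K (CrossedRel.pow (K := K) (B := B) (φ := φ) (n := n) (a := a))
  rwa [map_pow, AlgHom.commutes] at h

theorem CrossedProduct.u_pow_mul_ofBase (i : ℕ) (b : B) :
    u φ n a ^ i * ofBase φ n a b = ofBase φ n a ((φ ^ i) b) * u φ n a ^ i := by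
  induction i generalizing b with
  | zero => simp
  | succ i ih =>
    rw [pow_succ, mul_assoc, u_mul_ofBase, ← mul_assoc, ih, mul_assoc, ← pow_succ]
    rfl

/-- The sums of this shape contain `1` and are stable under left multiplication by the generators.
Multiplication by `u` shifts the coefficients, and the top one returns to position `0` multiplied by
`u ^ n = a`. -/
theorem CrossedProduct.exists_eq_sum (hn : 0 < n) (z : CrossedProduct K B φ n a) :
    ∃ b : ℕ → B, z = ∑ i ∈ range n, ofBase φ n a (b i) * u φ n a ^ i := by
  set V := {z | ∃ b : ℕ → B, z = ∑ i ∈ range n, ofBase φ n a (b i) * u φ n a ^ i} with hV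
  have hadd {x y} (hx : x ∈ V) (hy : y ∈ V) : x + y ∈ V := by
    obtain ⟨b, rfl⟩ := hx
    obtain ⟨c, rfl⟩ := hy
    exact ⟨fun i => b i + c i, by simp [add_mul, Finset.sum_add_distrib]⟩
  have hbase (c : B) {x} (hx : x ∈ V) : ofBase φ n a c * x ∈ V := by
    obtain ⟨b, rfl⟩ := hx
    exact ⟨fun i => c * b i, by simp [Finset.mul_sum, mul_assoc]⟩
  have hu {x} (hx : x ∈ V) : u φ n a * x ∈ V := by
    obtain ⟨b, rfl⟩ := hx
    obtain ⟨m, rfl⟩ : ∃ m, n = m + 1 := ⟨n - 1, by omega⟩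
    refine ⟨fun i => if i = 0 then algebraMap K B a * φ (b m) else φ (b (i - 1)), ?_⟩
    rw [Finset.mul_sum, Finset.sum_range_succ, Finset.sum_range_succ']
    congr 1
    · refine Finset.sum_congr rfl fun i _ => ?_
      rw [← mul_assoc, u_mul_ofBase, mul_assoc, ← pow_succ']
      simp
    · rw [← mul_assoc, u_mul_ofBase, mul_assoc, ← pow_succ', u_pow]
      simp [Algebra.commutes]
  have hone : (1 : CrossedProduct K B φ n a) ∈ V := by
    refine ⟨fun i => if i = 0 then 1 else 0, ?_⟩
    rw [Finset.sum_eq_single 0] <;> simp +contextual [hn.ne']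
  obtain ⟨w, rfl⟩ := RingQuot.mkAlgHom_surjective K _ z
  suffices h : ∀ x ∈ V, RingQuot.mkAlgHom K (CrossedRel K B φ n a) w * x ∈ V by
    have := h 1 hone
    rwa [mul_one] at this
  induction w using FreeAlgebra.induction with
  | grade0 k =>
    intro x hx
    have := hbase (algebraMap K B k) hx
    rwa [AlgHom.commutes] at this ⊢
  | grade1 o =>
    intro x hx
    cases o with
    | none => exact hu hx
    | some b => exact hbase b hx
  | mul c d hc hd =>
    intro x hx
    rw [map_mul, mul_assoc]
    exact hc _ (hd _ hx)
  | add c d hc hd =>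
    intro x hx
    rw [map_add, add_mul]
    exact hadd (hc _ hx) (hd _ hx)

variable {φ n a}

/-- The universal property of the cyclic crossed product. -/
noncomputable def CrossedProduct.lift {A : Type*} [Ring A] [Algebra K A] (f : B →ₐ[K] A) (v : A)
    (hskew : ∀ b, v * f b = f (φ b) * v) (hpow : v ^ n = algebraMap K A a) :
    CrossedProduct K B φ n a →ₐ[K] A :=
  RingQuot.liftAlgHom K ⟨FreeAlgebra.lift K fun o => Option.elim o v f, by
    rintro x y (⟨b, c⟩ | ⟨b, c⟩ | k | b | _) <;> simp [hskew, hpow]⟩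

@[simp] theorem CrossedProduct.lift_u {A : Type*} [Ring A] [Algebra K A] (f : B →ₐ[K] A) (v : A)
    (hskew : ∀ b, v * f b = f (φ b) * v) (hpow : v ^ n = algebraMap K A a) :
    CrossedProduct.lift f v hskew hpow (u φ n a) = v := by
  simp [lift, u]

@[simp] theorem CrossedProduct.lift_ofBase {A : Type*} [Ring A] [Algebra K A] (f : B →ₐ[K] A)
    (v : A) (hskew : ∀ b, v * f b = f (φ b) * v) (hpow : v ^ n = algebraMap K A a) (b : B) :
    CrossedProduct.lift f v hskew hpow (ofBase φ n a b) = f b :=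
  (RingQuot.liftAlgHom_mkAlgHom_apply K _ _ _).trans (by simp)

end Crossed

/-! ### Roots of the cyclotomic polynomial -/

section Cyclotomic

variable {R : Type*} [CommRing R] {p : ℕ} {ρ : R}

theorem pow_eq_one_of_isRoot_cyclotomic (hρ : (Polynomial.cyclotomic p R).IsRoot ρ) :
    ρ ^ p = 1 := by
  obtain ⟨q, hq⟩ := Polynomial.cyclotomic.dvd_X_pow_sub_one p R
  have := congrArg (Polynomial.eval ρ) hq
  rw [Polynomial.eval_mul, hρ.eq_zero] at this
  simpa [sub_eq_zero] using this

/-- In `ℤ[ζ]` one has `p = Φ_p(1) = ∏ (1 - μ)` over the `p - 1` primitive roots `μ = ζ ^ i`, and `ζ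
- 1` divides each factor. The divisibility is then transported along `ζ ↦ ρ`, since `R` need not be
a domain. -/
theorem sub_one_pow_dvd_of_isRoot_cyclotomic (hp : p.Prime)
    (hρ : (Polynomial.cyclotomic p R).IsRoot ρ) : (ρ - 1) ^ (p - 1) ∣ (p : R) := by
  have : Fact p.Prime := ⟨hp⟩
  have : Fact (Irreducible (Polynomial.cyclotomic p ℚ)) :=
    ⟨Polynomial.cyclotomic.irreducible_rat hp.pos⟩
  have hirr : Irreducible (Polynomial.cyclotomic p ℤ) := Polynomial.cyclotomic.irreducible hp.pos
  let Z := AdjoinRoot (Polynomial.cyclotomic p ℤ)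
  have : IsDomain Z := AdjoinRoot.isDomain_of_prime hirr.prime
  have hinj : Function.Injective (algebraMap ℤ Z) := by
    refine AdjoinRoot.of.injective_of_degree_ne_zero ?_
    rw [Polynomial.degree_cyclotomic]
    exact_mod_cast (Nat.totient_pos.2 hp.pos).ne'
  have : CharZero Z := ⟨fun a b hab => by
    have := @hinj a b (by simpa using hab)
    exact_mod_cast this⟩
  let ζ : Z := AdjoinRoot.root (Polynomial.cyclotomic p ℤ)
  have hroot : (Polynomial.cyclotomic p Z).IsRoot ζ := by
    have := AdjoinRoot.isRoot_root (Polynomial.cyclotomic p ℤ)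
    rwa [Polynomial.map_cyclotomic] at this
  have hpZ : NeZero (p : Z) := ⟨by exact_mod_cast hp.ne_zero⟩
  have hζ : IsPrimitiveRoot ζ p := Polynomial.isRoot_cyclotomic_iff.1 hroot
  have hdvd : (ζ - 1) ^ (p - 1) ∣ (p : Z) := by
    have h1 := congrArg (Polynomial.eval 1) (Polynomial.cyclotomic_eq_prod_X_sub_primitiveRoots hζ)
    rw [Polynomial.eval_one_cyclotomic_prime, Polynomial.eval_prod] at h1
    rw [h1, ← Nat.totient_prime hp, ← hζ.card_primitiveRoots, ← Finset.prod_const]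
    refine Finset.prod_dvd_prod_of_dvd _ _ fun μ hμ => ?_
    obtain ⟨i, -, -, rfl⟩ := hζ.isPrimitiveRoot_iff.1
      ((mem_primitiveRoots hp.pos).1 hμ)
    rw [← dvd_neg]
    simpa using sub_one_dvd_pow_sub_one ζ i
  let f : Z →+* R := AdjoinRoot.lift (Int.castRingHom R) ρ (by
    rw [← Polynomial.eval_map, Polynomial.map_cyclotomic]; exact hρ)
  have := map_dvd f hdvd
  rw [map_pow, map_sub, map_one, map_natCast] at this
  rwa [show f ζ = ρ from AdjoinRoot.lift_root _] at this

/-- Choose `j` with `i j ≡ 1` modulo `p`. The geometric sums of `ρ` up to `i` and of `ρ ^ i` up to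
`j` multiply `ρ - 1` to `ρ ^ (i j) - 1 = ρ - 1`, and `ρ - 1` cancels. -/
theorem isUnit_geom_sum (hp : p.Prime) (hρ : (Polynomial.cyclotomic p R).IsRoot ρ)
    (hη : ρ - 1 ∈ nonZeroDivisors R) {i : ℕ} (hi : 0 < i) (hip : i < p) :
    IsUnit (∑ j ∈ range i, ρ ^ j) := by
  have hcop : i.Coprime p :=
    Nat.coprime_comm.1 ((Nat.Prime.coprime_iff_not_dvd hp).2 (Nat.not_dvd_of_pos_of_lt hi hip))
  obtain ⟨j, -, hj⟩ := Nat.exists_mul_mod_eq_one_of_coprime hcop hp.one_lt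
  refine IsUnit.of_mul_eq_one (∑ k ∈ range j, (ρ ^ i) ^ k) ?_
  refine mul_cancel_right_mem_nonZeroDivisors hη |>.1 ?_
  rw [mul_right_comm, geom_sum_mul, mul_comm, geom_sum_mul, ← pow_mul, one_mul, ← Nat.mod_add_div
    (i * j) p, hj, pow_add, pow_mul, pow_eq_one_of_isRoot_cyclotomic hρ]
  simp

end Cyclotomic

/-! ### Galois extensions -/

section Galois

variable {G R T : Type*} [Group G] [CommRing R] [CommRing T] [Algebra R T]
  [MulSemiringAction G T]

theorem sum_smul_mul_of_coordinates {ι : Type*} [Fintype ι] {x y : ι → T}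
    (h0 : ∑ i, x i * y i = 1) (h1 : ∀ g : G, g ≠ 1 → ∑ i, x i * g • y i = 0) :
    (∑ i, y i * x i = 1) ∧ ∀ g : G, g ≠ 1 → ∑ i, y i * g • x i = 0 := by
  refine ⟨by simpa only [mul_comm] using h0, fun g hg => ?_⟩
  have := congrArg (g • ·) (h1 g⁻¹ (inv_ne_one.2 hg))
  simpa [Finset.smul_sum, smul_mul', mul_comm] using this

/-- When the trace is expanded, the coordinate relations kill every summand except `g = 1`. Thus the
`x i` generate `T`, with coordinate functions `t ↦ tr (t * y i)`. -/
theorem sum_trace_mul [Fintype G] {tr : T → R}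
    (htr : ∀ t, algebraMap R T (tr t) = ∑ g : G, g • t) {ι : Type*} [Fintype ι] {x y : ι → T}
    (h0 : ∑ i, x i * y i = 1) (h1 : ∀ g : G, g ≠ 1 → ∑ i, x i * g • y i = 0) (t : T) :
    ∑ i, algebraMap R T (tr (t * y i)) * x i = t := by
  classical
  simp_rw [htr, Finset.sum_mul]
  rw [Finset.sum_comm, Finset.sum_eq_single 1]
  · simp_rw [one_smul, mul_assoc, ← Finset.mul_sum, mul_comm (y _), h0, mul_one]
  · intro g _ hg
    simp_rw [smul_mul', mul_assoc, ← Finset.mul_sum, mul_comm (g • y _), h1 g hg, mul_zero]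
  · simp

variable [SMulCommClass G R T]

theorem IsGaloisExtension.exists_trace [Fintype G] (h : IsGaloisExtension G R T) :
    ∃ tr : T →ₗ[R] R, ∀ t, algebraMap R T (tr t) = ∑ g : G, g • t := by
  have hfix (t : T) : ∑ g : G, g • t ∈ Set.range (algebraMap R T) := h.fixed _ fun g => by
    rw [Finset.smul_sum]
    simp_rw [smul_smul]
    exact Fintype.sum_equiv (Equiv.mulLeft g) _ _ fun _ => rfl
  choose tr htr using hfix
  refine ⟨⟨⟨tr, fun s t => h.injective ?_⟩, fun r t => h.injective ?_⟩, htr⟩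
  · simp [htr, Finset.sum_add_distrib]
  · simp only [RingHom.id_apply, smul_eq_mul, map_mul, htr, Finset.mul_sum]
    refine Finset.sum_congr rfl fun g _ => ?_
    rw [smul_comm, Algebra.smul_def]

/-- By `sum_trace_mul` the image `I` of the trace satisfies `T = I T`. Nakayama gives some `t ≡ 1`
modulo `I` which kills `T`, and `t = 0` because `R` embeds in `T`. -/
theorem IsGaloisExtension.exists_trace_eq_one [Fintype G] (h : IsGaloisExtension G R T)
    {tr : T →ₗ[R] R} (htr : ∀ t, algebraMap R T (tr t) = ∑ g : G, g • t) : ∃ w, tr w = 1 := by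
  obtain ⟨n, x, y, h0, h1⟩ := h.coordinates
  have hsum := sum_trace_mul htr h0 h1
  have hfin : Module.Finite R T := by
    refine Module.Finite.of_surjective (Fintype.linearCombination R x) fun t => ?_
    exact ⟨fun i => tr (t * y i), by
      rw [Fintype.linearCombination_apply]; simpa [Algebra.smul_def] using hsum t⟩
  obtain ⟨t, ht, ht'⟩ := Submodule.exists_sub_one_mem_and_smul_eq_zero_of_fg_of_le_smul
      (LinearMap.range tr) (⊤ : Submodule R T) hfin.fg_top (fun t _ => by
        rw [← hsum t]
        refine Submodule.sum_mem _ fun i _ => ?_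
        rw [← Algebra.smul_def]
        exact Submodule.smul_mem_smul (LinearMap.mem_range_self _ _) trivial)
  have h2 : t = 0 := h.injective (by
    have := ht' 1 trivial
    rw [Algebra.smul_def, mul_one] at this
    rw [this, map_zero])
  rw [h2, zero_sub] at ht
  obtain ⟨w, hw⟩ := ht
  exact ⟨-w, by rw [map_neg, hw, neg_neg]⟩

/-- An element of `T` is determined by its coordinates `tr (t * y i)`, and these lie in `R`. -/
theorem IsGaloisExtension.regular (h : IsGaloisExtension G R T) {e : R}
    (he : e ∈ nonZeroDivisors R) : algebraMap R T e ∈ nonZeroDivisors T := by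
  have := h.finite
  have := Fintype.ofFinite G
  obtain ⟨tr, htr⟩ := h.exists_trace
  obtain ⟨n, x, y, h0, h1⟩ := h.coordinates
  rw [mem_nonZeroDivisors_iff_right]
  intro t ht
  rw [← sum_trace_mul htr h0 h1 t]
  refine Finset.sum_eq_zero fun i _ => ?_
  have : tr (t * y i) * e = 0 := by
    rw [mul_comm, ← smul_eq_mul, ← map_smul, Algebra.smul_def, ← mul_assoc, mul_comm _ t, ht,
      zero_mul, map_zero]
  rw [(mem_nonZeroDivisors_iff_right.1 he) _ this, map_zero, zero_mul]

/-- If for every `g ≠ 1` the elements `t - g t` generate the unit ideal, then there are Galois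
coordinates. -/
theorem exists_coordinates {G T : Type*} [Group G] [Finite G] [CommRing T]
    [MulSemiringAction G T]
    (h : ∀ g : G, g ≠ 1 → Ideal.span (Set.range fun t : T => t - g • t) = ⊤) :
    ∃ (n : ℕ) (x y : Fin n → T),
      (∑ i, x i * y i = 1) ∧ ∀ g : G, g ≠ 1 → ∑ i, x i * g • y i = 0 := by
  classical
  have := Fintype.ofFinite G
  have hone (g : G) (hg : g ≠ 1) : ∃ (n : ℕ) (x y : Fin n → T),
      (∑ i, x i * y i = 1) ∧ ∑ i, x i * g • y i = 0 := by
    have h1 : (1 : T) ∈ Ideal.span (Set.range fun t : T => t - g • t) := by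
      rw [h g hg]; trivial
    obtain ⟨c, hc⟩ := Finsupp.mem_ideal_span_range_iff_exists_finsupp.1 h1
    let E := (c.support.equivFin).symm
    have hE (f : T → T) : ∑ i, f (E i) = ∑ t ∈ c.support, f t := by
      rw [E.sum_comp (fun t : c.support => f t), Finset.sum_coe_sort]
    -- From `1 = ∑ c t * (t - g • t)`: one extra pair, with second entry `1`, subtracts `∑ c t * g •
    -- t` from both sums.
    refine ⟨c.support.card + 1, Fin.cons (-∑ t ∈ c.support, c t * g • t) fun i => c (E i),
      Fin.cons 1 fun i => E i, ?_, ?_⟩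
    · rw [Fin.sum_univ_succ]
      simp only [Fin.cons_zero, Fin.cons_succ]
      rw [hE fun t => c t * t, mul_one, neg_add_eq_sub, ← Finset.sum_sub_distrib]
      simpa only [mul_sub, Finsupp.sum] using hc
    · rw [Fin.sum_univ_succ]
      simp only [Fin.cons_zero, Fin.cons_succ, smul_one]
      rw [hE fun t => c t * g • t]
      ring
  have hF (F : Finset G) (hF : 1 ∉ F) : ∃ (n : ℕ) (x y : Fin n → T),
      (∑ i, x i * y i = 1) ∧ ∀ g ∈ F, ∑ i, x i * g • y i = 0 := by
    induction F using Finset.induction_on with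
    | empty => exact ⟨1, fun _ => 1, fun _ => 1, by simp⟩
    | insert a F ha ih =>
      obtain ⟨n, x, y, h0, h1⟩ := ih (fun h => hF (Finset.mem_insert_of_mem h))
      obtain ⟨m, x', y', h0', h1'⟩ := hone a (fun h => hF (by simp [h]))
      -- Multiplying two coordinate systems multiplies their sums, so the product system vanishes
      -- wherever one of the factors does.
      have key (g : G) : ∑ i, (x (finProdFinEquiv.symm i).1 * x' (finProdFinEquiv.symm i).2) *
          g • (y (finProdFinEquiv.symm i).1 * y' (finProdFinEquiv.symm i).2) =
          (∑ i, x i * g • y i) * ∑ i, x' i * g • y' i := by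
        rw [finProdFinEquiv.symm.sum_comp (fun i : Fin n × Fin m => (x i.1 * x' i.2) *
          g • (y i.1 * y' i.2)), Fintype.sum_prod_type, Finset.sum_mul_sum]
        refine Finset.sum_congr rfl fun i _ => Finset.sum_congr rfl fun j _ => ?_
        rw [smul_mul']
        ring
      refine ⟨n * m, fun i => x (finProdFinEquiv.symm i).1 * x' (finProdFinEquiv.symm i).2,
        fun i => y (finProdFinEquiv.symm i).1 * y' (finProdFinEquiv.symm i).2, ?_, fun g hg => ?_⟩
      · have := key 1
        simpa [h0, h0'] using this
      · rw [key]
        rcases Finset.mem_insert.1 hg with rfl | hg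
        · rw [h1', mul_zero]
        · rw [h1 g hg, zero_mul]
  obtain ⟨n, x, y, h0, h1⟩ := hF (Finset.univ.erase 1) (by simp)
  exact ⟨n, x, y, h0, fun g hg => h1 g (by simp [hg])⟩

theorem sum_range_pow_eq_sum_univ {G M : Type*} [Group G] [Fintype G] [AddCommMonoid M] {σ : G}
    (hσ : ∀ g : G, g ∈ Subgroup.zpowers σ) (f : G → M) :
    ∑ i ∈ range (Fintype.card G), f (σ ^ i) = ∑ g, f g := by
  classical
  rw [← Nat.card_eq_fintype_card, ← orderOf_eq_card_of_forall_mem_zpowers hσ, ← IsCyclic.image_range_orderOf hσ,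
    Finset.sum_image]
  intro i hi j hj hij
  exact pow_injOn_Iio_orderOf (by simpa using hi) (by simpa using hj) hij

end Galois

/-! ### The graded ring `S'[M']` -/

namespace SymLoc

variable {S : Type*} [CommRing S] (M : Type*) [AddCommGroup M] [Module S M] (e : S)

/-- The inclusion of `M` in `S'[M']`. -/
noncomputable def ι : M →ₗ[S] SymLoc M e :=
  (IsScalarTower.toAlgHom S (SymmetricAlgebra S M) (SymLoc M e)).toLinearMap ∘ₗ
    SymmetricAlgebra.ι S M

variable {M e}

theorem inv_pow_mul_pow (k : ℕ) : inv M e ^ k * algebraMap S (SymLoc M e) e ^ k = 1 := by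
  rw [← mul_pow, inv_mul, one_pow]

theorem ringHom_ext {A : Type*} [CommRing A] {f g : SymLoc M e →+* A}
    (hS : ∀ s : S, f (algebraMap S _ s) = g (algebraMap S _ s))
    (hM : ∀ y : M, f (ι M e y) = g (ι M e y)) : f = g := by
  refine IsLocalization.ringHom_ext
    (Submonoid.powers (algebraMap S (SymmetricAlgebra S M) e)) ?_
  refine RingHom.ext fun z => ?_
  induction z using SymmetricAlgebra.induction with
  | algebraMap s => exact hS s
  | ι y => exact hM y
  | mul a b ha hb => rw [map_mul, map_mul, ha, hb]
  | add a b ha hb => rw [map_add, map_add, ha, hb]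

theorem map_inv_of_map_algebraMap {A : Type*} [CommRing A] (f : SymLoc M e →+* A) {c : A}
    (h : c * f (algebraMap S _ e) = 1) : f (inv M e) = c := by
  have h' := congrArg f (inv_mul M e)
  rw [map_mul, map_one] at h'
  linear_combination (-f (inv M e)) * h + c * h'

section Lift

variable {A : Type*} [CommRing A] [Algebra S A] (l : M →ₗ[S] A)
  (he : IsUnit (algebraMap S A e))

/-- The universal property of `S'[M']`. -/
noncomputable def lift : SymLoc M e →ₐ[S] A :=
  { IsLocalization.Away.lift (S := SymLoc M e) (algebraMap S (SymmetricAlgebra S M) e)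
      (g := (SymmetricAlgebra.lift l : SymmetricAlgebra S M →ₐ[S] A).toRingHom)
      (by simpa using he) with
    commutes' s := by
      change IsLocalization.Away.lift (S := SymLoc M e) _ _
        (algebraMap (SymmetricAlgebra S M) _ (algebraMap S _ s)) = _
      rw [IsLocalization.Away.lift_eq]
      simp }

@[simp] theorem lift_ι (y : M) : lift l he (ι M e y) = l y := by
  refine (IsLocalization.Away.lift_eq (S := SymLoc M e) (algebraMap S (SymmetricAlgebra S M) e)
    (g := (SymmetricAlgebra.lift l : SymmetricAlgebra S M →ₐ[S] A).toRingHom)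
    (by simpa using he) (SymmetricAlgebra.ι S M y)).trans ?_
  simp

end Lift

theorem isUnit_algebraMap : IsUnit (algebraMap S (SymLoc M e) e) :=
  IsUnit.of_mul_eq_one_right _ (inv_mul M e)

theorem isUnit_algebraMap_polynomial :
    IsUnit (algebraMap S (Polynomial (SymLoc M e)) e) :=
  (isUnit_algebraMap (M := M) (e := e)).map Polynomial.C

theorem algebraMap_injective (he : e ∈ nonZeroDivisors S) :
    Function.Injective (algebraMap S (SymLoc M e)) := by
  have h1 : IsUnit (algebraMap S (Localization.Away e) e) :=
    IsLocalization.Away.algebraMap_isUnit e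
  have h2 : Function.Injective (algebraMap S (Localization.Away e)) :=
    IsLocalization.injective _ (Submonoid.powers_le.2 he)
  intro a b hab
  have := congrArg (lift (M := M) (0 : M →ₗ[S] Localization.Away e) h1) hab
  rw [AlgHom.commutes, AlgHom.commutes] at this
  exact h2 this

variable (M e)

/-- The grading of `S'[M']`: the homomorphism to `S'[M'][X]` which multiplies the elements of
degree `d` by `X ^ d`. -/
noncomputable def grade : SymLoc M e →ₐ[S] Polynomial (SymLoc M e) :=
  lift (LinearMap.mulRight S (Polynomial.X : Polynomial (SymLoc M e)) ∘ₗ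
    (Polynomial.CAlgHom (R := S) (A := SymLoc M e)).toLinearMap ∘ₗ ι M e)
    isUnit_algebraMap_polynomial

/-- The component of degree `d`. -/
noncomputable def component (d : ℕ) : SymLoc M e →ₗ[S] SymLoc M e :=
  (Polynomial.lcoeff (SymLoc M e) d).restrictScalars S ∘ₗ (grade M e).toLinearMap

variable {M e}

theorem component_apply (d : ℕ) (z : SymLoc M e) : component M e d z = (grade M e z).coeff d := rfl

@[simp] theorem grade_ι (y : M) : grade M e (ι M e y) = Polynomial.C (ι M e y) * Polynomial.X := by
  simp [grade]

theorem grade_algebraMap (s : S) : grade M e (algebraMap S _ s) = Polynomial.C (algebraMap S _ s) :=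
  AlgHom.commutes _ _

@[simp] theorem grade_inv : grade M e (inv M e) = Polynomial.C (inv M e) := by
  refine map_inv_of_map_algebraMap (grade M e).toRingHom ?_
  change Polynomial.C (inv M e) * grade M e (algebraMap S _ e) = 1
  rw [grade_algebraMap, ← Polynomial.C_mul, inv_mul, Polynomial.C_1]

theorem eval_one_grade (z : SymLoc M e) : Polynomial.eval 1 (grade M e z) = z := by
  have : (Polynomial.evalRingHom (1 : SymLoc M e)).comp (grade M e).toRingHom = RingHom.id _ :=
    ringHom_ext (fun s => by simp) (fun y => by simp)
  exact RingHom.congr_fun this z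

theorem sum_component (z : SymLoc M e) {k : ℕ} (hk : (grade M e z).natDegree ≤ k) :
    ∑ d ∈ range (k + 1), component M e d z = z := by
  conv_rhs => rw [← eval_one_grade z, Polynomial.eval_eq_sum_range' (Nat.lt_succ_of_le hk)]
  simp [component_apply]

/-- The endomorphism which multiplies the elements of degree `d` by `c ^ d`. -/
noncomputable def scale (c : SymLoc M e) : SymLoc M e →+* SymLoc M e :=
  (Polynomial.evalRingHom c).comp (grade M e).toRingHom

theorem scale_algebraMap (c : SymLoc M e) (s : S) :
    scale c (algebraMap S _ s) = algebraMap S (SymLoc M e) s := by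
  simp [scale]

theorem scale_ι (c : SymLoc M e) (y : M) : scale c (ι M e y) = ι M e y * c := by
  simp [scale]

theorem component_scale (c : S) (d : ℕ) (z : SymLoc M e) :
    component M e d (scale (algebraMap S _ c) z) = component M e d z * algebraMap S _ c ^ d := by
  have : (grade M e).toRingHom.comp (scale (algebraMap S _ c)) =
      (Polynomial.compRingHom (Polynomial.C (algebraMap S _ c) * Polynomial.X)).comp
        (grade M e).toRingHom := by
    refine ringHom_ext (fun s => by simp [scale]) (fun y => ?_)
    simp [scale]
    rw [mul_right_comm, mul_assoc]
  have h := congrArg (Polynomial.coeff · d) (RingHom.congr_fun this z)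
  simpa [component_apply, Polynomial.comp_C_mul_X_coeff] using h

theorem grade_of_mem_pow {d : ℕ} {z : SymLoc M e} (hz : z ∈ LinearMap.range (ι M e) ^ d) :
    grade M e z = Polynomial.C z * Polynomial.X ^ d := by
  induction hz using Submodule.pow_induction_on_left' with
  | algebraMap s => rw [grade_algebraMap]; simp
  | add x y i _ _ hx hy => rw [map_add, hx, hy, map_add, add_mul]
  | mem_mul m hm i x _ hx =>
    obtain ⟨y, rfl⟩ := hm
    rw [map_mul, hx, grade_ι, map_mul, pow_succ]
    ring

theorem mem_degreePart_iff {d : ℕ} {z : SymLoc M e} :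
    z ∈ degreePart M e d ↔ ∃ k, ∃ l ∈ LinearMap.range (ι M e) ^ d, z = inv M e ^ k * l := by
  have hmap : LinearMap.range (ι M e) ^ d = Submodule.map
      (IsScalarTower.toAlgHom S (SymmetricAlgebra S M) (SymLoc M e)).toLinearMap
      (LinearMap.range (SymmetricAlgebra.ι S M) ^ d) := by
    rw [Submodule.map_pow, ι, LinearMap.range_comp]
  rw [hmap]
  constructor
  · rintro ⟨w, hw, k, rfl⟩
    exact ⟨k, _, ⟨w, hw, rfl⟩, rfl⟩
  · rintro ⟨k, _, ⟨w, hw, rfl⟩, rfl⟩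
    exact ⟨w, hw, k, rfl⟩

theorem grade_of_mem_degreePart {d : ℕ} {z : SymLoc M e} (hz : z ∈ degreePart M e d) :
    grade M e z = Polynomial.C z * Polynomial.X ^ d := by
  obtain ⟨k, l, hl, rfl⟩ := mem_degreePart_iff.1 hz
  rw [map_mul, map_pow, grade_inv, grade_of_mem_pow hl]
  simp [mul_assoc]

theorem component_of_mem_degreePart {d : ℕ} {z : SymLoc M e} (hz : z ∈ degreePart M e d) (k : ℕ) :
    component M e k z = if k = d then z else 0 := by
  rw [component_apply, grade_of_mem_degreePart hz, Polynomial.coeff_C_mul, Polynomial.coeff_X_pow]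
  simp

theorem inv_pow_mul_algebraMap_mem (k : ℕ) (s : S) :
    inv M e ^ k * algebraMap S _ s ∈ degreePart M e 0 :=
  mem_degreePart_iff.2 ⟨k, _, by rw [pow_zero]; exact Submodule.mem_one.2 ⟨s, rfl⟩, rfl⟩

section Map

variable {σ : S →+* S} {g : M →ₛₗ[σ] M} {he : σ e = e}

@[simp] theorem map_ι (y : M) : map σ g he (ι M e y) = ι M e (g y) := by
  change IsLocalization.map _ _ _ (algebraMap (SymmetricAlgebra S M) _ _) = _
  rw [IsLocalization.map_eq, symMap_ι]
  rfl

@[simp] theorem map_algebraMap (s : S) :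
    map σ g he (algebraMap S _ s) = algebraMap S (SymLoc M e) (σ s) := by
  change IsLocalization.map _ _ _ (algebraMap (SymmetricAlgebra S M) _ (algebraMap S _ s)) = _
  rw [IsLocalization.map_eq, symMap_algebraMap]
  rfl

@[simp] theorem map_inv : map σ g he (inv M e) = inv M e :=
  map_inv_of_map_algebraMap _ (by rw [map_algebraMap, he, inv_mul])

theorem component_map (d : ℕ) (z : SymLoc M e) :
    component M e d (map σ g he z) = map σ g he (component M e d z) := by
  have : (grade M e).toRingHom.comp (map σ g he) =
      (Polynomial.mapRingHom (map σ g he)).comp (grade M e).toRingHom :=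
    ringHom_ext (fun s => by simp) (fun y => by simp)
  have h := congrArg (Polynomial.coeff · d) (RingHom.congr_fun this z)
  simpa [component_apply] using h

theorem map_iterate_ι (k : ℕ) (y : M) :
    (map σ g he)^[k] (ι M e y) = ι M e (g^[k] y) := by
  induction k with
  | zero => rfl
  | succ k ih => rw [Function.iterate_succ_apply', ih, map_ι, Function.iterate_succ_apply']

theorem map_iterate_algebraMap (k : ℕ) (s : S) :
    (map σ g he)^[k] (algebraMap S _ s) = algebraMap S (SymLoc M e) (σ^[k] s) := by
  induction k with
  | zero => rfl
  | succ k ih => rw [Function.iterate_succ_apply', ih, map_algebraMap, Function.iterate_succ_apply']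

/-- Meant for `k = p ^ r` and `c = ρ`: the induced action of `τ = σ ^ k` on the graded ring is
multiplication by `ρ ^ d` in degree `d`. -/
theorem map_iterate_eq_scale {k : ℕ} {c : S} (hσ : ∀ s, σ^[k] s = s)
    (hg : ∀ y, g^[k] y = c • y) (z : SymLoc M e) :
    (map σ g he)^[k] z = scale (algebraMap S _ c) z := by
  have : (map σ g he) ^ k = scale (algebraMap S _ c) := by
    refine ringHom_ext (fun s => ?_) (fun y => ?_)
    · rw [RingHom.coe_pow, map_iterate_algebraMap, hσ, scale_algebraMap]
    · rw [RingHom.coe_pow, map_iterate_ι, hg, scale_ι, map_smul, Algebra.smul_def, mul_comm]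
  rw [← this, RingHom.coe_pow]

end Map

/-- In the symmetric algebra of a module of rank one, no nonzero homogeneous element is killed by
a power of the module. -/
theorem eq_zero_of_forall_mul_eq_zero {ι' : Type*} [Fintype ι'] (x : ι' → M)
    (ψ : ι' → M →ₗ[S] S) (hψ : ∀ i y z, ψ i y • z = ψ i z • y) (hone : ∑ i, ψ i (x i) = 1)
    {k d : ℕ} {z : SymLoc M e} (hz : grade M e z = Polynomial.C z * Polynomial.X ^ d)
    (h : ∀ y : M, ι M e y ^ k * z = 0) : z = 0 := by
  have key (i : ι') : ψ i (x i) ^ (k + d) • z = 0 := by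
    -- `f` replaces `y` by `ψ i y` times `X`. Evaluating `X` at `x i` gives `ψ i y • x i = ψ i (x i)
    -- • y`, so the composite scales by `ψ i (x i)`. Applied to `x i ^ k * z = 0` this leaves `ψ i
    -- (x i) ^ (k + d)` times `z`.
    let f : SymLoc M e →ₐ[S] Polynomial (SymLoc M e) := lift
      (LinearMap.mulRight S (Polynomial.X : Polynomial (SymLoc M e)) ∘ₗ
        Algebra.linearMap S (Polynomial (SymLoc M e)) ∘ₗ ψ i) isUnit_algebraMap_polynomial
    have hf (y : M) : f (ι M e y) = Polynomial.C (algebraMap S _ (ψ i y)) * Polynomial.X := by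
      simp [f]
    have h1 := congrArg f (h (x i))
    rw [map_mul, map_pow, map_zero, hf, mul_pow, mul_right_comm] at h1
    replace h1 := Polynomial.mul_X_pow_eq_zero h1
    have h2 : (Polynomial.evalRingHom (ι M e (x i))).comp f.toRingHom =
        scale (algebraMap S _ (ψ i (x i))) := by
      refine ringHom_ext (fun s => by simp [scale]) (fun y => ?_)
      rw [scale_ι]
      simp only [RingHom.comp_apply, AlgHom.toRingHom_eq_coe, RingHom.coe_coe, hf]
      simp only [Polynomial.coe_evalRingHom, Polynomial.eval_mul, Polynomial.eval_C,
        Polynomial.eval_X]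
      rw [← Algebra.smul_def, ← map_smul, hψ, map_smul, Algebra.smul_def, mul_comm]
    have h3 := congrArg (Polynomial.evalRingHom (ι M e (x i))) h1
    rw [map_mul, map_zero] at h3
    have h4 := RingHom.congr_fun h2 z
    rw [RingHom.comp_apply] at h4
    erw [h4] at h3
    have h5 : scale (algebraMap S _ (ψ i (x i))) z = z * algebraMap S _ (ψ i (x i)) ^ d := by
      change Polynomial.eval _ (grade M e z) = _
      rw [hz]
      simp
    rw [h5] at h3
    rw [Algebra.smul_def, map_pow, pow_add]
    simp only [map_pow, Polynomial.coe_evalRingHom, Polynomial.eval_C] at h3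
    linear_combination h3
  have htop : Ideal.span (Set.range fun i => ψ i (x i)) = ⊤ := by
    rw [Ideal.eq_top_iff_one, ← hone]
    exact Ideal.sum_mem _ fun i _ => Ideal.subset_span ⟨i, rfl⟩
  have h1 : (1 : S) ∈ Ideal.span ((fun x : S => x ^ (k + d)) '' Set.range fun i => ψ i (x i)) := by
    rw [Ideal.span_pow_eq_top _ htop]
    trivial
  have h2 : ∀ a ∈ Ideal.span ((fun x : S => x ^ (k + d)) '' Set.range fun i => ψ i (x i)),
      a • z = 0 := by
    intro a ha
    refine Submodule.span_induction ?_ (zero_smul _ _) ?_ ?_ ha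
    · rintro _ ⟨_, ⟨i, rfl⟩, rfl⟩
      exact key i
    · intro a b _ _ ha hb
      rw [add_smul, ha, hb, add_zero]
    · intro c a _ ha
      rw [smul_assoc, ha, smul_zero]
  rw [← one_smul S z, h2 1 h1]

end SymLoc

/-! ### The submodules `P(k)` of `U'` -/

namespace SemilinearAction

variable {R S P : Type*} [CommRing R] [CommRing S] [Algebra R S] {σ : S ≃ₐ[R] S}
  [AddCommGroup P] [Module S P] {D : SemilinearAction σ P} {ρ : R}

/-- The projection `P(1) → P₀ ≅ S`. -/
noncomputable def Normalization.coord (ν : D.Normalization) : P →ₗ[S] S :=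
  ν.equiv.toLinearMap ∘ₗ Submodule.mkQ _

theorem Normalization.coord_surjective (ν : D.Normalization) : Function.Surjective ν.coord :=
  ν.equiv.surjective.comp (Submodule.mkQ_surjective _)

theorem Normalization.coord_tau (ν : D.Normalization) (x : P) :
    ν.coord (D.tau x) = ν.coord x := by
  rw [← sub_eq_zero, ← map_sub]
  change ν.equiv (Submodule.Quotient.mk (D.tau x - x)) = 0
  rw [(Submodule.Quotient.mk_eq_zero _).2 (LinearMap.mem_range.2 ⟨x, by simp⟩), map_zero]

theorem Normalization.coord_act (ν : D.Normalization) (x : P) :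
    ν.coord (D.act x) = σ (ν.coord x) := ν.map_act x

variable (D ρ) in
/-- The projection `P(1) → P₁`. -/
noncomputable def toOne : P →ₗ[S] D.POne ρ := Submodule.mkQ _

theorem toOne_surjective : Function.Surjective (D.toOne ρ) := Submodule.mkQ_surjective _

theorem toOne_tau (x : P) : D.toOne ρ (D.tau x) = algebraMap R S ρ • D.toOne ρ x := by
  rw [← sub_eq_zero, ← map_smul, ← map_sub]
  exact (Submodule.Quotient.mk_eq_zero _).2 (LinearMap.mem_range.2 ⟨x, by simp⟩)

theorem exists_of_toOne_eq_zero {x : P} (hx : D.toOne ρ x = 0) :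
    ∃ y, x = D.tau y - algebraMap R S ρ • y := by
  obtain ⟨y, hy⟩ := (Submodule.Quotient.mk_eq_zero _).1 hx
  exact ⟨y, by simp [← hy]⟩

theorem actOne_toOne (x : P) : D.actOne ρ (D.toOne ρ x) = D.toOne ρ (D.act x) := rfl

variable (D ρ) in
/-- The inclusion `P₁ ⊆ U'`. -/
noncomputable abbrev ιU : D.POne ρ →ₗ[S] D.UPrime ρ :=
  SymLoc.ι (D.POne ρ) (algebraMap R S (ρ - 1))

variable (D ρ) in
/-- The element `1/η` of `U'`. -/
noncomputable abbrev invU : D.UPrime ρ := SymLoc.inv (D.POne ρ) (algebraMap R S (ρ - 1))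

variable (D ρ) in
/-- The grading of `U'`. -/
noncomputable abbrev gradeU : D.UPrime ρ →ₐ[S] Polynomial (D.UPrime ρ) :=
  SymLoc.grade (D.POne ρ) (algebraMap R S (ρ - 1))

variable (D ρ) in
/-- The homogeneous components in `U'`. -/
noncomputable abbrev compU (d : ℕ) : D.UPrime ρ →ₗ[S] D.UPrime ρ :=
  SymLoc.component (D.POne ρ) (algebraMap R S (ρ - 1)) d

theorem invU_mul : D.invU ρ * algebraMap S (D.UPrime ρ) (algebraMap R S (ρ - 1)) = 1 :=
  SymLoc.inv_mul _ _

theorem algebraMap_rho :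
    algebraMap S (D.UPrime ρ) (algebraMap R S ρ) =
      1 + algebraMap S (D.UPrime ρ) (algebraMap R S (ρ - 1)) := by
  simp

theorem smul_eq_mulU (s : S) (z : D.UPrime ρ) : s • z = algebraMap S (D.UPrime ρ) s * z :=
  Algebra.smul_def s z

variable (ν : D.Normalization)

theorem embed_apply (x : P) : embed ρ ν x =
    D.invU ρ * (D.ιU ρ (D.toOne ρ x) - algebraMap S _ (ν.coord x)) := by
  rw [embed, LinearMap.comp_apply, LinearMap.mulLeft_apply, LinearMap.comp_apply,
    LinearMap.sub_apply, map_sub (AlgHom.toLinearMap _)]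
  rfl

theorem ιU_toOne_eq (x : P) : D.ιU ρ (D.toOne ρ x) = algebraMap S _ (ν.coord x) +
    algebraMap S _ (algebraMap R S (ρ - 1)) * embed ρ ν x := by
  rw [embed_apply]
  linear_combination (-(D.ιU ρ (D.toOne ρ x) - algebraMap S _ (ν.coord x))) *
    invU_mul (D := D) (ρ := ρ)

/-- `(ρ θ - s) / η = (θ - s) / η + θ`, because `ρ = 1 + η`. -/
theorem embed_tau (x : P) : embed ρ ν (D.tau x) = embed ρ ν x + D.ιU ρ (D.toOne ρ x) := by
  rw [embed_apply, embed_apply, toOne_tau, ν.coord_tau, map_smul, smul_eq_mulU, algebraMap_rho]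
  linear_combination D.ιU ρ (D.toOne ρ x) * invU_mul (D := D) (ρ := ρ)

/-- If `x` has image `s` in `P₀`, then `(τ - ρ) x` embeds as `θ - η X = s`. -/
theorem algebraMap_mem_range_embed (s : S) :
    algebraMap S (D.UPrime ρ) s ∈ LinearMap.range (embed ρ ν) := by
  obtain ⟨x, hx⟩ := ν.coord_surjective s
  refine ⟨D.tau x - algebraMap R S ρ • x, ?_⟩
  rw [map_sub, embed_tau, map_smul, smul_eq_mulU, algebraMap_rho, ιU_toOne_eq, hx]
  ring

theorem ιU_mem_range_embed (y : D.POne ρ) : D.ιU ρ y ∈ LinearMap.range (embed ρ ν) := by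
  obtain ⟨x, rfl⟩ := toOne_surjective y
  exact ⟨D.tau x - x, by rw [map_sub, embed_tau, add_sub_cancel_left]⟩

theorem one_le_range_embed : 1 ≤ LinearMap.range (embed ρ ν) := by
  intro z hz
  obtain ⟨s, rfl⟩ := Submodule.mem_one.1 hz
  exact algebraMap_mem_range_embed ν s

theorem power_mono {i j : ℕ} (h : i ≤ j) : power ρ ν i ≤ power ρ ν j := by
  obtain ⟨k, rfl⟩ := Nat.exists_eq_add_of_le h
  induction k with
  | zero => exact le_rfl
  | succ k ih =>
    refine (ih (by omega)).trans ?_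
    rw [power, power, ← add_assoc, pow_succ]
    calc _ = LinearMap.range (embed ρ ν) ^ (i + k) * 1 := (mul_one _).symm
      _ ≤ _ := mul_le_mul' le_rfl (one_le_range_embed ν)

theorem embed_mem_power_one (x : P) : embed ρ ν x ∈ power ρ ν 1 := by
  rw [power, pow_one]
  exact LinearMap.mem_range_self _ _

theorem mul_mem_power {i j : ℕ} {y z : D.UPrime ρ} (hy : y ∈ power ρ ν i)
    (hz : z ∈ power ρ ν j) : y * z ∈ power ρ ν (i + j) := by
  rw [power, pow_add]
  exact Submodule.mul_mem_mul hy hz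

theorem algebraMap_mem_power (k : ℕ) (s : S) : algebraMap S (D.UPrime ρ) s ∈ power ρ ν k :=
  power_mono ν (Nat.zero_le k) (by rw [power, pow_zero]; exact Submodule.mem_one.2 ⟨s, rfl⟩)

/-- Expand `θ ^ p = (s + η X) ^ p`. The term `η ^ p X ^ p` is divisible by `η ^ p`. In the terms
with `0 < k < p` the binomial coefficient contributes `η ^ (p - 1)` and `η ^ k` contributes at least
one more factor. -/
theorem kummer_mem_power {p : ℕ} (hp : p.Prime) (hdvd : (ρ - 1) ^ (p - 1) ∣ (p : R)) (x : P) :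
    D.invU ρ ^ p * (D.ιU ρ (D.toOne ρ x) ^ p - algebraMap S _ (ν.coord x) ^ p) ∈
      power ρ ν p := by
  set e : D.UPrime ρ := algebraMap S _ (algebraMap R S (ρ - 1)) with he
  have hie : D.invU ρ * e = 1 := invU_mul
  have hie' (k : ℕ) : D.invU ρ ^ k * e ^ k = 1 := by rw [← mul_pow, hie, one_pow]
  rw [ιU_toOne_eq ν, add_comm, add_pow, Finset.sum_range_succ', pow_zero]
  simp only [tsub_zero, one_mul, Nat.choose_zero_right, Nat.cast_one, mul_one,
    add_sub_cancel_right, Finset.mul_sum]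
  refine Submodule.sum_mem _ fun k hk => ?_
  rw [Finset.mem_range] at hk
  have hX : embed ρ ν x ^ (k + 1) ∈ power ρ ν p :=
    power_mono ν (show k + 1 ≤ p by omega) (Submodule.pow_mem_pow _ (LinearMap.mem_range_self _ x) _)
  suffices h : ∃ c : S, D.invU ρ ^ p * e ^ (k + 1) * (p.choose (k + 1) : D.UPrime ρ) =
      algebraMap S _ c by
    obtain ⟨c, hc⟩ := h
    have : D.invU ρ ^ p * ((e * embed ρ ν x) ^ (k + 1) *
        algebraMap S _ (ν.coord x) ^ (p - (k + 1)) * (p.choose (k + 1) : D.UPrime ρ)) =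
        (c * ν.coord x ^ (p - (k + 1))) • embed ρ ν x ^ (k + 1) := by
      rw [smul_eq_mulU, map_mul, map_pow, ← hc]
      ring
    rw [this]
    exact Submodule.smul_mem _ _ hX
  rcases eq_or_lt_of_le (show k + 1 ≤ p by omega) with h | h
  · exact ⟨1, by rw [h, hie', Nat.choose_self]; simp⟩
  · obtain ⟨d, hd⟩ := hp.dvd_choose_self (by omega) h
    obtain ⟨c, hc⟩ := hdvd
    refine ⟨algebraMap R S ((ρ - 1) ^ k * c * d), ?_⟩
    have h1 : (p : D.UPrime ρ) = e ^ (p - 1) * algebraMap S _ (algebraMap R S c) := by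
      have := congrArg (fun r => algebraMap S (D.UPrime ρ) (algebraMap R S r)) hc
      simpa only [map_natCast, map_mul, map_pow, ← he] using this
    have h2 : e ^ p = e ^ (p - 1) * e := by rw [← pow_succ, Nat.sub_add_cancel hp.pos]
    rw [hd, Nat.cast_mul, h1]
    simp only [map_mul, map_pow, map_natCast, ← he]
    linear_combination e ^ k * algebraMap S _ (algebraMap R S c) * (d : D.UPrime ρ) *
      (hie' p) - D.invU ρ ^ p * e ^ k * algebraMap S _ (algebraMap R S c) * (d : D.UPrime ρ) * h2

theorem gradeU_embed (x : P) : D.gradeU ρ (embed ρ ν x) =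
    Polynomial.C (D.invU ρ * D.ιU ρ (D.toOne ρ x)) * Polynomial.X -
      Polynomial.C (D.invU ρ * algebraMap S _ (ν.coord x)) := by
  rw [embed_apply, map_mul, map_sub (D.gradeU ρ), SymLoc.grade_inv, SymLoc.grade_ι, SymLoc.grade_algebraMap,
    Polynomial.C_mul, Polynomial.C_mul]
  ring

theorem natDegree_gradeU_embed (x : P) : (D.gradeU ρ (embed ρ ν x)).natDegree ≤ 1 := by
  rw [gradeU_embed]
  compute_degree

theorem compU_one_embed (x : P) :
    D.compU ρ 1 (embed ρ ν x) = D.invU ρ * D.ιU ρ (D.toOne ρ x) := by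
  rw [SymLoc.component_apply]
  erw [gradeU_embed]
  simp [Polynomial.coeff_C]

theorem natDegree_gradeU_le {k : ℕ} {z : D.UPrime ρ} (hz : z ∈ power ρ ν k) :
    (D.gradeU ρ z).natDegree ≤ k := by
  induction hz using Submodule.pow_induction_on_left' with
  | algebraMap s => rw [SymLoc.grade_algebraMap, Polynomial.natDegree_C]
  | add x y i _ _ hx hy => rw [map_add]; exact Polynomial.natDegree_add_le_of_degree_le hx hy
  | mem_mul m hm i x _ hx =>
    obtain ⟨y, rfl⟩ := hm
    rw [map_mul, Nat.succ_eq_one_add]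
    exact Polynomial.natDegree_mul_le_of_le (natDegree_gradeU_embed ν y) hx

theorem compU_embed_mul {k : ℕ} {z : D.UPrime ρ} (hz : z ∈ power ρ ν k) (x : P) :
    D.compU ρ (k + 1) (embed ρ ν x * z) =
      D.invU ρ * D.ιU ρ (D.toOne ρ x) * D.compU ρ k z := by
  rw [← compU_one_embed ν, SymLoc.component_apply, SymLoc.component_apply, SymLoc.component_apply,
    map_mul, add_comm]
  exact Polynomial.coeff_mul_add_eq_of_natDegree_le (natDegree_gradeU_embed ν x)
    (natDegree_gradeU_le ν hz)

theorem exists_compU_top {k : ℕ} {z : D.UPrime ρ} (hz : z ∈ power ρ ν k) :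
    ∃ l ∈ LinearMap.range (D.ιU ρ) ^ k, D.compU ρ k z = D.invU ρ ^ k * l := by
  induction hz using Submodule.pow_induction_on_left' with
  | algebraMap s =>
    refine ⟨algebraMap S _ s, by rw [pow_zero]; exact Submodule.mem_one.2 ⟨s, rfl⟩, ?_⟩
    rw [SymLoc.component_apply, SymLoc.grade_algebraMap]
    simp
  | add x y i _ _ hx hy =>
    obtain ⟨l, hl, hl'⟩ := hx
    obtain ⟨m, hm, hm'⟩ := hy
    exact ⟨l + m, add_mem hl hm, by rw [map_add, hl', hm', mul_add]⟩
  | mem_mul m hm i x hx' hx =>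
    obtain ⟨y, rfl⟩ := hm
    obtain ⟨l, hl, hl'⟩ := hx
    refine ⟨D.ιU ρ (D.toOne ρ y) * l, ?_, ?_⟩
    · rw [pow_succ']
      exact Submodule.mul_mem_mul ⟨_, rfl⟩ hl
    · rw [compU_embed_mul ν hx', hl', pow_succ]
      ring

theorem exists_compU_zero {k : ℕ} {z : D.UPrime ρ} (hz : z ∈ power ρ ν k) :
    ∃ s : S, D.compU ρ 0 z = D.invU ρ ^ k * algebraMap S _ s := by
  induction hz using Submodule.pow_induction_on_left' with
  | algebraMap s =>
    refine ⟨s, ?_⟩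
    rw [SymLoc.component_apply, SymLoc.grade_algebraMap]
    simp
  | add x y i _ _ hx hy =>
    obtain ⟨l, hl⟩ := hx
    obtain ⟨m, hm⟩ := hy
    exact ⟨l + m, by rw [map_add, hl, hm, map_add, mul_add]⟩
  | mem_mul m hm i x hx' hx =>
    obtain ⟨y, rfl⟩ := hm
    obtain ⟨l, hl⟩ := hx
    refine ⟨-ν.coord y * l, ?_⟩
    rw [SymLoc.component_apply] at hl ⊢
    rw [map_mul, Polynomial.mul_coeff_zero, hl]
    erw [gradeU_embed]
    simp
    ring

/-! ### The action of `σ` on `P(k)` -/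

theorem actU_ιU (y : D.POne ρ) : D.actU ρ (D.ιU ρ y) = D.ιU ρ (D.actOne ρ y) :=
  SymLoc.map_ι _

theorem actU_algebraMap (s : S) :
    D.actU ρ (algebraMap S _ s) = algebraMap S (D.UPrime ρ) (σ s) :=
  SymLoc.map_algebraMap _

theorem actU_smul (s : S) (z : D.UPrime ρ) : D.actU ρ (s • z) = σ s • D.actU ρ z := by
  rw [smul_eq_mulU, map_mul, actU_algebraMap, ← smul_eq_mulU]

theorem actU_invU : D.actU ρ (D.invU ρ) = D.invU ρ := SymLoc.map_inv

theorem compU_actU (d : ℕ) (z : D.UPrime ρ) :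
    D.compU ρ d (D.actU ρ z) = D.actU ρ (D.compU ρ d z) := SymLoc.component_map d z

theorem actU_embed (x : P) : D.actU ρ (embed ρ ν x) = embed ρ ν (D.act x) := by
  rw [embed_apply, embed_apply, map_mul, map_sub (D.actU ρ), actU_invU, actU_ιU, actU_algebraMap,
    actOne_toOne, ν.coord_act]

theorem actU_mem_power {k : ℕ} {z : D.UPrime ρ} (hz : z ∈ power ρ ν k) :
    D.actU ρ z ∈ power ρ ν k := by
  induction hz using Submodule.pow_induction_on_left' with
  | algebraMap s => rw [actU_algebraMap]; exact algebraMap_mem_power ν 0 _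
  | add x y i _ _ hx hy => rw [map_add]; exact add_mem hx hy
  | mem_mul m hm i x _ hx =>
    obtain ⟨y, rfl⟩ := hm
    rw [map_mul, actU_embed, Nat.succ_eq_one_add]
    exact mul_mem_power ν (embed_mem_power_one ν _) hx

theorem iterate_actU_smul (k : ℕ) (s : S) (z : D.UPrime ρ) :
    (D.actU ρ)^[k] (s • z) = σ^[k] s • (D.actU ρ)^[k] z := by
  induction k with
  | zero => rfl
  | succ k ih => simp only [Function.iterate_succ_apply', ih, actU_smul]

theorem iterate_actU_eq_scale {n : ℕ} (hσ : ∀ s, σ^[n] s = s)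
    (hact : ∀ x, D.act^[n] x = D.tau x) (z : D.UPrime ρ) :
    (D.actU ρ)^[n] z = SymLoc.scale (algebraMap S _ (algebraMap R S ρ)) z := by
  refine SymLoc.map_iterate_eq_scale hσ (fun y => ?_) z
  obtain ⟨x, rfl⟩ := toOne_surjective y
  have (k : ℕ) : (D.actOne ρ)^[k] (D.toOne ρ x) = D.toOne ρ (D.act^[k] x) := by
    induction k with
    | zero => rfl
    | succ k ih => rw [Function.iterate_succ_apply', ih, actOne_toOne, Function.iterate_succ_apply']
  rw [this, hact, toOne_tau]

/-! ### Consequences of `P₁` having rank one -/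

section RankOne

variable {ι' : Type*} [Fintype ι'] (x : ι' → D.POne ρ)
    (ψ : ι' → D.POne ρ →ₗ[S] S) (hψ : ∀ i y z, ψ i y • z = ψ i z • y) (hone : ∑ i, ψ i (x i) = 1)

include hψ hone in
-- Modulo `η` the map `P(1) → S` factors through `P₁`, because it sends `(τ - ρ) z` to a multiple of
-- `η`. Rank one allows a lift to `P₁`, as `θ = ∑ ψ i θ • x i`.
theorem exists_lift_coord : ∃ l : D.POne ρ →ₗ[S] S, ∀ y : P, ∃ c : S,
    l (D.toOne ρ y) - ν.coord y = algebraMap R S (ρ - 1) * c := by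
  choose x' hx' using fun i => toOne_surjective (x i)
  refine ⟨∑ i, (ψ i).smulRight (ν.coord (x' i)), fun y => ?_⟩
  have h : D.toOne ρ (∑ i, ψ i (D.toOne ρ y) • x' i - y) = 0 := by
    simp only [map_sub, map_sum, map_smul, hx']
    simp_rw [hψ _ (D.toOne ρ y), ← Finset.sum_smul, hone, one_smul, sub_self]
  obtain ⟨z, hz⟩ := exists_of_toOne_eq_zero h
  refine ⟨-ν.coord z, ?_⟩
  have h2 := congrArg ν.coord hz
  simp only [map_sub, map_sum, map_smul, ν.coord_tau, smul_eq_mul] at h2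
  simp only [LinearMap.sum_apply, LinearMap.smulRight_apply, smul_eq_mul, h2, map_sub, map_one]
  ring

include hψ hone in
/-- `P(k) ∩ S' = S`. -/
theorem exists_algebraMap_of_mem_power {k j : ℕ} {s : S}
    (h : D.invU ρ ^ j * algebraMap S _ s ∈ power ρ ν k) :
    ∃ c : S, D.invU ρ ^ j * algebraMap S _ s = algebraMap S (D.UPrime ρ) c := by
  obtain ⟨l, hl⟩ := exists_lift_coord ν x ψ hψ hone
  -- The substitution `θ ↦ l θ` fixes `S'` and sends `(θ - s) / η` to `(l θ - s) / η`, which lies in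
  -- `S`. Hence it maps every `P(k)` into `S`.
  let f : D.UPrime ρ →ₐ[S] D.UPrime ρ := SymLoc.lift
    (Algebra.linearMap S (D.UPrime ρ) ∘ₗ l) SymLoc.isUnit_algebraMap
  have hfinv : f (D.invU ρ) = D.invU ρ :=
    SymLoc.map_inv_of_map_algebraMap f.toRingHom (by
      change D.invU ρ * f (algebraMap S _ _) = 1
      rw [AlgHom.commutes, invU_mul])
  have key {k : ℕ} {z : D.UPrime ρ} (hz : z ∈ power ρ ν k) :
      ∃ c : S, f z = algebraMap S (D.UPrime ρ) c := by
    induction hz using Submodule.pow_induction_on_left' with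
    | algebraMap s => exact ⟨s, AlgHom.commutes _ _⟩
    | add y z i _ _ hy hz =>
      obtain ⟨a, ha⟩ := hy
      obtain ⟨b, hb⟩ := hz
      exact ⟨a + b, by rw [map_add, ha, hb, map_add]⟩
    | mem_mul m hm i z _ hz =>
      obtain ⟨y, rfl⟩ := hm
      obtain ⟨a, ha⟩ := hz
      obtain ⟨c, hc⟩ := hl y
      refine ⟨c * a, ?_⟩
      have h1 : f (D.ιU ρ (D.toOne ρ y)) = algebraMap S _ (l (D.toOne ρ y)) := by simp [f]
      rw [map_mul, ha, embed_apply, map_mul, hfinv, map_sub f, AlgHom.commutes, h1,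
        ← map_sub (algebraMap S (D.UPrime ρ)), hc,
        map_mul, map_mul, ← mul_assoc (D.invU ρ), invU_mul, one_mul]
  obtain ⟨c, hc⟩ := key h
  refine ⟨c, ?_⟩
  rw [← hc, map_mul, map_pow, hfinv, AlgHom.commutes]

include hψ hone in
/-- An element of `P(k + 1)` is determined modulo `P(k)` by its component of degree `k + 1`. -/
theorem sub_smul_mem_power {k : ℕ} {z w : D.UPrime ρ} (hz : z ∈ power ρ ν (k + 1))
    (hw : w ∈ power ρ ν (k + 1)) {s : S} (h : D.compU ρ (k + 1) z = s • D.compU ρ (k + 1) w) :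
    z - s • w ∈ power ρ ν k := by
  obtain ⟨l, hl⟩ := exists_lift_coord ν x ψ hψ hone
  set e : D.UPrime ρ := algebraMap S _ (algebraMap R S (ρ - 1)) with he
  have hie : D.invU ρ * e = 1 := invU_mul
  -- The substitution `θ ↦ (θ - l θ) / η` rebuilds an element of `P(k)`, up to `P(k - 1)`, from its
  -- component of degree `k` multiplied by `η ^ k`.
  let f : D.UPrime ρ →ₐ[S] D.UPrime ρ := SymLoc.lift
    (LinearMap.mulLeft S (D.invU ρ) ∘ₗ (D.ιU ρ - Algebra.linearMap S (D.UPrime ρ) ∘ₗ l))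
    SymLoc.isUnit_algebraMap
  have hf (y) : f (D.ιU ρ y) = D.invU ρ * (D.ιU ρ y - algebraMap S _ (l y)) := by simp [f]
  -- `N k` stands for `P(k - 1)`, with `P(-1) = 0`.
  let N : ℕ → Submodule S (D.UPrime ρ) := fun k => Nat.rec ⊥ (fun k _ => power ρ ν k) k
  have hN (k : ℕ) : N k ≤ power ρ ν k := by
    cases k with
    | zero => exact bot_le
    | succ k => exact power_mono ν (Nat.le_succ k)
  have key {k : ℕ} {z : D.UPrime ρ} (hz : z ∈ power ρ ν k) :
      z - f (e ^ k * D.compU ρ k z) ∈ N k := by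
    induction hz using Submodule.pow_induction_on_left' with
    | algebraMap s =>
      rw [SymLoc.component_apply, SymLoc.grade_algebraMap]
      simp
    | add y z i _ _ hy hz =>
      rw [map_add, mul_add, map_add, add_sub_add_comm]
      exact add_mem hy hz
    | mem_mul m hm i z hz' hz =>
      obtain ⟨y, rfl⟩ := hm
      obtain ⟨c, hc⟩ := hl y
      set v := e ^ i * D.compU ρ i z with hv
      have h1 : e ^ (i + 1) * D.compU ρ (i + 1) (embed ρ ν y * z) =
          D.ιU ρ (D.toOne ρ y) * v := by
        rw [compU_embed_mul ν hz', hv, pow_succ]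
        linear_combination (e ^ i * D.ιU ρ (D.toOne ρ y) * D.compU ρ i z) * hie
      have h2 : f (D.ιU ρ (D.toOne ρ y)) = embed ρ ν y - algebraMap S _ c := by
        have := congrArg (algebraMap S (D.UPrime ρ)) hc
        rw [map_sub, map_mul, ← he] at this
        rw [hf, embed_apply]
        linear_combination -D.invU ρ * this - algebraMap S (D.UPrime ρ) c * hie
      have h3 : f v ∈ power ρ ν i := by
        have := sub_mem hz' (hN i hz)
        rwa [sub_sub_cancel] at this
      have h4 : embed ρ ν y * z - f (e ^ (i + 1) * D.compU ρ (i + 1) (embed ρ ν y * z)) =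
          embed ρ ν y * (z - f v) + c • f v := by
        rw [h1, map_mul, h2, smul_eq_mulU]
        ring
      rw [h4]
      refine add_mem ?_ (Submodule.smul_mem _ _ h3)
      cases i with
      | zero =>
        rw [(Submodule.mem_bot S).1 hz, mul_zero]
        exact zero_mem _
      | succ i =>
        rw [add_comm i]
        exact mul_mem_power ν (embed_mem_power_one ν y) hz
  have h1 := key hz
  have h2 := Submodule.smul_mem _ s (key hw)
  have h3 := sub_mem h1 h2
  rw [h, mul_smul_comm, map_smul, smul_sub, sub_sub_sub_cancel_right] at h3
  exact h3

end RankOne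

end SemilinearAction

theorem SymLoc.grade_component {S : Type*} [CommRing S] {M : Type*} [AddCommGroup M] [Module S M]
    {e : S} (d : ℕ) (z : SymLoc M e) : grade M e (component M e d z) =
      Polynomial.C (component M e d z) * Polynomial.X ^ d := by
  have : (Polynomial.mapRingHom (grade M e).toRingHom).comp (grade M e).toRingHom =
      ((Polynomial.compRingHom (Polynomial.C Polynomial.X * Polynomial.X)).comp
        (Polynomial.mapRingHom Polynomial.C)).comp (grade M e).toRingHom :=
    ringHom_ext (fun s => by simp) (fun y => by simp [mul_assoc])
  have h := congrArg (Polynomial.coeff · d) (RingHom.congr_fun this z)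
  simpa [component_apply, Polynomial.comp_C_mul_X_coeff] using h

/-! ### The algebra generated by `P(1)`, and descent along `S / R` -/

namespace SemilinearAction

variable {R S P : Type*} [CommRing R] [CommRing S] [Algebra R S] {σ : S ≃ₐ[R] S}
  [AddCommGroup P] [Module S P] {D : SemilinearAction σ P} {ρ : R} (ν : D.Normalization)

variable (ρ) in
/-- The subalgebra of `U'` generated by `P(1)`, the union of all `P(k)`. -/
noncomputable def powerUnion : Subalgebra S (D.UPrime ρ) where
  carrier := {z | ∃ k, z ∈ power ρ ν k}
  mul_mem' := by
    rintro y z ⟨i, hi⟩ ⟨j, hj⟩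
    exact ⟨i + j, mul_mem_power ν hi hj⟩
  add_mem' := by
    rintro y z ⟨i, hi⟩ ⟨j, hj⟩
    exact ⟨max i j, add_mem (power_mono ν (le_max_left _ _) hi)
      (power_mono ν (le_max_right _ _) hj)⟩
  algebraMap_mem' s := ⟨0, algebraMap_mem_power ν 0 s⟩

theorem iterate_actU_mem_power (i : ℕ) {k : ℕ} {z : D.UPrime ρ} (hz : z ∈ power ρ ν k) :
    (D.actU ρ)^[i] z ∈ power ρ ν k := by
  induction i with
  | zero => exact hz
  | succ i ih => rw [Function.iterate_succ_apply']; exact actU_mem_power ν ih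

theorem iterate_actU_embed (i : ℕ) (x : P) :
    (D.actU ρ)^[i] (embed ρ ν x) = embed ρ ν (D.act^[i] x) := by
  induction i with
  | zero => rfl
  | succ i ih => rw [Function.iterate_succ_apply', ih, actU_embed, Function.iterate_succ_apply']

/-- Galois descent: an element of `P(k)` fixed by `σ ^ n` is an `S`-linear combination of
invariants. -/
theorem exists_sum_invariants {n k : ℕ} (hσ : ∀ s, σ^[n] s = s) {m : ℕ} {a b : Fin m → S}
    (hab : ∀ i < n, ∑ l, a l * σ^[i] (b l) = if i = 0 then 1 else 0) (hn : 0 < n)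
    {z : D.UPrime ρ} (hz : z ∈ power ρ ν k) (hfix : (D.actU ρ)^[n] z = z) :
    ∃ v : Fin m → D.UPrime ρ, (∀ l, v l ∈ powerInvariants ρ ν k) ∧ z = ∑ l, a l • v l := by
  -- The invariants are the traces of the elements `b l • z`.
  refine ⟨fun l => ∑ i ∈ range n, (D.actU ρ)^[i] (b l • z), fun l => ⟨?_, ?_⟩, ?_⟩
  · exact Submodule.sum_mem _ fun i _ =>
      iterate_actU_mem_power ν i (Submodule.smul_mem _ _ hz)
  · rw [map_sum]
    simp_rw [← Function.iterate_succ_apply' (D.actU ρ)]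
    obtain ⟨n, rfl⟩ : ∃ n', n = n' + 1 := ⟨n - 1, by omega⟩
    rw [Finset.sum_range_succ, Finset.sum_range_succ' _ n, Nat.succ_eq_add_one, iterate_actU_smul,
      hfix, hσ]
    rfl
  · simp_rw [Finset.smul_sum, iterate_actU_smul, smul_smul]
    rw [Finset.sum_comm]
    simp_rw [← Finset.sum_smul]
    rw [Finset.sum_eq_single 0]
    · rw [hab 0 hn]; simp
    · intro i hi hi0
      rw [hab i (Finset.mem_range.1 hi), if_neg hi0, zero_smul]
    · intro h
      exact absurd (Finset.mem_range.2 hn) h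

end SemilinearAction

/-! ### Invariant generators of `P(p)` and division by them -/

namespace SemilinearAction

variable {R S P : Type*} [CommRing R] [CommRing S] [Algebra R S] {σ : S ≃ₐ[R] S}
  [AddCommGroup P] [Module S P] {D : SemilinearAction σ P} {ρ : R}

/-- An invariant element `w = (l + s) / η ^ p` of `P(p)`, where `s` is a unit of `S` and `l`
generates `P₁ ^ p`. -/
structure IsKummerElement (ν : D.Normalization) (p : ℕ) (w l : D.UPrime ρ) (s : S) : Prop where
  mem_power : w ∈ power ρ ν p
  actU_eq : D.actU ρ w = w
  mem_pow : l ∈ LinearMap.range (D.ιU ρ) ^ p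
  isUnit : IsUnit s
  eq_add : w = D.invU ρ ^ p * (l + algebraMap S _ s)
  exists_smul : ∀ y, ∃ c : S, D.ιU ρ y ^ p = c • l

/-- The image of `1 ∈ R *ₚ R` is the wanted `w`. Every `(θ ^ p - s ^ p) / η ^ p` is an element of
`P(p)` fixed by `τ`, hence an `S`-combination of invariants, each of which is a pair of scalars
applied to the two components of `w`. Comparing components shows that `θ ^ p` and `s ^ p` are
multiples of those of `w`. -/
theorem exists_isKummerElement {ν : D.Normalization} {p : ℕ} (hp : p.Prime)
    (hρ : (Polynomial.cyclotomic p R).IsRoot ρ)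
    (hη : algebraMap R S (ρ - 1) ∈ nonZeroDivisors S) {n : ℕ} (hn : 0 < n)
    (hσ : ∀ s, σ^[n] s = s) {m : ℕ} {a b : Fin m → S}
    (hab : ∀ i < n, ∑ l, a l * σ^[i] (b l) = if i = 0 then 1 else 0)
    (hact : ∀ x, D.act^[n] x = D.tau x) (h : PowerInvariantsTrivial ρ ν p) :
    ∃ w l s, IsKummerElement (ρ := ρ) ν p w l s := by
  obtain ⟨N, hN, ⟨E⟩⟩ := h
  set w₀ : D.DegreePZero ρ p := (E 1).1 with hw₀
  set wp : D.UPrime ρ := w₀.1.1 with hwp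
  set wz : D.UPrime ρ := w₀.2.1 with hwz
  have hwp_mem : wp ∈ D.degreePart ρ p := w₀.1.2
  have hwz_mem : wz ∈ D.degreePart ρ 0 := w₀.2.2
  have hw : wp + wz ∈ powerInvariants ρ ν p := by
    rw [hN]
    exact ⟨w₀, (E 1).2, rfl⟩
  have hinv {z : D.UPrime ρ} (hz : z ∈ powerInvariants ρ ν p) :
      ∃ a b : S, z = a • wp + b • wz := by
    rw [hN] at hz
    obtain ⟨z, hz, rfl⟩ := hz
    set c := E.symm ⟨z, hz⟩ with hc
    have h1 : (z : D.DegreePZero ρ p) = c • w₀ := by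
      have : E (c • 1) = ⟨z, hz⟩ := by rw [smul_eq_mul, mul_one, hc, E.apply_symm_apply]
      rw [map_smul] at this
      exact (congrArg Subtype.val this).symm
    refine ⟨algebraMap R S c.1.1, algebraMap R S c.1.2, ?_⟩
    rw [h1]
    rfl
  have hp0 : p ≠ 0 := hp.ne_zero
  have hcompp (a b : S) : D.compU ρ p (a • wp + b • wz) = a • wp := by
    rw [map_add, map_smul, map_smul, SymLoc.component_of_mem_degreePart hwp_mem,
      SymLoc.component_of_mem_degreePart hwz_mem, if_pos rfl, if_neg hp0, smul_zero, add_zero]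
  have hcompz (a b : S) : D.compU ρ 0 (a • wp + b • wz) = b • wz := by
    rw [map_add, map_smul, map_smul, SymLoc.component_of_mem_degreePart hwp_mem,
      SymLoc.component_of_mem_degreePart hwz_mem, if_pos rfl, if_neg hp0.symm, smul_zero, zero_add]
  obtain ⟨l, hl, hl'⟩ := exists_compU_top ν hw.1
  obtain ⟨s, hs⟩ := exists_compU_zero ν hw.1
  have h1 := hcompp 1 1
  have h2 := hcompz 1 1
  rw [one_smul, one_smul] at h1 h2
  rw [h1] at hl'
  rw [h2] at hs
  have hρp := pow_eq_one_of_isRoot_cyclotomic hρ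
  have key (x : P) : ∃ a b : S, D.ιU ρ (D.toOne ρ x) ^ p = a • l ∧
      -algebraMap S (D.UPrime ρ) (ν.coord x) ^ p = b • algebraMap S (D.UPrime ρ) s := by
    set A := D.ιU ρ (D.toOne ρ x) with hA
    set z := D.invU ρ ^ p * (A ^ p - algebraMap S _ (ν.coord x) ^ p) with hz
    have hzmem : z ∈ power ρ ν p :=
      kummer_mem_power ν hp (sub_one_pow_dvd_of_isRoot_cyclotomic hp hρ) x
    -- `σ ^ n` multiplies `θ` by `ρ`, and `ρ ^ p = 1`.
    have hfix : (D.actU ρ)^[n] z = z := by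
      rw [iterate_actU_eq_scale hσ hact]
      have hinv : SymLoc.scale (algebraMap S _ (algebraMap R S ρ)) (D.invU ρ) = D.invU ρ :=
        SymLoc.map_inv_of_map_algebraMap _ (by rw [SymLoc.scale_algebraMap, invU_mul])
      rw [hz, map_mul, map_pow, hinv, map_sub (SymLoc.scale _), map_pow (SymLoc.scale _),
        map_pow (SymLoc.scale _), SymLoc.scale_algebraMap, hA, SymLoc.scale_ι, mul_pow,
        ← map_pow (algebraMap S _), ← map_pow (algebraMap R S), hρp, map_one, map_one, mul_one]
    obtain ⟨v, hv, hzv⟩ := exists_sum_invariants ν hσ hab hn hzmem hfix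
    choose c d hcd using fun l => hinv (hv l)
    have hz2 : z = (∑ l, a l * c l) • wp + (∑ l, a l * d l) • wz := by
      rw [hzv, Finset.sum_smul, Finset.sum_smul, ← Finset.sum_add_distrib]
      refine Finset.sum_congr rfl fun l _ => ?_
      rw [hcd, smul_add, smul_smul, smul_smul]
    have hA_mem : D.invU ρ ^ p * A ^ p ∈ D.degreePart ρ p := SymLoc.mem_degreePart_iff.2
      ⟨p, _, Submodule.pow_mem_pow _ (LinearMap.mem_range_self _ _) _, rfl⟩
    have hB_mem : D.invU ρ ^ p * algebraMap S _ (ν.coord x) ^ p ∈ D.degreePart ρ 0 := by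
      rw [← map_pow]
      exact SymLoc.inv_pow_mul_algebraMap_mem p _
    have hz3 := congrArg (D.compU ρ p) hz2
    have hz4 := congrArg (D.compU ρ 0) hz2
    rw [hcompp, hz, mul_sub, map_sub (D.compU ρ p), SymLoc.component_of_mem_degreePart hA_mem,
      SymLoc.component_of_mem_degreePart hB_mem, if_pos rfl, if_neg hp0, sub_zero, hl',
      ← mul_smul_comm] at hz3
    rw [hcompz, hz, mul_sub, map_sub (D.compU ρ 0), SymLoc.component_of_mem_degreePart hA_mem,
      SymLoc.component_of_mem_degreePart hB_mem, if_pos rfl, if_neg hp0.symm, zero_sub, hs,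
      ← mul_smul_comm, ← mul_neg] at hz4
    have hcancel {y z : D.UPrime ρ} (h : D.invU ρ ^ p * y = D.invU ρ ^ p * z) : y = z := by
      have h1 : D.invU ρ ^ p * algebraMap S _ (algebraMap R S (ρ - 1)) ^ p = 1 :=
        SymLoc.inv_pow_mul_pow p
      linear_combination (algebraMap S (D.UPrime ρ) (algebraMap R S (ρ - 1)) ^ p) * h -
        (y - z) * h1
    exact ⟨_, _, hcancel hz3, hcancel hz4⟩
  refine ⟨wp + wz, l, s, hw.1, hw.2, hl, ?_, ?_, fun y => ?_⟩
  -- An element of `P(1)` with image `1` in `P₀` yields `-1 = b s`.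
  · obtain ⟨x, hx⟩ := ν.coord_surjective 1
    obtain ⟨_, b, -, hb⟩ := key x
    rw [hx, map_one, one_pow, smul_eq_mulU, ← map_mul] at hb
    refine IsUnit.of_mul_eq_one (-b) (SymLoc.algebraMap_injective (M := D.POne ρ) hη ?_)
    rw [mul_neg, mul_comm, map_neg, map_one]
    exact neg_eq_iff_eq_neg.2 hb.symm
  · rw [hl', hs, mul_add]
  · obtain ⟨x, rfl⟩ := toOne_surjective y
    obtain ⟨a, _, ha, -⟩ := key x
    exact ⟨a, ha⟩

section RankOne

variable {ν : D.Normalization} {p : ℕ} {w l : D.UPrime ρ} {s : S}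
    (hw : IsKummerElement ν p w l s)
    {ι' : Type*} [Fintype ι'] {x : ι' → D.POne ρ}
    {ψ : ι' → D.POne ρ →ₗ[S] S} (hψ : ∀ i y z, ψ i y • z = ψ i z • y) (hone : ∑ i, ψ i (x i) = 1)

include hw in
theorem IsKummerElement.invU_pow_mul_mem : D.invU ρ ^ p * l ∈ D.degreePart ρ p :=
  SymLoc.mem_degreePart_iff.2 ⟨p, l, hw.mem_pow, rfl⟩

include hw in
theorem IsKummerElement.gradeU_eq : D.gradeU ρ w = Polynomial.C (D.invU ρ ^ p * l) *
    Polynomial.X ^ p + Polynomial.C (D.invU ρ ^ p * algebraMap S _ s) := by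
  conv_lhs => rw [hw.eq_add, mul_add, map_add]
  rw [SymLoc.grade_of_mem_degreePart hw.invU_pow_mul_mem,
    SymLoc.grade_of_mem_degreePart (SymLoc.inv_pow_mul_algebraMap_mem p s), pow_zero, mul_one]

include hw in
theorem IsKummerElement.natDegree_le : (D.gradeU ρ w).natDegree ≤ p := by
  rw [hw.gradeU_eq]
  compute_degree

include hw in
theorem IsKummerElement.coeff_eq (hp : p ≠ 0) :
    (D.gradeU ρ w).coeff p = D.invU ρ ^ p * l := by
  rw [hw.gradeU_eq, Polynomial.coeff_add, Polynomial.coeff_C_mul_X_pow, Polynomial.coeff_C,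
    if_pos rfl, if_neg hp, add_zero]

include hw hψ hone in
-- By rank one, `ψ i (x i) ^ p` carries every `p`-fold product into `S (x i) ^ p`, which lies in `S
-- l`. The elements `ψ i (x i)` generate the unit ideal, so membership in `S l` can be checked
-- locally.
theorem IsKummerElement.mem_span {z : D.UPrime ρ}
    (hz : z ∈ LinearMap.range (D.ιU ρ) ^ p) : ∃ c : S, z = c • l := by
  suffices h : z ∈ Submodule.span S {l} by
    obtain ⟨c, hc⟩ := Submodule.mem_span_singleton.1 h
    exact ⟨c, hc.symm⟩
  have key (i : ι') {k : ℕ} {z : D.UPrime ρ} (hz : z ∈ LinearMap.range (D.ιU ρ) ^ k) :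
      ∃ c : S, ψ i (x i) ^ k • z = c • D.ιU ρ (x i) ^ k := by
    induction hz using Submodule.pow_induction_on_left' with
    | algebraMap s => exact ⟨s, by rw [pow_zero, one_smul, pow_zero, smul_eq_mulU, mul_one]⟩
    | add y z i _ _ hy hz =>
      obtain ⟨c, hc⟩ := hy
      obtain ⟨d, hd⟩ := hz
      exact ⟨c + d, by rw [smul_add, hc, hd, add_smul]⟩
    | mem_mul m hm j z _ hz =>
      obtain ⟨y, rfl⟩ := hm
      obtain ⟨c, hc⟩ := hz
      refine ⟨ψ i y * c, ?_⟩
      have h1 : ψ i (x i) • D.ιU ρ y = ψ i y • D.ιU ρ (x i) := by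
        rw [← map_smul, hψ, map_smul]
      rw [pow_succ', ← smul_mul_smul_comm, h1, hc, smul_mul_smul_comm, ← pow_succ']
  refine Submodule.mem_of_span_eq_top_of_smul_pow_mem _ (Set.range fun i => ψ i (x i)) ?_ _ ?_
  · rw [Ideal.eq_top_iff_one, ← hone]
    exact Ideal.sum_mem _ fun i _ => Ideal.subset_span ⟨i, rfl⟩
  · rintro ⟨_, i, rfl⟩
    obtain ⟨c, hc⟩ := key i hz
    obtain ⟨d, hd⟩ := hw.exists_smul (x i)
    refine ⟨p, ?_⟩
    change ψ i (x i) ^ p • z ∈ _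
    rw [hc, hd]
    exact Submodule.smul_mem _ _ (Submodule.smul_mem _ _ (Submodule.mem_span_singleton_self l))

include hw hψ hone in
-- Division with remainder: `w` behaves like a monic polynomial of degree `p`, since the top
-- components of elements of `P(p)` are exactly the `S`-multiples of the top component of `w`.
theorem IsKummerElement.exists_sub_mul_mem (hp : p ≠ 0) {k : ℕ} {z : D.UPrime ρ}
    (hz : z ∈ power ρ ν k) : ∃ q ∈ powerUnion ρ ν, z - q * w ∈ power ρ ν (p - 1) := by
  have hbase {z : D.UPrime ρ} (hz : z ∈ power ρ ν p) : ∃ c : S, z - c • w ∈ power ρ ν (p - 1) := by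
    obtain ⟨m, hm, hm'⟩ := exists_compU_top ν hz
    obtain ⟨c, rfl⟩ := hw.mem_span hψ hone hm
    refine ⟨c, ?_⟩
    have hp1 : p - 1 + 1 = p := Nat.sub_add_cancel (Nat.pos_of_ne_zero hp)
    refine sub_smul_mem_power ν x ψ hψ hone (by rwa [hp1]) (by rw [hp1]; exact hw.mem_power) ?_
    rw [hp1, hm', SymLoc.component_apply]
    erw [hw.coeff_eq hp]
    rw [mul_smul_comm]
  induction hz using Submodule.pow_induction_on_left' with
  | algebraMap s =>
    exact ⟨0, zero_mem _, by rw [zero_mul, sub_zero]; exact algebraMap_mem_power ν _ s⟩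
  | add y z i _ _ hy hz =>
    obtain ⟨c, hc, hc'⟩ := hy
    obtain ⟨d, hd, hd'⟩ := hz
    exact ⟨c + d, add_mem hc hd, by rw [add_mul, add_sub_add_comm]; exact add_mem hc' hd'⟩
  | mem_mul m hm i z _ hz =>
    obtain ⟨y, rfl⟩ := hm
    obtain ⟨q, hq, hq'⟩ := hz
    have h1 := mul_mem_power ν (embed_mem_power_one ν y) hq'
    rw [Nat.add_sub_cancel' (Nat.pos_of_ne_zero hp)] at h1
    obtain ⟨c, hc⟩ := hbase h1
    refine ⟨embed ρ ν y * q + algebraMap S _ c,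
      add_mem (mul_mem ⟨1, embed_mem_power_one ν y⟩ hq) (Subalgebra.algebraMap_mem _ _), ?_⟩
    rw [smul_eq_mulU] at hc
    convert hc using 1
    ring

include hw hψ hone in
-- Uniqueness of the remainder. If the top component of `z` were killed by `l`, it would be killed
-- by all `θ ^ p`, hence vanish by `SymLoc.eq_zero_of_forall_mul_eq_zero`.
theorem IsKummerElement.eq_zero_of_natDegree_lt (hp : p ≠ 0) {z : D.UPrime ρ}
    (hz : (D.gradeU ρ (z * w)).natDegree < p) : z = 0 := by
  by_contra hne
  have hne' : D.gradeU ρ z ≠ 0 := by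
    intro h
    apply hne
    have := SymLoc.eval_one_grade z
    erw [h] at this
    simpa using this.symm
  set d := (D.gradeU ρ z).natDegree with hd
  have h1 : (D.gradeU ρ z).coeff d * (D.invU ρ ^ p * l) = 0 := by
    rw [← hw.coeff_eq hp, ← Polynomial.coeff_mul_add_eq_of_natDegree_le le_rfl hw.natDegree_le,
      ← map_mul]
    exact Polynomial.coeff_eq_zero_of_natDegree_lt (by omega)
  have h2 : l * D.compU ρ d z = 0 := by
    have h3 : D.invU ρ ^ p * algebraMap S _ (algebraMap R S (ρ - 1)) ^ p = 1 :=
      SymLoc.inv_pow_mul_pow p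
    rw [SymLoc.component_apply]
    linear_combination algebraMap S (D.UPrime ρ) (algebraMap R S (ρ - 1)) ^ p * h1 -
      l * (D.gradeU ρ z).coeff d * h3
  have h4 := SymLoc.eq_zero_of_forall_mul_eq_zero x ψ hψ hone (k := p)
    (SymLoc.grade_component d z) fun y => by
      obtain ⟨c, hc⟩ := hw.exists_smul y
      rw [hc, smul_mul_assoc]
      erw [h2]
      rw [smul_zero]
  exact hne' (Polynomial.leadingCoeff_eq_zero.1 h4)

end RankOne

end SemilinearAction

/-! ### The algebra cut out by an invariant generator -/

namespace SemilinearAction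

section

variable {R S P : Type*} [CommRing R] [CommRing S] [Algebra R S] {σ : S ≃ₐ[R] S}
  [AddCommGroup P] [Module S P] {D : SemilinearAction σ P} {ρ : R}

/-- In degree `0 < d < p`, a fixed component is killed by `ρ ^ d - 1`, a unit of `R` times `η`,
which is invertible in `U'`. What remains lies in `P(p - 1) ∩ S' = S`. -/
theorem eq_algebraMap_of_scale_eq {p : ℕ} (hp : p.Prime)
    (hρ : (Polynomial.cyclotomic p R).IsRoot ρ) (hη : ρ - 1 ∈ nonZeroDivisors R)
    {ν : D.Normalization} {ι' : Type*} [Fintype ι'] {x : ι' → D.POne ρ}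
    {ψ : ι' → D.POne ρ →ₗ[S] S} (hψ : ∀ i y z, ψ i y • z = ψ i z • y) (hone : ∑ i, ψ i (x i) = 1)
    {z : D.UPrime ρ} (hz : z ∈ power ρ ν (p - 1))
    (hfix : SymLoc.scale (algebraMap S _ (algebraMap R S ρ)) z = z) :
    ∃ c : S, z = algebraMap S _ c := by
  have hcomp (d : ℕ) (hd : d ∈ range (p - 1)) : D.compU ρ (d + 1) z = 0 := by
    rw [Finset.mem_range] at hd
    have h1 := congrArg (D.compU ρ (d + 1)) hfix
    rw [SymLoc.component_scale] at h1
    obtain ⟨v, hv⟩ := isUnit_geom_sum hp hρ hη (i := d + 1) (by omega) (by omega)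
    have h2 := geom_sum_mul ρ (d + 1)
    rw [← hv] at h2
    have h3 : D.compU ρ (d + 1) z * algebraMap S _ (algebraMap R S ((v : R) * (ρ - 1))) = 0 := by
      rw [h2, map_sub (algebraMap R S) (ρ ^ (d + 1)) 1, map_sub (algebraMap S _), map_pow, map_pow, map_one,
        map_one, mul_sub, h1, mul_one, sub_self]
    have h4 := congrArg (algebraMap R S) (v.inv_mul)
    have h5 := congrArg (algebraMap S (D.UPrime ρ)) h4
    have h6 := invU_mul (D := D) (ρ := ρ)
    rw [map_mul (algebraMap R S), map_mul (algebraMap S _)] at h3 h5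
    rw [map_one, map_one] at h5
    generalize algebraMap S (D.UPrime ρ) (algebraMap R S (v : R)) = a at *
    generalize algebraMap S (D.UPrime ρ) (algebraMap R S (v⁻¹ : Rˣ)) = b at *
    linear_combination b * D.invU ρ * h3 - D.compU ρ (d + 1) z * a * b * h6 -
      D.compU ρ (d + 1) z * h5
  have h1 := SymLoc.sum_component z (natDegree_gradeU_le ν hz)
  rw [Finset.sum_range_succ'] at h1
  erw [Finset.sum_eq_zero hcomp] at h1
  rw [zero_add] at h1
  obtain ⟨s, hs⟩ := exists_compU_zero ν hz
  erw [hs] at h1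
  rw [← h1] at hz
  obtain ⟨c, hc⟩ := exists_algebraMap_of_mem_power ν x ψ hψ hone hz
  exact ⟨c, by rw [← h1, hc]⟩

end

variable {R S P : Type u} [CommRing R] [CommRing S] [Algebra R S] {σ : S ≃ₐ[R] S}
  [AddCommGroup P] [Module S P] {D : SemilinearAction σ P} {ρ : R}

set_option maxHeartbeats 1000000 in
/-- The ring `T` attached to an invariant generator of `P(p)`: the quotient of `S[P(1)] ⊆ U'` by
the generator. -/
theorem exists_ring_of_isKummerElement {p : ℕ} (hp : p.Prime)
    (hρ : (Polynomial.cyclotomic p R).IsRoot ρ) (hη : ρ - 1 ∈ nonZeroDivisors R)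
    (hηS : algebraMap R S (ρ - 1) ∈ nonZeroDivisors S) {n : ℕ}
    (hσ : ∀ s, σ^[n] s = s) (hact : ∀ x, D.act^[n] x = D.tau x)
    {ν : D.Normalization} {ι' : Type*} [Fintype ι'] {x : ι' → D.POne ρ}
    {ψ : ι' → D.POne ρ →ₗ[S] S} (hψ : ∀ i y z, ψ i y • z = ψ i z • y) (hone : ∑ i, ψ i (x i) = 1)
    {w l : D.UPrime ρ} {s : S} (hw : IsKummerElement ν p w l s) :
    ∃ (T : Type u) (_ : CommRing T) (_ : Algebra S T) (f : T →+* T),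
      (∀ a, f (algebraMap S T a) = algebraMap S T (σ a)) ∧ (∀ t, f^[n * p] t = t) ∧
      Function.Injective (algebraMap S T) ∧ (∀ t, f^[n] t = t → t ∈ Set.range (algebraMap S T)) ∧
      ∀ i, 0 < i → i < p → Ideal.span (Set.range fun t => t - f^[n * i] t) = ⊤ := by
  set E := powerUnion ρ ν with hE
  have hp0 : p ≠ 0 := hp.ne_zero
  let w' : E := ⟨w, p, hw.mem_power⟩
  let fE : E →+* E := (D.actU ρ).restrict E E (fun z hz => by
    obtain ⟨k, hk⟩ := hz
    exact ⟨k, actU_mem_power ν hk⟩)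
  have hfE (k : ℕ) (z : E) : ((fE^[k] z : E) : D.UPrime ρ) = (D.actU ρ)^[k] z := by
    induction k with
    | zero => rfl
    | succ k ih => rw [Function.iterate_succ_apply', Function.iterate_succ_apply', ← ih]; rfl
  let I : Ideal E := Ideal.span {w'}
  have hfw : fE w' = w' := Subtype.ext hw.actU_eq
  have hI : I ≤ I.comap fE := by
    rw [Ideal.span_le, Set.singleton_subset_iff]
    change fE w' ∈ I
    rw [hfw]
    exact Ideal.mem_span_singleton_self _
  let f : E ⧸ I →+* E ⧸ I := Ideal.quotientMap I fE hI
  have hf (k : ℕ) (z : E) : f^[k] (Ideal.Quotient.mk I z) = Ideal.Quotient.mk I (fE^[k] z) := by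
    induction k with
    | zero => rfl
    | succ k ih =>
      rw [Function.iterate_succ_apply', Function.iterate_succ_apply', ih, Ideal.quotientMap_mk]
  have hmem {z : E} : z ∈ I ↔ ∃ q ∈ E, (z : D.UPrime ρ) = q * w := by
    rw [Ideal.mem_span_singleton']
    exact ⟨fun ⟨q, hq⟩ => ⟨q, q.2, (congrArg Subtype.val hq).symm⟩,
      fun ⟨q, hq, h⟩ => ⟨⟨q, hq⟩, Subtype.ext h.symm⟩⟩
  -- A nonzero multiple of `w` has degree at least `p`, so `P(k)` embeds in the quotient for `k <
  -- p`.
  have hzero {z : E} {k : ℕ} (hk : k < p) (hz : (z : D.UPrime ρ) ∈ power ρ ν k) (hzI : z ∈ I) :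
      z = 0 := by
    obtain ⟨q, hq, h⟩ := hmem.1 hzI
    have h1 := natDegree_gradeU_le ν hz
    rw [h] at h1
    have h2 := hw.eq_zero_of_natDegree_lt hψ hone hp0 (h1.trans_lt hk)
    refine Subtype.ext ?_
    rw [h, h2, zero_mul]
    rfl
  have hscale (z : D.UPrime ρ) := iterate_actU_eq_scale (ρ := ρ) hσ hact z
  refine ⟨E ⧸ I, inferInstance, inferInstance, f, fun a => ?_, fun t => ?_, ?_, fun t ht => ?_,
    fun i hi hip => ?_⟩
  · change f (Ideal.Quotient.mk I (algebraMap S E a)) = Ideal.Quotient.mk I (algebraMap S E (σ a))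
    rw [Ideal.quotientMap_mk]
    congr 1
    exact Subtype.ext (actU_algebraMap a)
  · obtain ⟨z, rfl⟩ := Ideal.Quotient.mk_surjective t
    rw [hf]
    congr 1
    refine Subtype.ext ?_
    rw [hfE, Function.iterate_mul]
    have h1 : (D.actU ρ)^[n] = SymLoc.scale (algebraMap S _ (algebraMap R S ρ)) := funext hscale
    rw [h1, ← RingHom.coe_pow]
    suffices h : (SymLoc.scale (algebraMap S (D.UPrime ρ) (algebraMap R S ρ))) ^ p =
        RingHom.id (D.UPrime ρ) from RingHom.congr_fun h _
    refine SymLoc.ringHom_ext (fun a => ?_) (fun y => ?_)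
    · rw [RingHom.coe_pow]
      exact Function.iterate_fixed (SymLoc.scale_algebraMap _ _) p
    · rw [RingHom.coe_pow, RingHom.id_apply]
      have (k : ℕ) : (SymLoc.scale (algebraMap S (D.UPrime ρ) (algebraMap R S ρ)))^[k]
          (D.ιU ρ y) = D.ιU ρ y * algebraMap S _ (algebraMap R S ρ) ^ k := by
        induction k with
        | zero => simp
        | succ k ih =>
          rw [Function.iterate_succ_apply', ih, map_mul, map_pow, SymLoc.scale_ι,
            SymLoc.scale_algebraMap, pow_succ']
          ring
      rw [this, ← map_pow (algebraMap S _), ← map_pow (algebraMap R S),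
        pow_eq_one_of_isRoot_cyclotomic hρ, map_one, map_one, mul_one]
  · rw [injective_iff_map_eq_zero]
    intro a ha
    have h1 : algebraMap S E a ∈ I := Ideal.Quotient.eq_zero_iff_mem.1 ha
    have h2 := hzero hp.pos (algebraMap_mem_power ν 0 a) h1
    refine SymLoc.algebraMap_injective (M := D.POne ρ) hηS ?_
    rw [map_zero]
    exact congrArg Subtype.val h2
  · obtain ⟨z, rfl⟩ := Ideal.Quotient.mk_surjective t
    obtain ⟨k, hk⟩ := z.2
    -- Pass to the representative in `P(p - 1)`. For it, being fixed modulo `w` means being fixed in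
    -- `U'`.
    obtain ⟨q, hq, hq'⟩ := hw.exists_sub_mul_mem hψ hone hp0 hk
    set y : E := z - ⟨q, hq⟩ * w' with hy
    have hyz : Ideal.Quotient.mk I y = Ideal.Quotient.mk I z := by
      rw [hy, map_sub (Ideal.Quotient.mk I), sub_eq_self, Ideal.Quotient.eq_zero_iff_mem]
      exact Ideal.mul_mem_left _ _ (Ideal.mem_span_singleton_self _)
    have hymem : (y : D.UPrime ρ) ∈ power ρ ν (p - 1) := hq'
    rw [← hyz] at ht ⊢
    rw [hf] at ht
    have h1 : fE^[n] y - y = 0 := by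
      refine hzero (k := p - 1) (by have := hp.pos; omega) ?_ (Ideal.Quotient.eq.1 ht)
      change ((fE^[n] y : E) : D.UPrime ρ) - y ∈ _
      rw [hfE]
      exact sub_mem (iterate_actU_mem_power ν n hymem) hymem
    have h2 : SymLoc.scale (algebraMap S _ (algebraMap R S ρ)) (y : D.UPrime ρ) = y := by
      rw [← hscale, ← hfE, sub_eq_zero.1 h1]
    obtain ⟨c, hc⟩ := eq_algebraMap_of_scale_eq hp hρ hη hψ hone hymem h2
    refine ⟨c, congrArg (Ideal.Quotient.mk I) (?_ : algebraMap S E c = y)⟩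
    exact Subtype.ext hc.symm
  · set J := Ideal.span (Set.range fun t => t - f^[n * i] t) with hJ
    -- The preimage of `J`, viewed inside `U'`. It is shown to contain `P₁`, therefore `P₁ ^ p`, and
    -- therefore `l`.
    let JU : Submodule S (D.UPrime ρ) := Submodule.map E.val.toLinearMap
      ((J.comap (Ideal.Quotient.mk I)).restrictScalars S)
    have hJU {z : D.UPrime ρ} (hz : z ∈ JU) (hzE : z ∈ E) :
        Ideal.Quotient.mk I ⟨z, hzE⟩ ∈ J := by
      obtain ⟨y, hy, rfl⟩ := hz
      exact hy
    obtain ⟨v, hv⟩ := isUnit_geom_sum hp hρ hη hi hip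
    -- `τ ^ k X = X + (1 + ρ + ⋯ + ρ ^ (k - 1)) θ`. For `k = i` the factor is a unit.
    have htau (x : P) (k : ℕ) : embed ρ ν (D.tau^[k] x) = embed ρ ν x +
        algebraMap S _ (algebraMap R S (∑ j ∈ range k, ρ ^ j)) * D.ιU ρ (D.toOne ρ x) := by
      have h1 (k : ℕ) : D.toOne ρ (D.tau^[k] x) = algebraMap R S (ρ ^ k) • D.toOne ρ x := by
        induction k with
        | zero => simp
        | succ k ih =>
          rw [Function.iterate_succ_apply', toOne_tau, ih, smul_smul, ← map_mul, pow_succ']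
      induction k with
      | zero => simp
      | succ k ih =>
        rw [Function.iterate_succ_apply', embed_tau, ih, h1, map_smul, smul_eq_mulU,
          Finset.sum_range_succ, map_add (algebraMap R S), map_add (algebraMap S _)]
        ring
    have hι (y : D.POne ρ) : D.ιU ρ y ∈ JU := by
      obtain ⟨x, rfl⟩ := toOne_surjective y
      let X : E := ⟨embed ρ ν x, 1, embed_mem_power_one ν x⟩
      have h1 : Ideal.Quotient.mk I (X - fE^[n * i] X) ∈ J := by
        rw [map_sub (Ideal.Quotient.mk I), ← hf]
        exact Ideal.subset_span ⟨_, rfl⟩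
      have h2 : ((X - fE^[n * i] X : E) : D.UPrime ρ) ∈ JU := ⟨_, h1, rfl⟩
      have h3 : ((X - fE^[n * i] X : E) : D.UPrime ρ) =
          -(algebraMap R S v • D.ιU ρ (D.toOne ρ x)) := by
        change embed ρ ν x - ((fE^[n * i] X : E) : D.UPrime ρ) = _
        have h4 : D.act^[n] = D.tau := funext hact
        rw [hfE, iterate_actU_embed, Function.iterate_mul, h4, htau, ← hv, smul_eq_mulU]
        ring
      rw [h3] at h2
      have h4 := Submodule.smul_mem _ (algebraMap R S (v⁻¹ : Rˣ)) (Submodule.neg_mem _ h2)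
      rwa [neg_neg, smul_smul, ← map_mul (algebraMap R S), v.inv_mul, map_one, one_smul] at h4
    have hl : l ∈ JU := by
      have h1 := hw.mem_pow
      obtain ⟨m, rfl⟩ : ∃ m, p = m + 1 := ⟨p - 1, by have := hp.pos; omega⟩
      rw [pow_succ] at h1
      refine (Submodule.mul_le.2 ?_ : LinearMap.range (D.ιU ρ) ^ m * LinearMap.range (D.ιU ρ) ≤ JU)
        h1
      rintro a ha _ ⟨y, rfl⟩
      have haE : a ∈ E := by
        refine ⟨m, ?_⟩
        have : LinearMap.range (D.ιU ρ) ≤ LinearMap.range (embed ρ ν) := by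
          rintro _ ⟨y, rfl⟩
          exact ιU_mem_range_embed ν y
        exact pow_le_pow_left' this m ha
      obtain ⟨z, hz, hz'⟩ := hι y
      refine ⟨⟨a, haE⟩ * z, Ideal.mul_mem_left _ _ hz, ?_⟩
      rw [← hz']
      rfl
    have hlE : l ∈ E := by
      obtain ⟨z, -, rfl⟩ := hl
      exact z.2
    have h1 := hJU hl hlE
    -- `l + s = η ^ p w` vanishes in the quotient, and this makes `l` a unit there.
    have h2 : Ideal.Quotient.mk I ⟨l, hlE⟩ = -algebraMap S (E ⧸ I) s := by
      rw [← sub_eq_zero, sub_neg_eq_add]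
      change Ideal.Quotient.mk I (⟨l, hlE⟩ + algebraMap S E s) = 0
      rw [Ideal.Quotient.eq_zero_iff_mem, hmem]
      refine ⟨algebraMap S _ (algebraMap R S (ρ - 1)) ^ p,
        pow_mem (Subalgebra.algebraMap_mem _ _) _, ?_⟩
      have h3 : D.invU ρ ^ p * algebraMap S _ (algebraMap R S (ρ - 1)) ^ p = 1 :=
        SymLoc.inv_pow_mul_pow p
      change l + algebraMap S _ s = _
      rw [hw.eq_add]
      linear_combination -(l + algebraMap S (D.UPrime ρ) s) * h3
    rw [h2] at h1
    refine Ideal.eq_top_of_isUnit_mem _ h1 ?_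
    exact (hw.isUnit.map (algebraMap S (E ⧸ I))).neg

end SemilinearAction

/-! ### Cyclic groups -/

section Cyclic

variable {G : Type*} [CommGroup G] {p r : ℕ} {σ : G} {C : Subgroup G}

theorem finite_of_card_eq {G : Type*} {p r : ℕ} (hp : p.Prime) (hG : Nat.card G = p ^ (r + 1)) : Finite G :=
  Nat.finite_of_card_ne_zero (by rw [hG]; exact pow_ne_zero _ hp.ne_zero)

theorem exists_pow_eq [Finite G] (hσ : ∀ g : G, g ∈ Subgroup.zpowers σ) (g : G) :
    ∃ k : ℕ, σ ^ k = g :=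
  (isOfFinOrder_of_finite σ).mem_powers_iff_mem_zpowers.2 (hσ g)

/-- An element `σ ^ k` of `C` is killed by `p`, so `p ^ (r + 1)` divides `k p` and `p ^ r` divides
`k`. -/
theorem exists_pow_eq_of_mem (hp : p.Prime) (hG : Nat.card G = p ^ (r + 1))
    (hσ : ∀ g : G, g ∈ Subgroup.zpowers σ) (hC : Nat.card C = p) {c : G} (hc : c ∈ C) :
    ∃ i < p, c = σ ^ (p ^ r * i) := by
  have := finite_of_card_eq hp hG
  obtain ⟨k, rfl⟩ := exists_pow_eq hσ c
  have h1 : (σ ^ k) ^ p = 1 := by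
    have : (⟨σ ^ k, hc⟩ : C) ^ Nat.card C = 1 := pow_card_eq_one'
    rw [hC] at this
    exact congrArg Subtype.val this
  rw [← pow_mul, ← orderOf_dvd_iff_pow_eq_one, orderOf_eq_card_of_forall_mem_zpowers hσ, hG,
    pow_succ] at h1
  obtain ⟨i, rfl⟩ := Nat.dvd_of_mul_dvd_mul_right hp.pos h1
  refine ⟨i % p, Nat.mod_lt _ hp.pos, ?_⟩
  rw [pow_eq_pow_iff_modEq, orderOf_eq_card_of_forall_mem_zpowers hσ, hG, pow_succ]
  exact (Nat.mod_modEq i p).symm.mul_left' (p ^ r)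

theorem card_quotient_eq (hp : p.Prime) (hG : Nat.card G = p ^ (r + 1)) (hC : Nat.card C = p) :
    Nat.card (G ⧸ C) = p ^ r := by
  have := Subgroup.card_eq_card_quotient_mul_card_subgroup C
  rw [hG, hC, pow_succ] at this
  exact (Nat.eq_of_mul_eq_mul_right hp.pos this).symm

theorem mem_zpowers_mk (hσ : ∀ g : G, g ∈ Subgroup.zpowers σ) (g : G ⧸ C) :
    g ∈ Subgroup.zpowers (σ : G ⧸ C) := by
  obtain ⟨g, rfl⟩ := QuotientGroup.mk_surjective g
  obtain ⟨k, rfl⟩ := hσ g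
  exact ⟨k, rfl⟩

/-- An endomorphism of a ring of finite order extends to an action of a cyclic group. -/
theorem exists_mulSemiringAction {T : Type*} [CommRing T] [Finite G]
    (hσ : ∀ g : G, g ∈ Subgroup.zpowers σ) (f : T →+* T) (hf : ∀ t, f^[Nat.card G] t = t) :
    ∃ _ : MulSemiringAction G T, ∀ t : T, σ • t = f t := by
  have h1 : f ^ Nat.card G = 1 := RingHom.ext fun t => by rw [RingHom.coe_pow, hf]; rfl
  let v : (T →+* T)ˣ := Units.ofPowEqOne f (Nat.card G) h1 Nat.card_pos.ne'
  let F : G →* (T →+* T)ˣ := monoidHomOfForallMemZpowers hσ (g' := v) (by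
    rw [orderOf_eq_card_of_forall_mem_zpowers hσ]
    exact orderOf_dvd_of_pow_eq_one (Units.pow_ofPowEqOne _ _))
  refine ⟨MulSemiringAction.compHom T ((Units.coeHom (T →+* T)).comp F), fun t => ?_⟩
  have h2 : F σ = v := monoidHomOfForallMemZpowers_apply_gen _ _
  change (F σ : T →+* T) t = f t
  rw [h2]
  rfl

end Cyclic

/-! ### From a ring with an endomorphism to a `G`-Galois extension -/

theorem extendsToGalois_of_ring {p r : ℕ} (hp : p.Prime)
    {R S : Type u} [CommRing R] [CommRing S] [Algebra R S]
    {G : Type v} [CommGroup G] (hG : Nat.card G = p ^ (r + 1))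
    {σ : G} (hσ : ∀ g : G, g ∈ Subgroup.zpowers σ)
    {C : Subgroup G} (hC : Nat.card C = p) (hτ : σ ^ p ^ r ∈ C)
    [MulSemiringAction (G ⧸ C) S] [SMulCommClass (G ⧸ C) R S]
    (hS : IsGaloisExtension (G ⧸ C) R S) {T : Type u} [CommRing T] [Algebra S T] (f : T →+* T)
    (hfS : ∀ a : S, f (algebraMap S T a) = algebraMap S T ((σ : G ⧸ C) • a))
    (hf : ∀ t, f^[p ^ r * p] t = t) (hinj : Function.Injective (algebraMap S T))
    (hfix : ∀ t, f^[p ^ r] t = t → t ∈ Set.range (algebraMap S T))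
    (hspan : ∀ i, 0 < i → i < p → Ideal.span (Set.range fun t => t - f^[p ^ r * i] t) = ⊤) :
    ExtendsToGalois C R S := by
  have hfin := finite_of_card_eq hp hG
  obtain ⟨act, hact⟩ := exists_mulSemiringAction hσ f (by rwa [hG, pow_succ])
  have hpow (k : ℕ) (t : T) : σ ^ k • t = f^[k] t := by
    induction k with
    | zero => simp
    | succ k ih => rw [pow_succ', mul_smul, ih, hact, Function.iterate_succ_apply']
  have hsmul (g : G) (a : S) : g • algebraMap S T a = algebraMap S T ((g : G ⧸ C) • a) := by
    obtain ⟨k, rfl⟩ := exists_pow_eq hσ g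
    rw [hpow]
    induction k with
    | zero => simp
    | succ k ih =>
      rw [Function.iterate_succ_apply', ih, hfS, smul_smul, ← QuotientGroup.mk_mul, ← pow_succ']
  let algT : Algebra R T := ((algebraMap S T).comp (algebraMap R S)).toAlgebra
  have htower : IsScalarTower R S T := IsScalarTower.of_algebraMap_eq fun _ => rfl
  have hR (a : R) : algebraMap R T a = algebraMap S T (algebraMap R S a) := rfl
  have hcomm : SMulCommClass G R T := ⟨fun g a t => by
    rw [Algebra.smul_def, Algebra.smul_def, smul_mul', hR, hsmul, smul_algebraMap]⟩
  refine ⟨T, inferInstance, algT, inferInstance, htower, act, hcomm, ⟨hfin, ?_, ?_, ?_⟩, hinj,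
    ?_, hsmul⟩
  · exact hinj.comp hS.injective
  · intro t ht
    obtain ⟨a, rfl⟩ := hfix t (by rw [← hpow, ht])
    obtain ⟨b, rfl⟩ := hS.fixed a fun g => by
      obtain ⟨g, rfl⟩ := QuotientGroup.mk_surjective g
      exact hinj (by rw [← hsmul, ht])
    exact ⟨b, rfl⟩
  · refine exists_coordinates fun g hg => ?_
    -- A nontrivial element of `C` is a power of `τ` and falls under `hspan`. An element outside `C`
    -- acts nontrivially on `S`, where the coordinates of `S / R` already write `1` through
    -- differences.
    by_cases hgC : g ∈ C
    · obtain ⟨i, hi, rfl⟩ := exists_pow_eq_of_mem hp hG hσ hC hgC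
      simp_rw [hpow]
      refine hspan i (Nat.pos_of_ne_zero fun h => hg ?_) hi
      rw [h, mul_zero, pow_zero]
    · obtain ⟨n, x, y, h0, h1⟩ := hS.coordinates
      have h2 := h1 (g : G ⧸ C) (fun h => hgC ((QuotientGroup.eq_one_iff g).1 h))
      rw [Ideal.eq_top_iff_one]
      have h3 : (1 : T) = ∑ i, algebraMap S T (x i) *
          (algebraMap S T (y i) - g • algebraMap S T (y i)) := by
        simp_rw [hsmul, ← map_sub, ← map_mul, ← map_sum, mul_sub, Finset.sum_sub_distrib]
        rw [h0, h2, sub_zero, map_one]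
      rw [h3]
      exact Ideal.sum_mem _ fun i _ => Ideal.mul_mem_left _ _ (Ideal.subset_span ⟨_, rfl⟩)
  · ext t
    constructor
    · rintro ⟨a, rfl⟩ c hc
      rw [hsmul, (QuotientGroup.eq_one_iff c).2 hc, one_smul]
    · intro ht
      exact hfix t (by rw [← hpow]; exact ht _ hτ)

/-! ### Splitting modules of cyclic crossed products -/

section SplittingModule

variable {K B : Type*} [CommRing K] [CommRing B] [Algebra K B] {φ : B →ₐ[K] B} {n : ℕ} {a : K}

/-- For `i > 0`, apply `φ ^ i` to the relation of index `n - i`. -/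
theorem sum_pow_mul_of_coordinates (hφ : φ ^ n = 1) {m : ℕ} {x y : Fin m → B}
    (hxy : ∀ i < n, ∑ l, x l * (φ ^ i) (y l) = if i = 0 then 1 else 0) {i : ℕ} (hi : i < n) :
    ∑ l, y l * (φ ^ i) (x l) = if i = 0 then 1 else 0 := by
  rcases Nat.eq_zero_or_pos i with rfl | h0
  · simpa [mul_comm] using hxy 0 hi
  · have h1 := congrArg (φ ^ i) (hxy (n - i) (by omega))
    rw [if_neg (by omega), map_zero, map_sum] at h1
    rw [if_neg h0.ne', ← h1]
    refine Finset.sum_congr rfl fun l _ => ?_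
    rw [map_mul, ← AlgHom.mul_apply, ← pow_add, Nat.add_sub_cancel' hi.le, hφ, AlgHom.one_apply,
      mul_comm]

theorem sum_algebraMap_mul_of_coordinates (hn : 0 < n) {t : B → K}
    (ht : ∀ b, algebraMap K B (t b) = ∑ i ∈ range n, (φ ^ i) b) {m : ℕ} {x y : Fin m → B}
    (hxy : ∀ i < n, ∑ l, x l * (φ ^ i) (y l) = if i = 0 then 1 else 0) (b : B) :
    ∑ l, algebraMap K B (t (b * y l)) * x l = b := by
  simp_rw [ht, Finset.sum_mul]
  rw [Finset.sum_comm, Finset.sum_eq_single 0]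
  · have := hxy 0 hn
    simp only [pow_zero, AlgHom.one_apply, if_true] at this ⊢
    simp_rw [mul_assoc, ← Finset.mul_sum, mul_comm (y _), this, mul_one]
  · intro i hi hi0
    have := hxy i (Finset.mem_range.1 hi)
    rw [if_neg hi0] at this
    simp_rw [map_mul, mul_assoc, ← Finset.mul_sum, mul_comm ((φ ^ i) (y _)), this, mul_zero]
  · intro h
    exact absurd (Finset.mem_range.2 hn) h

variable {P : Type*} [AddCommGroup P] [Module K P] [Module (CrossedProduct K B φ n a) P]
  [IsScalarTower K (CrossedProduct K B φ n a) P] [Module B P]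

/-- A splitting module of a cyclic crossed product over `B / K` is a `B`-module of rank one. -/
theorem IsSplittingModule.exists_rankOne
    (hsplit : IsSplittingModule K (CrossedProduct K B φ n a) P)
    (hB : ∀ (b : B) (x : P), b • x = CrossedProduct.ofBase φ n a b • x)
    (hn : 0 < n) (ha : IsUnit a) (hφ : φ ^ n = 1)
    (htr : ∀ b, ∃ k, algebraMap K B k = ∑ i ∈ range n, (φ ^ i) b) {m : ℕ} {x y : Fin m → B}
    (hxy : ∀ i < n, ∑ l, x l * (φ ^ i) (y l) = if i = 0 then 1 else 0)
    (hK : Function.Injective (algebraMap K (CrossedProduct K B φ n a))) :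
    ∃ (d : ℕ) (v : Fin d → P) (f : Fin d → P →ₗ[B] B),
      (∀ i z w, f i z • w = f i w • z) ∧ ∑ i, f i (v i) = 1 := by
  obtain ⟨hfin, hproj, hbij⟩ := hsplit
  choose t ht using htr
  have hyx (i) (hi : i < n) := sum_pow_mul_of_coordinates hφ hxy hi
  have hexp := sum_algebraMap_mul_of_coordinates hn ht hxy
  have hexp' := sum_algebraMap_mul_of_coordinates hn ht hyx
  have hKP (k : K) (z : P) : algebraMap K B k • z = k • z := by
    rw [hB, AlgHom.commutes, algebraMap_smul]
  have hinj {c d : CrossedProduct K B φ n a} (h : ∀ z : P, c • z = d • z) : c = d :=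
    hbij.1 (LinearMap.ext h)
  set u := CrossedProduct.u φ n a with hu
  have husurj (i : ℕ) : Function.Surjective fun z : P => u ^ i • z := by
    induction i with
    | zero => exact fun z => ⟨z, by simp⟩
    | succ i ih =>
      intro z
      obtain ⟨b, hb⟩ := ha.exists_right_inv
      obtain ⟨w, hw⟩ := ih (u ^ (n - 1) • b • z)
      refine ⟨w, ?_⟩
      change u ^ i • w = _ at hw
      change u ^ (i + 1) • w = z
      rw [pow_succ', mul_smul, hw, ← mul_smul, ← pow_succ', Nat.sub_add_cancel hn,
        CrossedProduct.u_pow, algebraMap_smul, ← mul_smul, hb, one_smul]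
  -- Since `u` acts surjectively, the annihilator of `P` in `B` is stable under `φ`, so the traces
  -- of its elements kill `P` and vanish. By `hexp` those traces are the coordinates of the element.
  have hfaithful : FaithfulSMul B P := by
    refine ⟨fun {b c} hbc => ?_⟩
    rw [← sub_eq_zero]
    have h1 (z : P) : (b - c) • z = 0 := by rw [sub_smul, hbc, sub_self]
    generalize b - c = b at h1
    have h2 (b : B) (h1 : ∀ z : P, b • z = 0) (i : ℕ) (z : P) : (φ ^ i) b • z = 0 := by
      obtain ⟨w, rfl⟩ := husurj i z
      change (φ ^ i) b • u ^ i • w = 0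
      rw [hB, ← mul_smul, ← CrossedProduct.u_pow_mul_ofBase, mul_smul, ← hB, h1, smul_zero]
    have h3 (c : B) : t (b * c) = 0 := by
      refine hK (hinj fun z => ?_)
      rw [algebraMap_smul, ← hKP, ht, Finset.sum_smul, map_zero, zero_smul]
      exact Finset.sum_eq_zero fun i _ => h2 _ (fun z => by rw [mul_comm, mul_smul, h1, smul_zero])
        i z
    rw [← hexp b]
    exact Finset.sum_eq_zero fun l _ => by rw [h3, map_zero, zero_mul]
  -- `h` is the action of some `c = ∑ b i u ^ i` which commutes with `B`. Hence `c = ∑ x l c y l`,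
  -- and moving `y l` past `u ^ i` produces the factor `∑ x l φ ^ i (y l)`, which leaves only `b 0`.
  have hend (h : P →ₗ[B] P) : ∃ b : B, ∀ z, h z = b • z := by
    let hKlin : P →ₗ[K] P :=
      { toFun := h
        map_add' := map_add h
        map_smul' k z := by rw [← hKP, map_smul, hKP]; rfl }
    obtain ⟨c, hc⟩ := hbij.2 hKlin
    have hc' (z : P) : c • z = h z := LinearMap.congr_fun hc z
    have hcomm (b : B) : CrossedProduct.ofBase φ n a b * c = c * CrossedProduct.ofBase φ n a b :=
      hinj fun z => by rw [mul_smul, mul_smul, hc', hc', ← hB, ← hB, map_smul]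
    obtain ⟨b, hb⟩ := CrossedProduct.exists_eq_sum φ n a hn c
    refine ⟨b 0, fun z => ?_⟩
    rw [← hc', hB]
    congr 1
    have h0 : ∑ l, CrossedProduct.ofBase φ n a (x l) * CrossedProduct.ofBase φ n a (y l) = 1 := by
      have := congrArg (CrossedProduct.ofBase φ n a) (hxy 0 hn)
      simpa using this
    calc c = ∑ l, CrossedProduct.ofBase φ n a (x l) * (c * CrossedProduct.ofBase φ n a (y l)) := by
          simp_rw [← hcomm, ← mul_assoc]
          rw [← Finset.sum_mul, h0, one_mul]
      _ = ∑ i ∈ range n, CrossedProduct.ofBase φ n a (b i * ∑ l, x l * (φ ^ i) (y l)) *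
            u ^ i := by
          conv_lhs => rw [hb]
          simp_rw [Finset.sum_mul, Finset.mul_sum]
          rw [Finset.sum_comm]
          refine Finset.sum_congr rfl fun i _ => ?_
          rw [map_sum, Finset.sum_mul]
          refine Finset.sum_congr rfl fun l _ => ?_
          rw [mul_assoc (CrossedProduct.ofBase φ n a (b i)), CrossedProduct.u_pow_mul_ofBase]
          simp only [← mul_assoc, ← map_mul]
          rw [mul_comm (x l)]
      _ = CrossedProduct.ofBase φ n a (b 0) := by
          rw [Finset.sum_eq_single 0]
          · rw [hxy 0 hn]; simp
          · intro i hi hi0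
            rw [hxy i (Finset.mem_range.1 hi), if_neg hi0]
            simp
          · intro h
            exact absurd (Finset.mem_range.2 hn) h
  obtain ⟨d, v, f, hvf⟩ := exists_dualBasis (K := K) (P := P)
  have hlin (g : P →ₗ[K] K) (b : B) (z : P) : ∑ l, algebraMap K B (g (x l • b • z)) * y l =
      b * ∑ l, algebraMap K B (g (x l • z)) * y l := by
    have h1 (l : Fin m) : algebraMap K B (g (x l • b • z)) =
        ∑ j, algebraMap K B (t (x l * b * y j)) * algebraMap K B (g (x j • z)) := by
      rw [← mul_smul]
      conv_lhs => rw [← hexp (x l * b)]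
      rw [Finset.sum_smul, map_sum, map_sum]
      refine Finset.sum_congr rfl fun j _ => ?_
      rw [mul_smul, hKP, map_smul, smul_eq_mul, map_mul]
    simp_rw [h1, Finset.sum_mul]
    rw [Finset.sum_comm, Finset.mul_sum]
    refine Finset.sum_congr rfl fun j _ => ?_
    conv_rhs => rw [mul_left_comm, ← hexp' (b * y j), Finset.mul_sum]
    refine Finset.sum_congr rfl fun l _ => ?_
    rw [show x l * b * y j = b * y j * x l by ring]
    ring
  -- The `B`-linear form whose trace is the given `K`-linear form `f i`. In this way a dual basis
  -- over `K` gives one over `B`.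
  let F (i : Fin d) : P →ₗ[B] B :=
    { toFun z := ∑ l, algebraMap K B (f i (x l • z)) * y l
      map_add' z w := by simp [add_mul, Finset.sum_add_distrib]
      map_smul' b z := hlin (f i) b z }
  have hF (z : P) : ∑ i, F i z • v i = z := by
    change ∑ i, (∑ l, algebraMap K B (f i (x l • z)) * y l) • v i = z
    simp_rw [Finset.sum_smul, mul_comm _ (y _), mul_smul, hKP]
    rw [Finset.sum_comm]
    simp_rw [← Finset.smul_sum, hvf, ← mul_smul, ← Finset.sum_smul]
    have := hyx 0 hn
    simp only [pow_zero, AlgHom.one_apply, if_true] at this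
    rw [this, one_smul]
  obtain ⟨h1, h2⟩ := rankOne_of_scalar_endomorphisms hend v F hF
  exact ⟨d, v, F, fun i => h1 (F i), h2⟩

end SplittingModule

/-! ### The rings `R[C](1)` and `S[C](1)` -/

section GroupRingOne

variable {A C : Type*} [CommRing A] [CommGroup C] (τ : C) (ρ : A)

/-- The structure map `A → A[C](1)`. -/
noncomputable def groupRingOneC : A →+* GroupRingOne A τ ρ :=
  (Ideal.Quotient.mk _).comp (algebraMap A (MonoidAlgebra A C))

/-- The structure map `C → A[C](1)`. -/
noncomputable def groupRingOneOf : C →* GroupRingOne A τ ρ :=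
  (Ideal.Quotient.mk _ : MonoidAlgebra A C →+* GroupRingOne A τ ρ).toMonoidHom.comp
    (MonoidAlgebra.of A C)

theorem groupRingOneOf_self : groupRingOneOf τ ρ τ = tauOne τ ρ := rfl

variable {τ ρ}

theorem groupRingOne_induction {motive : GroupRingOne A τ ρ → Prop} (b : GroupRingOne A τ ρ)
    (single : ∀ (c : C) (s : A), motive (groupRingOneC τ ρ s * groupRingOneOf τ ρ c))
    (add : ∀ b b', motive b → motive b' → motive (b + b')) : motive b := by
  obtain ⟨b, rfl⟩ := Ideal.Quotient.mk_surjective b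
  induction b using MonoidAlgebra.induction_linear with
  | zero =>
    have h := single 1 0
    rw [map_zero, zero_mul] at h
    rwa [map_zero]
  | add x y hx hy => rw [map_add]; exact add _ _ hx hy
  | single c s =>
    have h : MonoidAlgebra.single c s = algebraMap A (MonoidAlgebra A C) s *
        MonoidAlgebra.of A C c := by
      simp [MonoidAlgebra.single_mul_single]
    rw [h, map_mul]
    exact single c s

theorem tauOne_relation :
    (tauOne τ ρ - groupRingOneC τ ρ ρ) * (tauOne τ ρ - 1) = 0 :=
  Ideal.Quotient.eq_zero_iff_mem.2 (Ideal.mem_span_singleton_self _)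

theorem isUnit_tauOne : IsUnit (tauOne τ ρ) :=
  (Group.isUnit τ).map (groupRingOneOf τ ρ)

variable {S : Type*} [CommRing S] [Algebra A S] (σ : S ≃ₐ[A] S)

theorem algebraMap_groupRingOneC (r : A) :
    algebraMap (GroupRingOne A τ ρ) (GroupRingOne S τ (algebraMap A S ρ)) (groupRingOneC τ ρ r) =
      groupRingOneC τ _ (algebraMap A S r) := by
  refine congrArg (Ideal.Quotient.mk _)
    (?_ : MonoidAlgebra.mapRingHom C (algebraMap A S) (algebraMap A _ r) = algebraMap S _ _)
  simp

theorem algebraMap_groupRingOneOf (c : C) :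
    algebraMap (GroupRingOne A τ ρ) (GroupRingOne S τ (algebraMap A S ρ)) (groupRingOneOf τ ρ c) =
      groupRingOneOf τ _ c := by
  refine congrArg (Ideal.Quotient.mk _)
    (?_ : MonoidAlgebra.mapRingHom C (algebraMap A S) (MonoidAlgebra.of A C c) =
      MonoidAlgebra.of S C c)
  simp

theorem sigmaOne_groupRingOneC (s : S) :
    sigmaOne σ τ ρ (groupRingOneC τ _ s) = groupRingOneC τ _ (σ s) := by
  refine congrArg (Ideal.Quotient.mk _)
    (?_ : MonoidAlgebra.mapRingHom C (σ : S →+* S) (algebraMap S _ s) = algebraMap S _ _)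
  simp

theorem sigmaOne_groupRingOneOf (c : C) :
    sigmaOne σ τ ρ (groupRingOneOf τ _ c) = groupRingOneOf τ _ c := by
  rw [← algebraMap_groupRingOneOf, AlgHom.commutes]

theorem sigmaOne_pow_groupRingOneC (i : ℕ) (s : S) :
    (sigmaOne σ τ ρ ^ i) (groupRingOneC τ _ s) = groupRingOneC τ _ (σ^[i] s) := by
  induction i with
  | zero => rfl
  | succ i ih =>
    rw [pow_succ', AlgHom.mul_apply, ih, sigmaOne_groupRingOneC, Function.iterate_succ_apply']

theorem sigmaOne_pow_groupRingOneOf (i : ℕ) (c : C) :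
    (sigmaOne σ τ ρ ^ i) (groupRingOneOf τ _ c) = groupRingOneOf τ _ c := by
  rw [← algebraMap_groupRingOneOf, AlgHom.commutes]

theorem sigmaOne_pow_eq_one {n : ℕ} (hσ : ∀ s, σ^[n] s = s) : sigmaOne σ τ ρ ^ n = 1 := by
  refine AlgHom.ext fun b => ?_
  induction b using groupRingOne_induction with
  | single c s =>
    rw [map_mul, sigmaOne_pow_groupRingOneC, sigmaOne_pow_groupRingOneOf, hσ, AlgHom.one_apply]
  | add b b' hb hb' => rw [map_add, hb, hb', map_add]

theorem exists_algebraMap_eq_sum_sigmaOne {n : ℕ}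
    (htr : ∀ s, ∃ r, algebraMap A S r = ∑ i ∈ range n, σ^[i] s)
    (b : GroupRingOne S τ (algebraMap A S ρ)) : ∃ k : GroupRingOne A τ ρ,
      algebraMap _ _ k = ∑ i ∈ range n, (sigmaOne σ τ ρ ^ i) b := by
  induction b using groupRingOne_induction with
  | single c s =>
    obtain ⟨r, hr⟩ := htr s
    refine ⟨groupRingOneC τ ρ r * groupRingOneOf τ ρ c, ?_⟩
    simp_rw [map_mul, sigmaOne_pow_groupRingOneC, sigmaOne_pow_groupRingOneOf]
    rw [algebraMap_groupRingOneC, algebraMap_groupRingOneOf, hr, map_sum, Finset.sum_mul]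
  | add b b' hb hb' =>
    obtain ⟨k, hk⟩ := hb
    obtain ⟨k', hk'⟩ := hb'
    exact ⟨k + k', by simp_rw [map_add, hk, hk', Finset.sum_add_distrib]⟩

theorem sigmaOne_coordinates {n m : ℕ} {x y : Fin m → S}
    (hxy : ∀ i < n, ∑ l, x l * σ^[i] (y l) = if i = 0 then 1 else 0) (i : ℕ) (hi : i < n) :
    ∑ l, groupRingOneC τ (algebraMap A S ρ) (x l) *
      (sigmaOne σ τ ρ ^ i) (groupRingOneC τ _ (y l)) = if i = 0 then 1 else 0 := by
  simp_rw [sigmaOne_pow_groupRingOneC, ← map_mul, ← map_sum, hxy i hi]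
  split_ifs <;> simp

/-- The homomorphism `A[C](1) → A` which maps `τ` to `ρ`. -/
theorem exists_eval_rho (hτ : ∀ c : C, c ∈ Subgroup.zpowers τ) (hρ : ρ ^ orderOf τ = 1)
    (hpos : orderOf τ ≠ 0) :
    ∃ ev : GroupRingOne A τ ρ →+* A, (∀ s, ev (groupRingOneC τ ρ s) = s) ∧
      ev (tauOne τ ρ) = ρ ∧ ∀ b, ∃ d, b - groupRingOneC τ ρ (ev b) =
        (tauOne τ ρ - groupRingOneC τ ρ ρ) * d := by
  let v : Aˣ := Units.ofPowEqOne ρ (orderOf τ) hρ hpos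
  let F : C →* Aˣ := monoidHomOfForallMemZpowers hτ (g' := v)
    (orderOf_dvd_of_pow_eq_one (Units.pow_ofPowEqOne _ _))
  have hF : F τ = v := monoidHomOfForallMemZpowers_apply_gen _ _
  let ev' : MonoidAlgebra A C →ₐ[A] A := MonoidAlgebra.lift A A C ((Units.coeHom A).comp F)
  have hev' (c : C) : ev' (MonoidAlgebra.of A C c) = F c := by simp [ev']
  have hevτ : ev' (MonoidAlgebra.of A C τ) = ρ := by rw [hev', hF]; rfl
  let ev : GroupRingOne A τ ρ →+* A := Ideal.Quotient.lift _ ev'.toRingHom (fun x hx => by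
    obtain ⟨y, rfl⟩ := Ideal.mem_span_singleton'.1 hx
    change ev' _ = 0
    rw [map_mul, map_mul, map_sub ev', hevτ, AlgHom.commutes]
    simp)
  have h1 (s : A) : ev (groupRingOneC τ ρ s) = s := AlgHom.commutes ev' s
  have h2 : ev (tauOne τ ρ) = ρ := hevτ
  refine ⟨ev, h1, h2, fun b => ?_⟩
  have hpow (c : C) : ∃ k : ℕ, c = τ ^ k := by
    have hfin : IsOfFinOrder τ := orderOf_pos_iff.1 (Nat.pos_of_ne_zero hpos)
    obtain ⟨k, hk⟩ := hfin.mem_powers_iff_mem_zpowers.2 (hτ c)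
    exact ⟨k, hk.symm⟩
  induction b using groupRingOne_induction with
  | single c s =>
    obtain ⟨k, rfl⟩ := hpow c
    obtain ⟨d, hd⟩ := sub_dvd_pow_sub_pow (tauOne τ ρ) (groupRingOneC τ ρ ρ) k
    refine ⟨groupRingOneC τ ρ s * d, ?_⟩
    rw [map_mul, h1, map_pow, map_pow, groupRingOneOf_self, h2, map_mul, map_pow]
    linear_combination groupRingOneC τ ρ s * hd
  | add b b' hb hb' =>
    obtain ⟨d, hd⟩ := hb
    obtain ⟨d', hd'⟩ := hb'
    refine ⟨d + d', ?_⟩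
    rw [map_add, map_add]
    linear_combination hd + hd'

end GroupRingOne

/-! ### Splitting modules of `A(1)` -/

section AOneModule

variable {R S C : Type*} [CommRing R] [CommRing S] [Algebra R S] [CommGroup C]
  (σ : S ≃ₐ[R] S) (τ : C) (ρ : R) (n : ℕ)

theorem AOne.ofS_apply (s : S) : AOne.ofS σ τ ρ n s =
    CrossedProduct.ofBase (sigmaOne σ τ ρ) n (tauOne τ ρ) (groupRingOneC τ _ s) := rfl

theorem AOne.tau_eq : AOne.tau σ τ ρ n =
    CrossedProduct.ofBase (sigmaOne σ τ ρ) n (tauOne τ ρ) (tauOne τ _) := by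
  have h := algebraMap_groupRingOneOf (A := R) (S := S) (τ := τ) (ρ := ρ) τ
  rw [groupRingOneOf_self, groupRingOneOf_self] at h
  rw [← h, AlgHom.commutes]
  rfl

theorem AOne.u_pow : AOne.u σ τ ρ n ^ n = AOne.tau σ τ ρ n :=
  CrossedProduct.u_pow _ _ _

variable {σ τ ρ n} {P : Type*} [AddCommGroup P] [Module (GroupRingOne R τ ρ) P]
  [Module (AOne σ τ ρ n) P] [IsScalarTower (GroupRingOne R τ ρ) (AOne σ τ ρ n) P]

/-- `P₁` is the base change of `P` along `S[C](1) → S`, `τ ↦ ρ`. The kernel of this map is generated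
by `τ - ρ`, so rank one passes from `P` over `S[C](1)` to `P₁` over `S`. -/
theorem IsSplittingModule.exists_rankOne_POne
    (hsplit : IsSplittingModule (GroupRingOne R τ ρ) (AOne σ τ ρ n) P)
    (hτ : ∀ c : C, c ∈ Subgroup.zpowers τ) (hρ : ρ ^ orderOf τ = 1) (hpos : orderOf τ ≠ 0)
    (hn : 0 < n) (hσ : ∀ s, σ^[n] s = s)
    (htr : ∀ s, ∃ r, algebraMap R S r = ∑ i ∈ range n, σ^[i] s) {m : ℕ} {x y : Fin m → S}
    (hxy : ∀ i < n, ∑ l, x l * σ^[i] (y l) = if i = 0 then 1 else 0)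
    (hK : Function.Injective (algebraMap (GroupRingOne R τ ρ) (AOne σ τ ρ n))) :
    letI := AOne.moduleS σ τ ρ n P
    ∃ (d : ℕ) (v : Fin d → (AOne.action σ τ ρ n P).POne ρ)
      (ψ : Fin d → (AOne.action σ τ ρ n P).POne ρ →ₗ[S] S),
      (∀ i y z, ψ i y • z = ψ i z • y) ∧ ∑ i, ψ i (v i) = 1 := by
  let _ := AOne.moduleS σ τ ρ n P
  let _ : Module (GroupRingOne S τ (algebraMap R S ρ)) P :=
    Module.compHom P (CrossedProduct.ofBase (sigmaOne σ τ ρ) n (tauOne τ ρ)).toRingHom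
  obtain ⟨d, v, f, hf, hone⟩ := hsplit.exists_rankOne (fun _ _ => rfl) hn isUnit_tauOne
    (sigmaOne_pow_eq_one σ hσ) (exists_algebraMap_eq_sum_sigmaOne σ htr)
    (sigmaOne_coordinates σ hxy) hK
  obtain ⟨ev, hev, hevτ, hevd⟩ := exists_eval_rho (A := S) (τ := τ) (ρ := algebraMap R S ρ) hτ
    (by rw [← map_pow, hρ, map_one]) hpos
  set D := AOne.action σ τ ρ n P with hD
  have hS (s : S) (z : P) : s • z = groupRingOneC τ (algebraMap R S ρ) s • z := rfl
  have htau (z : P) : D.tau z = tauOne τ (algebraMap R S ρ) • z := by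
    change AOne.tau σ τ ρ n • z = _
    rw [AOne.tau_eq]
    rfl
  have hsub (b : GroupRingOne S τ (algebraMap R S ρ)) (z : P) :
      D.toOne ρ (b • z) = D.toOne ρ (ev b • z) := by
    obtain ⟨d, hd⟩ := hevd b
    rw [← sub_eq_zero, ← map_sub, hS, ← sub_smul, hd]
    refine (Submodule.Quotient.mk_eq_zero _).2 (LinearMap.mem_range.2 ⟨d • z, ?_⟩)
    rw [mul_smul, sub_smul, ← hS, ← htau]
    simp
  let g (i : Fin d) : P →ₗ[S] S :=
    { toFun z := ev (f i z)
      map_add' z w := by rw [map_add, map_add]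
      map_smul' s z := by rw [hS, map_smul, smul_eq_mul, map_mul, hev]; rfl }
  have hg (i : Fin d) (z : P) : g i z = ev (f i z) := rfl
  let ψ (i : Fin d) : D.POne ρ →ₗ[S] S := Submodule.liftQ _ (g i) (by
    rintro _ ⟨z, rfl⟩
    rw [LinearMap.mem_ker, LinearMap.sub_apply, map_sub, LinearMap.smul_apply, LinearMap.id_apply,
      map_smul (g i), hg, hg, htau, map_smul (f i), smul_eq_mul, map_mul, hevτ, smul_eq_mul,
      sub_self])
  have hψ (i : Fin d) (z : P) : ψ i (D.toOne ρ z) = ev (f i z) := rfl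
  refine ⟨d, fun i => D.toOne ρ (v i), ψ, fun i y z => ?_, ?_⟩
  · obtain ⟨y, rfl⟩ := SemilinearAction.toOne_surjective y
    obtain ⟨z, rfl⟩ := SemilinearAction.toOne_surjective z
    rw [hψ, hψ, ← map_smul, ← map_smul, ← hsub, ← hsub, hf]
  · simp_rw [hψ]
    rw [← map_sum, hone, map_one]

end AOneModule

/-! ### The extension `S / R` expressed through powers of a generator -/

section CyclicGalois

variable {p r : ℕ} {R S : Type*} [CommRing R] [CommRing S] [Algebra R S]
    {G : Type*} [CommGroup G] {σ : G} {C : Subgroup G}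
    [MulSemiringAction (G ⧸ C) S] [SMulCommClass (G ⧸ C) R S]

theorem iterate_toAlgEquiv (g : G ⧸ C) (i : ℕ) (s : S) :
    (MulSemiringAction.toAlgEquiv R S g)^[i] s = g ^ i • s := by
  induction i with
  | zero => simp
  | succ i ih =>
    rw [Function.iterate_succ_apply', ih, pow_succ', mul_smul]
    rfl

theorem iterate_toAlgEquiv_eq (hp : p.Prime) (hG : Nat.card G = p ^ (r + 1))
    (hC : Nat.card C = p) (g : G ⧸ C) (s : S) :
    (MulSemiringAction.toAlgEquiv R S g)^[p ^ r] s = s := by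
  rw [iterate_toAlgEquiv, ← card_quotient_eq hp hG hC, pow_card_eq_one', one_smul]

theorem IsGaloisExtension.exists_algebraMap_eq_sum (hp : p.Prime) (hG : Nat.card G = p ^ (r + 1))
    (hσ : ∀ g : G, g ∈ Subgroup.zpowers σ) (hC : Nat.card C = p)
    (hS : IsGaloisExtension (G ⧸ C) R S) (s : S) : ∃ a, algebraMap R S a =
      ∑ i ∈ range (p ^ r), (MulSemiringAction.toAlgEquiv R S (σ : G ⧸ C))^[i] s := by
  have := hS.finite
  have := Fintype.ofFinite (G ⧸ C)
  obtain ⟨tr, htr⟩ := hS.exists_trace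
  refine ⟨tr s, ?_⟩
  rw [htr, ← sum_range_pow_eq_sum_univ (mem_zpowers_mk hσ), ← Nat.card_eq_fintype_card,
    card_quotient_eq hp hG hC]
  simp_rw [iterate_toAlgEquiv]

theorem IsGaloisExtension.exists_cyclic_coordinates (hp : p.Prime)
    (hG : Nat.card G = p ^ (r + 1)) (hσ : ∀ g : G, g ∈ Subgroup.zpowers σ) (hC : Nat.card C = p)
    (hS : IsGaloisExtension (G ⧸ C) R S) : ∃ (m : ℕ) (x y : Fin m → S),
      ∀ i < p ^ r, ∑ l, x l * (MulSemiringAction.toAlgEquiv R S (σ : G ⧸ C))^[i] (y l) =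
        if i = 0 then 1 else 0 := by
  obtain ⟨m, x, y, h0, h1⟩ := hS.coordinates
  refine ⟨m, x, y, fun i hi => ?_⟩
  simp_rw [iterate_toAlgEquiv]
  split_ifs with h
  · simpa [h] using h0
  · refine h1 _ fun h2 => h ?_
    rw [← orderOf_dvd_iff_pow_eq_one, orderOf_eq_card_of_forall_mem_zpowers (mem_zpowers_mk hσ),
      card_quotient_eq hp hG hC] at h2
    exact Nat.eq_zero_of_dvd_of_lt h2 hi

theorem mem_zpowers_tau (hp : p.Prime) (hG : Nat.card G = p ^ (r + 1))
    (hσ : ∀ g : G, g ∈ Subgroup.zpowers σ) (hC : Nat.card C = p) {τ : C}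
    (hτ : (τ : G) = σ ^ p ^ r) (c : C) : c ∈ Subgroup.zpowers τ := by
  obtain ⟨i, -, hi⟩ := exists_pow_eq_of_mem hp hG hσ hC c.2
  refine ⟨i, Subtype.ext ?_⟩
  change ((τ ^ (i : ℤ) : C) : G) = c
  rw [zpow_natCast, Subgroup.coe_pow, hτ, hi, pow_mul]

theorem orderOf_tau (hp : p.Prime) (hG : Nat.card G = p ^ (r + 1))
    (hσ : ∀ g : G, g ∈ Subgroup.zpowers σ) (hC : Nat.card C = p) {τ : C}
    (hτ : (τ : G) = σ ^ p ^ r) : orderOf τ = p := by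
  rw [orderOf_eq_card_of_forall_mem_zpowers (mem_zpowers_tau hp hG hσ hC hτ), hC]

end CyclicGalois

/-! ### From a splitting module to an extension -/

theorem extendsToGalois_of_splittingModule {p : ℕ} (hp : p.Prime) {r : ℕ}
    {R S : Type u} [CommRing R] [CommRing S] [Algebra R S]
    {ρ : R} (hρ : (Polynomial.cyclotomic p R).IsRoot ρ) (hη : ρ - 1 ∈ nonZeroDivisors R)
    {G : Type v} [CommGroup G] (hG : Nat.card G = p ^ (r + 1))
    {σ : G} (hσ : ∀ g : G, g ∈ Subgroup.zpowers σ)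
    {C : Subgroup G} (hC : Nat.card C = p) {τ : C} (hτ : (τ : G) = σ ^ p ^ r)
    [MulSemiringAction (G ⧸ C) S] [SMulCommClass (G ⧸ C) R S]
    (hS : IsGaloisExtension (G ⧸ C) R S)
    {φ : S ≃ₐ[R] S} (hφ : φ = MulSemiringAction.toAlgEquiv R S (σ : G ⧸ C))
    (hA : IsAzumaya (GroupRingOne R τ ρ) (AOne φ τ ρ (p ^ r)))
    {P : Type u} [AddCommGroup P] [Module (GroupRingOne R τ ρ) P]
    [Module (AOne φ τ ρ (p ^ r)) P]
    [IsScalarTower (GroupRingOne R τ ρ) (AOne φ τ ρ (p ^ r)) P]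
    (hP : IsSplittingModule (GroupRingOne R τ ρ) (AOne φ τ ρ (p ^ r)) P)
    (hN : IsNormalizedWithTrivialPower φ τ ρ (p ^ r) P p) :
    ExtendsToGalois C R S := by
  let _ := AOne.moduleS φ τ ρ (p ^ r) P
  have hn : 0 < p ^ r := pow_pos hp.pos r
  have hφn (s : S) : φ^[p ^ r] s = s := by
    rw [hφ, iterate_toAlgEquiv_eq hp hG hC _ s]
  have hord := orderOf_tau hp hG hσ hC hτ
  obtain ⟨m, x, y, hxy⟩ := hS.exists_cyclic_coordinates hp hG hσ hC
  rw [← hφ] at hxy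
  have htr := hS.exists_algebraMap_eq_sum hp hG hσ hC
  rw [← hφ] at htr
  obtain ⟨d, v, ψ, hψ, hone⟩ := hP.exists_rankOne_POne (mem_zpowers_tau hp hG hσ hC hτ)
    (by rw [hord, pow_eq_one_of_isRoot_cyclotomic hρ]) (by rw [hord]; exact hp.ne_zero) hn hφn
    htr hxy (FaithfulSMul.algebraMap_injective _ _)
  obtain ⟨ν, hν⟩ := hN
  have hact (z : P) : (AOne.action φ τ ρ (p ^ r) P).act^[p ^ r] z =
      (AOne.action φ τ ρ (p ^ r) P).tau z := by
    have (k : ℕ) : (AOne.action φ τ ρ (p ^ r) P).act^[k] z = AOne.u φ τ ρ (p ^ r) ^ k • z := by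
      induction k with
      | zero => simp
      | succ k ih =>
        rw [Function.iterate_succ_apply', ih, pow_succ', mul_smul]
        rfl
    rw [this, AOne.u_pow]
    rfl
  have hηS := hS.regular hη
  obtain ⟨w, l, s, hw⟩ := SemilinearAction.exists_isKummerElement hp hρ hηS hn hφn hxy hact hν
  obtain ⟨T, _, _, f, h1, h2, h3, h4, h5⟩ := SemilinearAction.exists_ring_of_isKummerElement hp hρ
    hη hηS hφn hact hψ hone hw
  exact extendsToGalois_of_ring hp hG hσ hC (hτ ▸ τ.2) hS f
    (fun a => by rw [h1, hφ]; rfl) h2 h3 h4 h5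

/-! ### Cyclic crossed products as endomorphism rings -/

section SplittingModule

variable {K B : Type*} [CommRing K] [CommRing B] [Algebra K B] {φ : B →ₐ[K] B} {n : ℕ} {a : K}

/-- Apply the smaller of the two powers of `φ` to a relation for the difference of the exponents. -/
theorem sum_pow_mul_pow_of_coordinates (hφ : φ ^ n = 1) {m : ℕ} {x y : Fin m → B}
    (hxy : ∀ i < n, ∑ l, x l * (φ ^ i) (y l) = if i = 0 then 1 else 0) {i j : ℕ} (hi : i < n)
    (hj : j < n) : ∑ l, (φ ^ j) (x l) * (φ ^ i) (y l) = if i = j then 1 else 0 := by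
  rcases le_total j i with h | h
  · obtain ⟨k, rfl⟩ := Nat.exists_eq_add_of_le h
    have h1 := congrArg (φ ^ j) (hxy k (by omega))
    rw [map_sum] at h1
    simp_rw [map_mul, ← AlgHom.mul_apply, ← pow_add] at h1
    rw [h1]
    by_cases hk : k = 0 <;> simp [hk]
  · obtain ⟨k, rfl⟩ := Nat.exists_eq_add_of_le h
    have h1 := congrArg (φ ^ i) (sum_pow_mul_of_coordinates hφ hxy (i := k) (by omega))
    rw [map_sum] at h1
    simp_rw [map_mul, ← AlgHom.mul_apply, ← pow_add, mul_comm ((φ ^ i) (y _))] at h1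
    rw [h1]
    by_cases hk : k = 0 <;> simp [hk]

variable {P : Type*} [AddCommGroup P] [Module K P] [Module B P] [IsScalarTower K B P]

/-- A `B`-module of rank one with a compatible semilinear action is a splitting module of the
cyclic crossed product. -/
theorem CrossedProduct.lift_bijective [FaithfulSMul B P]
    (hend : ∀ h : P →ₗ[B] P, ∃ b : B, ∀ x, h x = b • x)
    (hn : 0 < n) (ha : IsUnit a) (hφ : φ ^ n = 1)
    (htr : ∀ b, ∃ k, algebraMap K B k = ∑ i ∈ range n, (φ ^ i) b) {m : ℕ} {x y : Fin m → B}
    (hxy : ∀ i < n, ∑ l, x l * (φ ^ i) (y l) = if i = 0 then 1 else 0)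
    (v : Module.End K P)
    (hskew : ∀ b, v * Algebra.lsmul K K P b = Algebra.lsmul K K P (φ b) * v)
    (hpow : v ^ n = algebraMap K (Module.End K P) a) :
    Function.Bijective (CrossedProduct.lift (φ := φ) (n := n) (a := a)
      (Algebra.lsmul K K P : B →ₐ[K] Module.End K P) v hskew hpow) := by
  choose t ht using htr
  have hyx (i) (hi : i < n) := sum_pow_mul_of_coordinates hφ hxy hi
  have hexp := sum_algebraMap_mul_of_coordinates hn ht hxy
  have hexp' := sum_algebraMap_mul_of_coordinates hn ht hyx
  have hv : IsUnit v := (isUnit_pow_iff hn.ne').1 (by rw [hpow]; exact ha.map _)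
  obtain ⟨v, rfl⟩ := hv
  have hvinv (i : ℕ) (z : P) : ((v : Module.End K P) ^ i)
      ((((v⁻¹ : (Module.End K P)ˣ) : Module.End K P) ^ i) z) = z := by
    rw [← Module.End.mul_apply, ← Units.val_pow_eq_pow_val, ← Units.val_pow_eq_pow_val, inv_pow,
      Units.mul_inv]
    rfl
  have hskew' (i : ℕ) (b : B) (z : P) : ((v : Module.End K P) ^ i) (b • z) =
      (φ ^ i) b • ((v : Module.End K P) ^ i) z := by
    induction i generalizing b z with
    | zero => rfl
    | succ i ih =>
      have h1 : (v : Module.End K P) (b • z) = φ b • (v : Module.End K P) z :=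
        LinearMap.congr_fun (hskew b) z
      rw [pow_succ, Module.End.mul_apply, h1, ih, pow_succ, Module.End.mul_apply, AlgHom.mul_apply]
  set F := CrossedProduct.lift (φ := φ) (n := n) (a := a)
      (Algebra.lsmul K K P : B →ₐ[K] Module.End K P) v hskew hpow with hF
  have hFapply (b : B) (i : ℕ) (z : P) :
      F (ofBase φ n a b * u φ n a ^ i) z = b • ((v : Module.End K P) ^ i) z := by
    rw [map_mul, map_pow, hF, lift_u, lift_ofBase]
    rfl
  constructor
  · rw [injective_iff_map_eq_zero]
    intro c hc
    obtain ⟨b, rfl⟩ := exists_eq_sum φ n a hn c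
    refine Finset.sum_eq_zero fun j hj => ?_
    rw [Finset.mem_range] at hj
    suffices b j = 0 by rw [this, map_zero, zero_mul]
    refine FaithfulSMul.eq_of_smul_eq_smul (α := P) fun z => ?_
    rw [zero_smul]
    obtain ⟨w, rfl⟩ : ∃ w, ((v : Module.End K P) ^ j) w = z := ⟨_, hvinv j z⟩
    -- Evaluate at `y l • w` and multiply by `φ ^ j (x l)`. Summed over `l`, the coordinate
    -- relations isolate the coefficient `b j`.
    have h1 (l : Fin m) : ∑ i ∈ range n, (b i * ((φ ^ j) (x l) * (φ ^ i) (y l))) •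
        ((v : Module.End K P) ^ i) w = 0 := by
      have h2 := congrArg (fun f => (φ ^ j) (x l) • f) (LinearMap.congr_fun hc (y l • w))
      simp only [map_sum, LinearMap.sum_apply, hFapply, hskew', LinearMap.zero_apply, smul_zero,
        Finset.smul_sum, smul_smul] at h2
      rw [← h2]
      refine Finset.sum_congr rfl fun i _ => ?_
      congr 1
      ring
    have h3 : ∑ l, ∑ i ∈ range n, (b i * ((φ ^ j) (x l) * (φ ^ i) (y l))) •
        ((v : Module.End K P) ^ i) w = 0 := Finset.sum_eq_zero fun l _ => h1 l
    rw [Finset.sum_comm] at h3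
    simp_rw [← Finset.sum_smul, ← Finset.mul_sum] at h3
    rw [Finset.sum_eq_single j] at h3
    · rwa [sum_pow_mul_pow_of_coordinates hφ hxy hj hj, if_pos rfl, mul_one] at h3
    · intro i hi hij
      rw [sum_pow_mul_pow_of_coordinates hφ hxy (Finset.mem_range.1 hi) hj, if_neg hij, mul_zero,
        zero_smul]
    · intro h
      exact absurd (Finset.mem_range.2 hj) h
  · intro f
    -- `g i` is the `φ ^ i`-semilinear part of `f`. Composed with `v ^ (-i)` it becomes `B`-linear,
    -- hence a scalar. The parts add up to `f`, since summing over `i` turns `x l` into its trace.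
    let g (i : ℕ) (z : P) : P := ∑ l, (φ ^ i) (x l) • f (y l • z)
    have hg (i : ℕ) (b : B) (z : P) : g i (b • z) = (φ ^ i) b • g i z := by
      have h1 (l : Fin m) : f (y l • b • z) = ∑ j, t (y l * b * x j) • f (y j • z) := by
        rw [smul_smul]
        conv_lhs => rw [← hexp' (y l * b), Finset.sum_smul, map_sum]
        refine Finset.sum_congr rfl fun j _ => ?_
        rw [mul_smul, algebraMap_smul, map_smul]
      simp only [g, h1, Finset.smul_sum]
      rw [Finset.sum_comm]
      refine Finset.sum_congr rfl fun j _ => ?_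
      rw [smul_smul, ← map_mul]
      conv_rhs => rw [← hexp (b * x j), map_sum, Finset.sum_smul]
      refine Finset.sum_congr rfl fun l _ => ?_
      rw [map_mul, AlgHom.commutes, mul_smul, algebraMap_smul, smul_comm,
        show b * x j * y l = y l * b * x j by ring]
    have hscalar (i : ℕ) (hi : i < n) : ∃ c : B, ∀ z, g i z = c • ((v : Module.End K P) ^ i) z := by
      let h : P →ₗ[B] P :=
        { toFun z := g i ((((v⁻¹ : (Module.End K P)ˣ) : Module.End K P) ^ i) z)
          map_add' z w := by simp [g, Finset.sum_add_distrib]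
          map_smul' b z := by
            rw [RingHom.id_apply]
            set w := (((v⁻¹ : (Module.End K P)ˣ) : Module.End K P) ^ i) z with hw
            have hz : ((v : Module.End K P) ^ i) w = z := hvinv i z
            have hb : (φ ^ i) ((φ ^ (n - i)) b) = b := by
              rw [← AlgHom.mul_apply, ← pow_add, Nat.add_sub_cancel' hi.le, hφ, AlgHom.one_apply]
            have h1 : b • z = ((v : Module.End K P) ^ i) ((φ ^ (n - i)) b • w) := by
              rw [hskew', hb, hz]
            have h2 (w : P) : (((v⁻¹ : (Module.End K P)ˣ) : Module.End K P) ^ i)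
                (((v : Module.End K P) ^ i) w) = w := by
              rw [← Module.End.mul_apply, ← Units.val_pow_eq_pow_val, ← Units.val_pow_eq_pow_val,
                inv_pow, Units.inv_mul]
              rfl
            rw [h1, h2, hg, hb] }
      obtain ⟨c, hc⟩ := hend h
      refine ⟨c, fun z => ?_⟩
      rw [← hc]
      change _ = g i _
      congr 1
      rw [← Module.End.mul_apply, ← Units.val_pow_eq_pow_val, ← Units.val_pow_eq_pow_val, inv_pow,
        Units.inv_mul]
      rfl
    choose! c hc using hscalar
    refine ⟨∑ i ∈ range n, ofBase φ n a (c i) * u φ n a ^ i, LinearMap.ext fun z => ?_⟩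
    rw [map_sum, LinearMap.sum_apply]
    calc _ = ∑ i ∈ range n, g i z := Finset.sum_congr rfl fun i hi => by
            rw [hFapply, hc i (Finset.mem_range.1 hi)]
      _ = f z := by
          simp only [g]
          rw [Finset.sum_comm]
          simp_rw [← Finset.sum_smul, ← ht, algebraMap_smul, ← map_smul, ← map_sum]
          congr 1
          have := hexp' 1
          simp_rw [one_mul] at this
          conv_rhs => rw [← one_smul B z, ← this, Finset.sum_smul]
          simp_rw [mul_smul, algebraMap_smul]

end SplittingModule

/-! ### Invariants of `P(p)` -/

theorem eq_zero_of_forall_pow_smul_eq_zero {S M ι : Type*} [CommRing S] [AddCommGroup M]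
    [Module S M] [Fintype ι] {a f : ι → S} (h : ∑ k, a k * f k = 1) (n : ℕ) {x : M}
    (hx : ∀ k, f k ^ n • x = 0) : x = 0 := by
  have h1 : Ideal.span (Set.range f) = ⊤ := by
    rw [Ideal.eq_top_iff_one, ← h]
    exact sum_mem fun k _ => Ideal.mul_mem_left _ _ (Ideal.subset_span ⟨k, rfl⟩)
  have h2 := Ideal.span_pow_eq_top _ h1 n
  have h3 : Ideal.span ((fun x => x ^ n) '' Set.range f) ≤ LinearMap.ker (LinearMap.toSpanSingleton S M x) := by
    rw [Ideal.span_le]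
    rintro _ ⟨_, ⟨k, rfl⟩, rfl⟩
    exact hx k
  rw [h2] at h3
  simpa using h3 (Submodule.mem_top (x := (1 : S)))

namespace SemilinearAction

variable {R S P : Type*} [CommRing R] [CommRing S] [Algebra R S] {σ : S ≃ₐ[R] S}
  [AddCommGroup P] [Module S P] {D : SemilinearAction σ P} {ρ : R} {p : ℕ}
  {L : Type*} [CommRing L] [Algebra S L] {m : D.UPrime ρ →ₐ[S] L}
  {d : ℕ} {a : Fin d → S} {θ : Fin d → D.POne ρ}

/-- This says that `m` identifies `P₁ ^ p` with `S`. Rank one comes from the forms `y ↦ m y * m (θ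
k) ^ (p - 1)`, which take values in `S`. Their values at the `θ k` generate the unit ideal, so it
suffices to compare after multiplying by a power of each; then both sides are multiples of `θ k ^ p`
with coefficients visible through `m`. -/
theorem eq_smul_of_mem_pow (hp : 0 < p) (hS : Function.Injective (algebraMap S L))
    (hm : ∀ y, m (D.ιU ρ y) = 0 → y = 0)
    (hpow : ∀ l ∈ LinearMap.range (D.ιU ρ) ^ p, ∃ s, m l = algebraMap S L s)
    (hone : ∑ k, algebraMap S L (a k) * m (D.ιU ρ (θ k)) ^ p = 1)
    {l : D.UPrime ρ} (hl : l ∈ LinearMap.range (D.ιU ρ) ^ p) {s : S}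
    (hs : m l = algebraMap S L s) : l = s • ∑ k, a k • D.ιU ρ (θ k) ^ p := by
  have hψ (k : Fin d) (y : D.POne ρ) :
      ∃ c, algebraMap S L c = m (D.ιU ρ y) * m (D.ιU ρ (θ k)) ^ (p - 1) := by
    obtain ⟨c, hc⟩ := hpow (D.ιU ρ y * D.ιU ρ (θ k) ^ (p - 1)) (by
      have := Submodule.mul_mem_mul (LinearMap.mem_range_self (D.ιU ρ) y)
        (Submodule.pow_mem_pow _ (LinearMap.mem_range_self (D.ιU ρ) (θ k)) (p - 1))
      rwa [← pow_succ', Nat.sub_add_cancel hp] at this)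
    exact ⟨c, by rw [← hc, map_mul, map_pow]⟩
  choose ψ hψ using hψ
  have hf (k : Fin d) : algebraMap S L (ψ k (θ k)) = m (D.ιU ρ (θ k)) ^ p := by
    rw [hψ, ← pow_succ', Nat.sub_add_cancel hp]
  have hsum : ∑ k, a k * ψ k (θ k) = 1 := hS (by simp_rw [map_sum, map_mul, hf, hone, map_one])
  have hrank (k : Fin d) (y : D.POne ρ) : algebraMap S _ (ψ k (θ k)) * D.ιU ρ y =
      algebraMap S _ (ψ k y) * D.ιU ρ (θ k) := by
    rw [← smul_eq_mulU, ← smul_eq_mulU, ← map_smul, ← map_smul]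
    congr 1
    rw [← sub_eq_zero]
    refine hm _ ?_
    rw [map_sub (D.ιU ρ), map_sub m, map_smul (D.ιU ρ), map_smul (D.ιU ρ), smul_eq_mulU,
      smul_eq_mulU, map_mul, map_mul, AlgHom.commutes, AlgHom.commutes, hψ, hψ]
    ring
  have key (k : Fin d) {n : ℕ} {l : D.UPrime ρ} (hl : l ∈ LinearMap.range (D.ιU ρ) ^ n) :
      ∃ c, algebraMap S _ (ψ k (θ k)) ^ n * l = algebraMap S _ c * D.ιU ρ (θ k) ^ n ∧
        algebraMap S L c = m l * m (D.ιU ρ (θ k)) ^ ((p - 1) * n) := by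
    induction hl using Submodule.pow_induction_on_left' with
    | algebraMap s => exact ⟨s, by simp, by simp⟩
    | add x y i _ _ hx hy =>
      obtain ⟨c, hc, hc'⟩ := hx
      obtain ⟨b, hb, hb'⟩ := hy
      refine ⟨c + b, ?_, ?_⟩
      · rw [map_add (algebraMap S (D.UPrime ρ)), add_mul, mul_add, hc, hb]
      · rw [map_add (algebraMap S L), map_add m, add_mul, hc', hb']
    | mem_mul m' hm' i x _ hx =>
      obtain ⟨y, rfl⟩ := hm'
      obtain ⟨c, hc, hc'⟩ := hx
      refine ⟨ψ k y * c, ?_, ?_⟩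
      · rw [map_mul (algebraMap S (D.UPrime ρ)), Nat.succ_eq_add_one, pow_succ, pow_succ]
        linear_combination algebraMap S _ (ψ k (θ k)) ^ i * x * hrank k y +
          algebraMap S _ (ψ k y) * D.ιU ρ (θ k) * hc
      · rw [map_mul (algebraMap S L), map_mul m, hψ, hc', Nat.succ_eq_add_one, mul_add, pow_add,
          mul_one]
        ring
  set e₀ := ∑ k, a k • D.ιU ρ (θ k) ^ p with he₀
  have he₀mem : e₀ ∈ LinearMap.range (D.ιU ρ) ^ p := sum_mem fun k _ =>
    Submodule.smul_mem _ _ (Submodule.pow_mem_pow _ (LinearMap.mem_range_self _ _) _)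
  have hme₀ : m e₀ = 1 := by
    rw [he₀, map_sum, ← hone]
    exact Finset.sum_congr rfl fun k _ => by
      rw [smul_eq_mulU, map_mul, AlgHom.commutes, map_pow]
  rw [← sub_eq_zero]
  refine eq_zero_of_forall_pow_smul_eq_zero hsum p fun k => ?_
  have key' {l : D.UPrime ρ} (hl : l ∈ LinearMap.range (D.ιU ρ) ^ p) {s : S}
      (hs : m l = algebraMap S L s) : algebraMap S _ (ψ k (θ k)) ^ p * l =
        algebraMap S _ s * algebraMap S _ (ψ k (θ k)) ^ (p - 1) * D.ιU ρ (θ k) ^ p := by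
    obtain ⟨c, hc, hc'⟩ := key k hl
    have : c = s * ψ k (θ k) ^ (p - 1) := hS (by
      rw [hc', hs, map_mul, map_pow, hf, ← pow_mul, mul_comm p])
    rw [hc, this, map_mul, map_pow]
  have h1 := key' hl hs
  have h2 := key' he₀mem (s := 1) (by rw [hme₀, map_one])
  rw [smul_eq_mulU, smul_eq_mulU, map_pow]
  rw [map_one] at h2
  linear_combination h1 - algebraMap S _ s * h2

variable (ν : D.Normalization)

/-- The element `e₀` of `P₁ ^ p` with image `1` is invariant and generates `P₁ ^ p`. An invariant of
`P(p)` has components only in degrees `p` and `0`, so it is `(a e₀ + b) / η ^ p`, where `a` and `b`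
are fixed by `σ` and hence lie in `R`. Integrality of its image makes `a + b` divisible by `η ^ p`.
-/
theorem powerInvariantsTrivial_of_algHom (hp : p.Prime)
    (hρ : (Polynomial.cyclotomic p R).IsRoot ρ) (hη : ρ - 1 ∈ nonZeroDivisors R)
    (hRS : Function.Injective (algebraMap R S))
    (hfix : ∀ s : S, σ s = s → ∃ c, algebraMap R S c = s)
    {n : ℕ} (hσ : ∀ s, σ^[n] s = s) (hact : ∀ x, D.act^[n] x = D.tau x)
    (hS : Function.Injective (algebraMap S L))
    (hm : ∀ y, m (D.ιU ρ y) = 0 → y = 0)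
    (hpow : ∀ l ∈ LinearMap.range (D.ιU ρ) ^ p, ∃ s, m l = algebraMap S L s)
    (hintegral : ∀ z ∈ power ρ ν p, ∀ s, m z = m (D.invU ρ) ^ p * algebraMap S L s →
      ∃ c, m z = algebraMap S L c)
    (hone : ∑ k, algebraMap S L (a k) * m (D.ιU ρ (θ k)) ^ p = 1)
    (hone' : ∑ k, algebraMap S L (σ (a k)) * m (D.ιU ρ (D.actOne ρ (θ k))) ^ p = 1) :
    PowerInvariantsTrivial ρ ν p := by
  set e : D.UPrime ρ := algebraMap S _ (algebraMap R S (ρ - 1)) with he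
  have hie : D.invU ρ * e = 1 := invU_mul
  have hie' (k : ℕ) : D.invU ρ ^ k * e ^ k = 1 := by rw [← mul_pow, hie, one_pow]
  have hSU : Function.Injective (algebraMap S (D.UPrime ρ)) := fun s t h => hS (by
    rw [← m.commutes, h, m.commutes])
  have hinv {z : D.UPrime ρ} (k : ℕ) (h : D.invU ρ ^ k * z = 0) : z = 0 := by
    linear_combination e ^ k * h - z * hie' k
  set e₀ := ∑ k, a k • D.ιU ρ (θ k) ^ p with he₀
  have he₀mem : e₀ ∈ LinearMap.range (D.ιU ρ) ^ p := sum_mem fun k _ =>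
    Submodule.smul_mem _ _ (Submodule.pow_mem_pow _ (LinearMap.mem_range_self _ _) _)
  have hme₀ : m e₀ = 1 := by
    rw [he₀, map_sum, ← hone]
    exact Finset.sum_congr rfl fun k _ => by
      rw [smul_eq_mulU, map_mul, AlgHom.commutes, map_pow]
  have hsmul {l : D.UPrime ρ} (hl : l ∈ LinearMap.range (D.ιU ρ) ^ p) {s : S}
      (hs : m l = algebraMap S L s) : l = s • e₀ :=
    eq_smul_of_mem_pow hp.pos hS hm hpow hone hl hs
  have hacte₀ : D.actU ρ e₀ = e₀ := by
    have h1 : D.actU ρ e₀ = ∑ k, σ (a k) • D.ιU ρ (D.actOne ρ (θ k)) ^ p := by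
      rw [he₀, map_sum]
      exact Finset.sum_congr rfl fun k _ => by rw [actU_smul, map_pow, actU_ιU]
    rw [h1]
    conv_rhs => rw [← one_smul S e₀]
    refine hsmul (sum_mem fun k _ =>
      Submodule.smul_mem _ _ (Submodule.pow_mem_pow _ (LinearMap.mem_range_self _ _) _)) ?_
    rw [map_one, ← hone', map_sum]
    exact Finset.sum_congr rfl fun k _ => by
      rw [smul_eq_mulU, map_mul, AlgHom.commutes, map_pow]
  have hdiv {z : D.UPrime ρ} (hz : z ∈ power ρ ν p) {s : S}
      (h : m z = m (D.invU ρ) ^ p * algebraMap S L s) :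
      ∃ c, s = algebraMap R S (ρ - 1) ^ p * c := by
    obtain ⟨c, hc⟩ := hintegral z hz s h
    refine ⟨c, hS ?_⟩
    have h1 := congrArg m (hie' p)
    rw [map_mul, map_pow, map_pow, he, AlgHom.commutes, map_one] at h1
    rw [map_mul, map_pow, ← hc, h]
    linear_combination (-algebraMap S L s) * h1
  have halg (c : S) : D.invU ρ ^ p * algebraMap S _ (algebraMap R S (ρ - 1) ^ p * c) =
      algebraMap S (D.UPrime ρ) c := by
    rw [map_mul, map_pow, ← he, ← mul_assoc, hie', one_mul]
  -- Combining Kummer elements gives `(e₀ - s) / η ^ p ∈ P(p)` for some `s ∈ S`. By `hdiv`, `1 - s`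
  -- is divisible by `η ^ p`, so `s` may be replaced by `1`.
  have hw : D.invU ρ ^ p * (e₀ - 1) ∈ power ρ ν p := by
    choose x hx using fun k => toOne_surjective (θ k)
    have h1 : D.invU ρ ^ p * (e₀ - algebraMap S _ (∑ k, a k * ν.coord (x k) ^ p)) ∈
        power ρ ν p := by
      have h2 : D.invU ρ ^ p * (e₀ - algebraMap S _ (∑ k, a k * ν.coord (x k) ^ p)) =
          ∑ k, a k • (D.invU ρ ^ p * (D.ιU ρ (D.toOne ρ (x k)) ^ p -
            algebraMap S _ (ν.coord (x k)) ^ p)) := by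
        rw [he₀, map_sum, ← Finset.sum_sub_distrib, Finset.mul_sum]
        refine Finset.sum_congr rfl fun k _ => ?_
        rw [hx, smul_eq_mulU, smul_eq_mulU, map_mul, map_pow]
        ring
      rw [h2]
      exact sum_mem fun k _ => Submodule.smul_mem _ _
        (kummer_mem_power ν hp (sub_one_pow_dvd_of_isRoot_cyclotomic hp hρ) (x k))
    obtain ⟨c, hc⟩ := hdiv h1 (s := 1 - ∑ k, a k * ν.coord (x k) ^ p) (by
      rw [map_mul, map_pow, map_sub m, hme₀, AlgHom.commutes, map_sub (algebraMap S L), map_one])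
    have h3 := sub_mem h1 (algebraMap_mem_power ν p c)
    rw [← halg c, ← hc, map_sub (algebraMap S (D.UPrime ρ)), map_one] at h3
    convert h3 using 1
    ring
  have hwp : D.invU ρ ^ p * e₀ ∈ D.degreePart ρ p := SymLoc.mem_degreePart_iff.2 ⟨p, e₀, he₀mem, rfl⟩
  have hwz : -D.invU ρ ^ p ∈ D.degreePart ρ 0 := by
    have := SymLoc.inv_pow_mul_algebraMap_mem (M := D.POne ρ) (e := algebraMap R S (ρ - 1)) p (-1)
    rwa [map_neg, map_one, mul_neg, mul_one] at this
  let w : D.DegreePZero ρ p := (⟨_, hwp⟩, ⟨_, hwz⟩)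
  let F := LinearMap.toSpanSingleton (FiberRing R (ρ - 1) p) (D.DegreePZero ρ p) w
  have hF1 (c : FiberRing R (ρ - 1) p) : ((F c).1 : D.UPrime ρ) =
      algebraMap R S c.1.1 • (D.invU ρ ^ p * e₀) := rfl
  have hF2 (c : FiberRing R (ρ - 1) p) : ((F c).2 : D.UPrime ρ) =
      algebraMap R S c.1.2 • (-D.invU ρ ^ p) := rfl
  have hmem (x : R × R) : x ∈ FiberRing R (ρ - 1) p ↔ ∃ c, x.2 - x.1 = (ρ - 1) ^ p * c := by
    rw [RingHom.mem_eqLocus]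
    change Ideal.Quotient.mk _ x.1 = Ideal.Quotient.mk _ x.2 ↔ _
    rw [eq_comm, Ideal.Quotient.mk_eq_mk_iff_sub_mem, Ideal.mem_span_singleton]
    rfl
  have hcancel {s t : S} (h : s • (D.invU ρ ^ p * e₀) = t • (D.invU ρ ^ p * e₀)) : s = t := by
    have h2 : D.invU ρ ^ p * ((s - t) • e₀) = 0 := by
      rw [sub_smul, mul_sub, mul_smul_comm, mul_smul_comm, h, sub_self]
    have h3 := congrArg m (hinv p h2)
    rw [smul_eq_mulU, map_mul, hme₀, mul_one, AlgHom.commutes, map_zero] at h3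
    exact sub_eq_zero.1 (hS (by rw [h3, map_zero]))
  have hcancel' {s t : S} (h : s • D.invU ρ ^ p = t • D.invU ρ ^ p) : s = t := by
    have h2 : D.invU ρ ^ p * algebraMap S _ (s - t) = 0 := by
      rw [mul_comm, ← smul_eq_mulU, sub_smul, h, sub_self]
    exact sub_eq_zero.1 (hSU (by rw [hinv p h2, map_zero]))
  refine ⟨LinearMap.range F, ?_, ⟨LinearEquiv.ofInjective F ?_⟩⟩
  · ext z
    constructor
    · rintro ⟨hz, hz'⟩
      -- `τ` fixes `z` and multiplies degree `k` by `ρ ^ k`, while `η` is a multiple of `ρ ^ k - 1`.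
      have hcomp (k : ℕ) (hk : 0 < k) (hkp : k < p) : D.compU ρ k z = 0 := by
        have h1 := iterate_actU_eq_scale hσ hact z
        rw [Function.iterate_fixed hz'] at h1
        have h2 := congrArg (D.compU ρ k) h1
        rw [SymLoc.component_scale] at h2
        obtain ⟨c, hc⟩ := (isUnit_geom_sum hp hρ hη hk hkp).exists_right_inv
        have h3 : (ρ ^ k - 1) * c = ρ - 1 := by
          rw [← geom_sum_mul]
          linear_combination (ρ - 1) * hc
        have h4 := congrArg (fun r => algebraMap S (D.UPrime ρ) (algebraMap R S r)) h3
        simp only [map_mul, map_sub (algebraMap R S), map_sub (algebraMap S (D.UPrime ρ)), map_pow,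
          map_one] at h4
        have h5 : e * D.compU ρ k z = 0 := by
          linear_combination (-D.compU ρ k z) * h4 -
            algebraMap S (D.UPrime ρ) (algebraMap R S c) * h2 -
            D.compU ρ k z * algebraMap_rho (D := D) (ρ := ρ)
        have := congrArg (D.invU ρ * ·) h5
        simpa only [← mul_assoc, hie, one_mul, mul_zero] using this
      have hsum := SymLoc.sum_component z (natDegree_gradeU_le ν hz)
      rw [Finset.sum_range_succ, Finset.sum_eq_single_of_mem 0 (Finset.mem_range.2 hp.pos)
        (fun k hk hk0 => hcomp k (Nat.pos_of_ne_zero hk0) (Finset.mem_range.1 hk))] at hsum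
      obtain ⟨l, hl, hl'⟩ := exists_compU_top ν hz
      obtain ⟨b, hb⟩ := exists_compU_zero ν hz
      obtain ⟨s, hs⟩ := hpow l hl
      obtain rfl := hsmul hl hs
      have hfs : σ s = s := by
        have h1 := compU_actU (D := D) (ρ := ρ) p z
        rw [hz', hl', map_mul, map_pow, actU_invU, actU_smul, hacte₀, mul_smul_comm,
          mul_smul_comm] at h1
        exact (hcancel h1).symm
      have hfb : σ b = b := by
        have h1 := compU_actU (D := D) (ρ := ρ) 0 z
        rw [hz', hb, map_mul, map_pow, actU_invU, actU_algebraMap, mul_comm, mul_comm (_ ^ p),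
          ← smul_eq_mulU, ← smul_eq_mulU] at h1
        exact (hcancel' h1).symm
      obtain ⟨a', rfl⟩ := hfix s hfs
      obtain ⟨b', rfl⟩ := hfix b hfb
      rw [hl', hb] at hsum
      -- Subtracting `a'` times the generator leaves `(a' + b') / η ^ p`.
      obtain ⟨c, hc⟩ := hdiv (sub_mem hz (Submodule.smul_mem _ (algebraMap R S a') hw))
        (s := algebraMap R S (a' + b')) (by
          rw [← hsum, map_sub m, map_add m, map_mul, map_mul, smul_eq_mulU, smul_eq_mulU, map_mul,
            map_mul, map_mul, map_sub m, hme₀, map_one, map_pow, AlgHom.commutes, AlgHom.commutes,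
            map_add (algebraMap R S), map_add (algebraMap S L)]
          ring)
      have hfc : σ c = c := by
        have h1 := congrArg σ hc
        rw [AlgEquiv.commutes, map_mul, map_pow, AlgEquiv.commutes, hc] at h1
        have h2 := congrArg (algebraMap S (D.UPrime ρ)) h1
        have h3 := congrArg (D.invU ρ ^ p * ·) h2
        simp only [halg] at h3
        exact (hSU h3).symm
      obtain ⟨c, rfl⟩ := hfix c hfc
      have hc' : a' + b' = (ρ - 1) ^ p * c := hRS (by rw [hc, map_mul, map_pow])
      -- The sign is due to the component of degree `0` of the generator, which is `-1 / η ^ p`.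
      refine ⟨F ⟨(a', -b'), (hmem _).2 ⟨-c, ?_⟩⟩, ⟨_, rfl⟩, ?_⟩
      · change -b' - a' = _
        linear_combination -hc'
      · rw [DegreePZero.toU, hF1, hF2, ← hsum, smul_eq_mulU, smul_eq_mulU, smul_eq_mulU,
          map_neg (algebraMap R S), map_neg (algebraMap S (D.UPrime ρ))]
        ring
    · rintro ⟨_, ⟨x, rfl⟩, rfl⟩
      rw [DegreePZero.toU, hF1, hF2]
      obtain ⟨c, hc⟩ := (hmem x.1).1 x.2
      have hx : algebraMap R S x.1.1 • (D.invU ρ ^ p * e₀) +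
          algebraMap R S x.1.2 • (-D.invU ρ ^ p) =
          algebraMap R S x.1.1 • (D.invU ρ ^ p * (e₀ - 1)) -
            algebraMap S _ (algebraMap R S c) := by
        rw [← halg, ← map_pow, ← map_mul, ← hc, smul_eq_mulU, smul_eq_mulU, smul_eq_mulU,
          map_sub (algebraMap R S) x.1.2, map_sub (algebraMap S (D.UPrime ρ))]
        ring
      constructor
      · rw [hx]
        exact sub_mem (Submodule.smul_mem _ _ hw) (algebraMap_mem_power ν p _)
      · rw [map_add (D.actU ρ), actU_smul, actU_smul, map_mul, map_neg (D.actU ρ), map_pow,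
          actU_invU, hacte₀, AlgEquiv.commutes, AlgEquiv.commutes]
  · intro x y hxy
    have h1 : ((F x).1 : D.UPrime ρ) = (F y).1 := by rw [hxy]
    have h2 : ((F x).2 : D.UPrime ρ) = (F y).2 := by rw [hxy]
    rw [hF1, hF1] at h1
    rw [hF2, hF2, smul_neg, smul_neg, neg_inj] at h2
    exact Subtype.ext (Prod.ext (hRS (hcancel h1)) (hRS (hcancel' h2)))

end SemilinearAction

namespace SemilinearAction

variable {R S P : Type*} [CommRing R] [CommRing S] [Algebra R S] {σ : S ≃ₐ[R] S}
  [AddCommGroup P] [Module S P] {D : SemilinearAction σ P} {ρ : R} {p : ℕ}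
  (ν : D.Normalization) {T : Type*} [CommRing T] [Algebra S T] {m : D.POne ρ →ₗ[S] T}
  {d : ℕ} {a : Fin d → S} {θ : Fin d → D.POne ρ}

/-- If `P₁` embeds in an extension `T` of `S` in such a way that `P(1) ⊆ T`, `P₁ ^ p ⊆ S` and
`1 ∈ P₁ ^ p`, then `P(p) ^ G ≅ R *ₚ R`. -/
theorem powerInvariantsTrivial_of_linearMap (hp : p.Prime)
    (hρ : (Polynomial.cyclotomic p R).IsRoot ρ) (hη : ρ - 1 ∈ nonZeroDivisors R)
    (hRS : Function.Injective (algebraMap R S))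
    (hfix : ∀ s : S, σ s = s → ∃ c, algebraMap R S c = s)
    {n : ℕ} (hσ : ∀ s, σ^[n] s = s) (hact : ∀ x, D.act^[n] x = D.tau x)
    (hST : Function.Injective (algebraMap S T))
    (hreg : algebraMap S T (algebraMap R S (ρ - 1)) ∈ nonZeroDivisors T)
    (hdesc : ∀ t s, algebraMap S T (algebraMap R S (ρ - 1)) ^ p * t = algebraMap S T s →
      ∃ c, t = algebraMap S T c)
    (hm : Function.Injective m)
    (hintegral : ∀ x, ∃ t, algebraMap S T (algebraMap R S (ρ - 1)) * t =
      m (D.toOne ρ x) - algebraMap S T (ν.coord x))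
    (hpow : ∀ l ∈ LinearMap.range m ^ p, ∃ s, l = algebraMap S T s)
    (hone : ∑ k, algebraMap S T (a k) * m (θ k) ^ p = 1)
    (hone' : ∑ k, algebraMap S T (σ (a k)) * m (D.actOne ρ (θ k)) ^ p = 1) :
    PowerInvariantsTrivial ρ ν p := by
  set e := algebraMap S T (algebraMap R S (ρ - 1)) with he
  -- All of `U'` maps to `L = T(1/η)`, in which `T` embeds because `η` is regular. Under this map
  -- every `P(k)` lands in `T`.
  let L := Localization.Away e
  have hTL : Function.Injective (algebraMap T L) :=
    IsLocalization.injective _ (Submonoid.powers_le.2 hreg)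
  have hunit : IsUnit (algebraMap S L (algebraMap R S (ρ - 1))) := by
    rw [IsScalarTower.algebraMap_apply S T L]
    exact IsLocalization.Away.algebraMap_isUnit e
  let F : D.UPrime ρ →ₐ[S] L :=
    SymLoc.lift ((IsScalarTower.toAlgHom S T L).toLinearMap ∘ₗ m) hunit
  have hF (y : D.POne ρ) : F (D.ιU ρ y) = algebraMap T L (m y) := by simp [F]
  have hinv : F (D.invU ρ) * algebraMap T L e = 1 := by
    have := congrArg F (invU_mul (D := D) (ρ := ρ))
    rwa [map_mul, AlgHom.commutes, map_one, IsScalarTower.algebraMap_apply S T L] at this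
  have hFe : F (D.invU ρ) ^ p * algebraMap T L e ^ p = 1 := by
    rw [← mul_pow, hinv, one_pow]
  refine powerInvariantsTrivial_of_algHom (m := F) (a := a) (θ := θ) ν hp hρ hη hRS hfix hσ hact
    (by rw [IsScalarTower.algebraMap_eq S T L]; exact hTL.comp hST) (fun y hy => ?_)
    (fun l hl => ?_) (fun z hz s hs => ?_) ?_ ?_
  · rw [hF, ← map_zero (algebraMap T L)] at hy
    exact hm ((hTL hy).trans (map_zero m).symm)
  · have key {k : ℕ} {l : D.UPrime ρ} (hl : l ∈ LinearMap.range (D.ιU ρ) ^ k) :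
        ∃ t ∈ LinearMap.range m ^ k, F l = algebraMap T L t := by
      induction hl using Submodule.pow_induction_on_left' with
      | algebraMap s =>
        exact ⟨algebraMap S T s, by rw [pow_zero]; exact Submodule.mem_one.2 ⟨s, rfl⟩, by
          rw [AlgHom.commutes, IsScalarTower.algebraMap_apply S T L]⟩
      | add x y i _ _ hx hy =>
        obtain ⟨t, ht, ht'⟩ := hx
        obtain ⟨v, hv, hv'⟩ := hy
        exact ⟨t + v, add_mem ht hv, by rw [map_add F, ht', hv', map_add]⟩
      | mem_mul x hx i l _ hl =>
        obtain ⟨y, rfl⟩ := hx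
        obtain ⟨t, ht, ht'⟩ := hl
        refine ⟨m y * t, ?_, by rw [map_mul F, ht', hF, map_mul]⟩
        rw [Nat.succ_eq_add_one, pow_succ']
        exact Submodule.mul_mem_mul ⟨_, rfl⟩ ht
    obtain ⟨t, ht, ht'⟩ := key hl
    obtain ⟨s, rfl⟩ := hpow t ht
    exact ⟨s, by rw [ht', IsScalarTower.algebraMap_apply S T L]⟩
  · have key {k : ℕ} {z : D.UPrime ρ} (hz : z ∈ power ρ ν k) : ∃ t, F z = algebraMap T L t := by
      induction hz using Submodule.pow_induction_on_left' with
      | algebraMap s =>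
        exact ⟨algebraMap S T s, by rw [AlgHom.commutes, IsScalarTower.algebraMap_apply S T L]⟩
      | add x y i _ _ hx hy =>
        obtain ⟨t, ht⟩ := hx
        obtain ⟨v, hv⟩ := hy
        exact ⟨t + v, by rw [map_add F, ht, hv, map_add]⟩
      | mem_mul x hx i l _ hl =>
        obtain ⟨y, rfl⟩ := hx
        obtain ⟨t, ht⟩ := hl
        obtain ⟨v, hv⟩ := hintegral y
        refine ⟨v * t, ?_⟩
        have h1 := congrArg (algebraMap T L) hv
        rw [map_mul, map_sub (algebraMap T L)] at h1
        rw [map_mul F, ht, embed_apply, map_mul F, map_sub F, hF, AlgHom.commutes,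
          IsScalarTower.algebraMap_apply S T L, ← h1, map_mul, ← mul_assoc (F _), hinv, one_mul]
    obtain ⟨t, ht⟩ := key hz
    obtain ⟨c, rfl⟩ := hdesc t s (hTL (by
      rw [ht, IsScalarTower.algebraMap_apply S T L] at hs
      rw [map_mul, map_pow, hs]
      linear_combination algebraMap T L (algebraMap S T s) * hFe))
    exact ⟨c, by rw [ht, IsScalarTower.algebraMap_apply S T L]⟩
  · have h1 := congrArg (algebraMap T L) hone
    simpa only [map_sum, map_mul, map_pow, map_one, hF,
      ← IsScalarTower.algebraMap_apply S T L] using h1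
  · have h1 := congrArg (algebraMap T L) hone'
    simpa only [map_sum, map_mul, map_pow, map_one, hF,
      ← IsScalarTower.algebraMap_apply S T L] using h1

end SemilinearAction

/-! ### The module `T(1) = T / (τ - ρ)(τ - 1) T` -/

section GroupRingModule

variable {A C : Type*} [CommRing A] [CommGroup C] {τ : C} {ρ : A}

theorem groupRingOne_map_smul {P Q : Type*} [AddCommGroup P] [AddCommGroup Q]
    [Module (GroupRingOne A τ ρ) P] [Module (GroupRingOne A τ ρ) Q] (f : P →+ Q)
    (hA : ∀ a x, f (groupRingOneC τ ρ a • x) = groupRingOneC τ ρ a • f x)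
    (hC : ∀ c x, f (groupRingOneOf τ ρ c • x) = groupRingOneOf τ ρ c • f x)
    (b : GroupRingOne A τ ρ) (x : P) : f (b • x) = b • f x := by
  induction b using groupRingOne_induction with
  | single c s => rw [mul_smul, hA, hC, mul_smul]
  | add b b' hb hb' => rw [add_smul, map_add, hb, hb', add_smul]

variable {T : Type u} [CommRing T] [Algebra A T] [MulSemiringAction C T]

/-- The projection `T → P` onto a module isomorphic to `T / (τ - ρ)(τ - 1) T`. -/
structure IsOneQuotient {P : Type*} [AddCommGroup P] [Module (GroupRingOne A τ ρ) P]
    (π : T →+ P) : Prop where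
  surjective : Function.Surjective π
  smul_base (a : A) (t : T) : groupRingOneC τ ρ a • π t = π (a • t)
  smul_of (c : C) (t : T) : groupRingOneOf τ ρ c • π t = π (c • t)
  exists_of_eq_zero (t : T) : π t = 0 → ∃ t', t = τ • (τ • t' - t') - ρ • (τ • t' - t')

variable (τ ρ T) in
theorem exists_isOneQuotient [SMulCommClass C A T] : ∃ (P : Type u) (_ : AddCommGroup P)
    (_ : Module (GroupRingOne A τ ρ) P) (π : T →+ P), IsOneQuotient (τ := τ) (ρ := ρ) π := by
  let f : MonoidAlgebra A C →ₐ[A] Module.End A T :=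
    MonoidAlgebra.lift A (Module.End A T) C (DistribMulAction.toModuleEnd A T)
  let _ : Module (MonoidAlgebra A C) T := Module.compHom T f.toRingHom
  have hf (b : MonoidAlgebra A C) (t : T) : b • t = f b t := rfl
  have hA (a : A) (t : T) : algebraMap A (MonoidAlgebra A C) a • t = a • t := by
    rw [hf, AlgHom.commutes]
    rfl
  have hC (c : C) (t : T) : MonoidAlgebra.of A C c • t = c • t := by
    rw [hf]
    simp [f]
  let I : Ideal (MonoidAlgebra A C) := Ideal.span
    {(MonoidAlgebra.of A C τ - algebraMap A (MonoidAlgebra A C) ρ) * (MonoidAlgebra.of A C τ - 1)}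
  refine ⟨T ⧸ (I • ⊤ : Submodule (MonoidAlgebra A C) T), inferInstance,
    inferInstanceAs (Module (MonoidAlgebra A C ⧸ I) _),
    (Submodule.mkQ (I • ⊤ : Submodule (MonoidAlgebra A C) T)).toAddMonoidHom,
    Submodule.mkQ_surjective _, fun a t => ?_, fun c t => ?_, fun t ht => ?_⟩
  · exact congrArg (Submodule.Quotient.mk (p := (I • ⊤ : Submodule (MonoidAlgebra A C) T))) (hA a t)
  · exact congrArg (Submodule.Quotient.mk (p := (I • ⊤ : Submodule (MonoidAlgebra A C) T))) (hC c t)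
  · have h1 : t ∈ (I • ⊤ : Submodule (MonoidAlgebra A C) T) :=
      (Submodule.Quotient.mk_eq_zero _).1 ht
    rw [Submodule.ideal_span_singleton_smul, Submodule.mem_smul_pointwise_iff_exists] at h1
    obtain ⟨t', -, rfl⟩ := h1
    exact ⟨t', by rw [mul_smul, sub_smul, sub_smul, hC, one_smul, hC, hA]⟩

namespace IsOneQuotient

variable {P : Type*} [AddCommGroup P] [Module (GroupRingOne A τ ρ) P] {π : T →+ P}
  (hπ : IsOneQuotient (τ := τ) (ρ := ρ) π)

include hπ

theorem map_eq_zero (t : T) : π (τ • (τ • t - t) - ρ • (τ • t - t)) = 0 := by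
  have h : ((tauOne τ ρ - groupRingOneC τ ρ ρ) * (tauOne τ ρ - 1)) • π t = 0 := by
    rw [tauOne_relation]
    exact zero_smul (GroupRingOne A τ ρ) (π t)
  simp only [mul_smul, sub_smul, one_smul, ← groupRingOneOf_self, hπ.smul_of,
    hπ.smul_base, ← map_sub π] at h
  exact h

/-- An additive map on `T` which kills `(τ - ρ)(τ - 1) T` induces a map on `T(1)`. -/
theorem exists_lift {Q : Type*} [AddCommGroup Q] (f : T →+ Q)
    (hf : ∀ t, f (τ • (τ • t - t)) = f (ρ • (τ • t - t))) :
    ∃ g : P →+ Q, ∀ t, g (π t) = f t := by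
  have hker : π.ker ≤ f.ker := fun t ht => by
    obtain ⟨t', rfl⟩ := hπ.exists_of_eq_zero t ht
    rw [AddMonoidHom.mem_ker, map_sub f, hf, sub_self]
  exact ⟨AddMonoidHom.liftOfSurjective π hπ.surjective ⟨f, hker⟩, fun t =>
    AddMonoidHom.liftOfRightInverse_comp_apply _ _ _ ⟨f, hker⟩ t⟩

variable [Fintype C] [SMulCommClass C A T]

/-- The `A[C](1)`-linear form `t ↦ ∑ c, tr(c⁻¹(t) y) c` on `T(1)`. -/
theorem exists_linearForm (tr : T →ₗ[A] A) (y : T) :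
    ∃ F : P →ₗ[GroupRingOne A τ ρ] GroupRingOne A τ ρ, ∀ t, F (π t) =
      ∑ c : C, groupRingOneC τ ρ (tr (c⁻¹ • t * y)) * groupRingOneOf τ ρ c := by
  let f : T →+ GroupRingOne A τ ρ :=
    { toFun t := ∑ c : C, groupRingOneC τ ρ (tr (c⁻¹ • t * y)) * groupRingOneOf τ ρ c
      map_zero' := by simp
      map_add' t t' := by simp only [smul_add, add_mul, map_add, Finset.sum_add_distrib] }
  have hf (t : T) : f t = ∑ c : C, groupRingOneC τ ρ (tr (c⁻¹ • t * y)) * groupRingOneOf τ ρ c :=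
    rfl
  have hA (a : A) (t : T) : f (a • t) = groupRingOneC τ ρ a * f t := by
    simp_rw [hf, smul_comm _ a t, smul_mul_assoc, map_smul tr, smul_eq_mul, map_mul, Finset.mul_sum,
      mul_assoc]
  have hC (c : C) (t : T) : f (c • t) = groupRingOneOf τ ρ c * f t := by
    rw [hf, hf, Finset.mul_sum]
    refine Fintype.sum_equiv (Equiv.mulLeft c⁻¹) _ _ fun b => ?_
    rw [Equiv.coe_mulLeft, mul_inv_rev, inv_inv, mul_smul, mul_left_comm, ← map_mul,
      mul_inv_cancel_left]
  obtain ⟨F, hF⟩ := hπ.exists_lift f (fun t => by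
    have := tauOne_relation (τ := τ) (ρ := ρ)
    rw [hC, hA, map_sub f, hC, groupRingOneOf_self]
    linear_combination f t * this)
  refine ⟨{ F with map_smul' := groupRingOne_map_smul F (fun a x => ?_) (fun c x => ?_) }, hF⟩
  · obtain ⟨t, rfl⟩ := hπ.surjective x
    rw [hπ.smul_base, hF, hF, hA, smul_eq_mul]
  · obtain ⟨t, rfl⟩ := hπ.surjective x
    rw [hπ.smul_of, hF, hF, hC, smul_eq_mul]

end IsOneQuotient

end GroupRingModule

/-! ### Dual bases over the group ring, and vanishing of cohomology -/

section Coordinates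

variable {A C T : Type*} [CommRing A] [CommGroup C] [Fintype C] [CommRing T] [Algebra A T]
  [MulSemiringAction C T] [SMulCommClass C A T] {m : ℕ} {x y : Fin m → T}

/-- Expand `c⁻¹ • t` in the coordinates, apply `c` and multiply by `c • w`. The sum over `c` is then
`t` times the trace of `w`. This yields a dual basis over the group ring of `C`. -/
theorem sum_trace_smul {tr : T → A}
    (hsum : ∀ t, ∑ j, algebraMap A T (tr (t * y j)) * x j = t) {w : T}
    (hw : ∑ c : C, c • w = 1) (t : T) :
    ∑ j, ∑ c : C, tr (c⁻¹ • t * y j) • c • (w * x j) = t := by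
  rw [Finset.sum_comm]
  have (c : C) : ∑ j, tr (c⁻¹ • t * y j) • c • (w * x j) = c • w * t := by
    have h := congrArg (fun z => c • w * c • z) (hsum (c⁻¹ • t))
    simp only [smul_inv_smul] at h
    rw [← h, Finset.smul_sum, Finset.mul_sum]
    refine Finset.sum_congr rfl fun j _ => ?_
    rw [← Algebra.smul_def, smul_comm c (tr _), smul_mul', mul_smul_comm (tr _)]
  simp_rw [this, ← Finset.sum_mul, hw, one_mul]

variable {τ : C} {p : ℕ}

/-- Vanishing of the twisted Tate cohomology: an element which is killed by `∑ i, a ^ (-i) τ ^ i`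
is a multiple of `τ - a`. -/
theorem exists_of_sum_pow_smul_eq_zero {tr : T →ₗ[A] A}
    (hsum : ∀ t, ∑ j, algebraMap A T (tr (t * y j)) * x j = t) {w : T}
    (hw : ∑ c : C, c • w = 1) (hτ : ∀ c : C, c ∈ Subgroup.zpowers τ) (hp : Fintype.card C = p)
    (a : A) {t : T} (ht : ∑ i ∈ range p, a ^ (p - 1 - i) • τ ^ i • t = 0) :
    ∃ t', t = τ • t' - a • t' := by
  -- `τ - a` divides `τ ^ i - a ^ i`. So in the expansion of `t`, each `τ ^ i` may be replaced by `a
  -- ^ i` modulo the image of `τ - a`.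
  have hpow (i : ℕ) (z : T) : ∃ z', τ ^ i • z - a ^ i • z = τ • z' - a • z' := by
    induction i with
    | zero => exact ⟨0, by simp⟩
    | succ i ih =>
      obtain ⟨z', hz'⟩ := ih
      refine ⟨a • z' + τ ^ i • z, ?_⟩
      have h1 : a • (τ ^ i • z - a ^ i • z) = a • (τ • z' - a • z') := by rw [hz']
      simp only [smul_sub, smul_add, smul_smul, pow_succ', smul_comm τ a z'] at h1 ⊢
      linear_combination (exp := 1) h1
  choose g hg using hpow
  have hτp (i : ℕ) (hi : i < p) : (τ ^ i)⁻¹ = τ * τ ^ (p - 1 - i) := by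
    rw [← pow_succ', inv_eq_iff_mul_eq_one, ← pow_add, show i + (p - 1 - i + 1) = p by omega, ← hp,
      pow_card_eq_one]
  have h1 := sum_trace_smul (C := C) hsum hw t
  simp_rw [← sum_range_pow_eq_sum_univ hτ, hp] at h1
  refine ⟨∑ j, ∑ i ∈ range p, tr ((τ ^ i)⁻¹ • t * y j) • g i (w * x j), ?_⟩
  -- What is left after the replacement is governed by `∑ i, a ^ i τ ^ (-i) t`, which is `τ` applied
  -- to the element assumed to vanish, as `τ ^ (-i) = τ τ ^ (p - 1 - i)`.
  have h2 (j : Fin m) : ∑ i ∈ range p, tr ((τ ^ i)⁻¹ • t * y j) • a ^ i • (w * x j) = 0 := by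
    simp_rw [smul_smul, ← Finset.sum_smul]
    have h3 : ∑ i ∈ range p, tr ((τ ^ i)⁻¹ • t * y j) * a ^ i =
        tr (τ • (∑ i ∈ range p, a ^ (p - 1 - i) • τ ^ i • t) * y j) := by
      rw [← Finset.sum_range_reflect, Finset.smul_sum, Finset.sum_mul, map_sum]
      refine Finset.sum_congr rfl fun i hi => ?_
      rw [Finset.mem_range] at hi
      rw [hτp _ (by omega), show p - 1 - (p - 1 - i) = i by omega, mul_smul, smul_comm τ (a ^ _),
        smul_mul_assoc (a ^ _), map_smul tr (a ^ _), smul_eq_mul, mul_comm]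
    rw [h3, ht, smul_zero, zero_mul, map_zero, zero_smul]
  simp_rw [Finset.smul_sum, ← Finset.sum_sub_distrib, smul_comm τ (tr _), smul_comm a (tr _),
    ← smul_sub, ← hg, smul_sub]
  simp_rw [Finset.sum_sub_distrib, h2]
  rw [h1, Finset.sum_const_zero, sub_zero]

end Coordinates

namespace IsOneQuotient

variable {A C : Type*} [CommRing A] [CommGroup C] [Fintype C] {τ : C} {ρ : A}
  {T : Type u} [CommRing T] [Algebra A T] [MulSemiringAction C T] [SMulCommClass C A T]
  {P : Type*} [AddCommGroup P] [Module (GroupRingOne A τ ρ) P] {π : T →+ P}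
  (hπ : IsOneQuotient (τ := τ) (ρ := ρ) π) {tr : T →ₗ[A] A} {m : ℕ} {x y : Fin m → T}
  (hsum : ∀ t, ∑ j, algebraMap A T (tr (t * y j)) * x j = t) {w : T} (hw : ∑ c : C, c • w = 1)

include hπ

include hsum hw in
theorem exists_dualBasis : ∃ F : Fin m → P →ₗ[GroupRingOne A τ ρ] GroupRingOne A τ ρ,
    (∀ j t, F j (π t) = ∑ c : C, groupRingOneC τ ρ (tr (c⁻¹ • t * y j)) * groupRingOneOf τ ρ c) ∧
      ∀ z, ∑ j, F j z • π (w * x j) = z := by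
  choose F hF using fun j => hπ.exists_linearForm tr (y j)
  refine ⟨F, hF, fun z => ?_⟩
  obtain ⟨t, rfl⟩ := hπ.surjective z
  simp_rw [hF, Finset.sum_smul, mul_smul, hπ.smul_of, hπ.smul_base, ← map_sum]
  rw [sum_trace_smul hsum hw]

include hsum hw in
theorem finite : Module.Finite (GroupRingOne A τ ρ) P := by
  obtain ⟨F, -, hF⟩ := hπ.exists_dualBasis hsum hw
  exact finite_of_dualBasis _ F hF

include hsum hw in
theorem projective : Module.Projective (GroupRingOne A τ ρ) P := by
  obtain ⟨F, -, hF⟩ := hπ.exists_dualBasis hsum hw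
  exact projective_of_dualBasis _ F hF

/-- The forms attached to `w' * y j` have values at the classes of the `x j` adding up to `1`: only
`c = 1` survives, with coefficient `tr w'`. -/
theorem faithfulSMul {w' : T} (hw' : tr w' = 1) (h0 : ∑ i, x i * y i = 1)
    (h1 : ∀ c : C, c ≠ 1 → ∑ i, x i * c • y i = 0) : FaithfulSMul (GroupRingOne A τ ρ) P := by
  obtain ⟨h0', h1'⟩ := sum_smul_mul_of_coordinates h0 h1
  choose F hF using fun j => hπ.exists_linearForm tr (w' * y j)
  have hone : ∑ j, F j (π (x j)) = 1 := by
    simp_rw [hF]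
    rw [Finset.sum_comm, Finset.sum_eq_single 1]
    · simp_rw [← Finset.sum_mul, ← map_sum, inv_one, one_smul, mul_left_comm _ w', ← Finset.mul_sum]
      rw [h0, mul_one, hw', map_one, map_one, mul_one]
    · intro c _ hc
      simp_rw [← Finset.sum_mul, ← map_sum, mul_left_comm _ w', ← Finset.mul_sum, mul_comm _ (y _)]
      rw [h1' _ (inv_ne_one.2 hc), mul_zero, map_zero, map_zero, zero_mul]
    · exact fun h => absurd (Finset.mem_univ _) h
  refine ⟨fun {b b'} h => ?_⟩
  rw [← mul_one b, ← mul_one b', ← hone, Finset.mul_sum, Finset.mul_sum]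
  refine Finset.sum_congr rfl fun j _ => ?_
  have h2 := map_smul (F j) b (π (x j))
  rwa [h, map_smul, smul_eq_mul, smul_eq_mul, eq_comm] at h2

include hsum hw in
-- Write `h` in the dual basis and lift its values to elements `k j` of `T`. Expanding the traces
-- gives a double sum over `C`; after a change of variable and commutation in `T`, the factor `d •
-- t` acquires the coefficient `tr (∑ y j * d⁻¹ • k j)`.
theorem exists_smul_of_linearMap (htr : ∀ t, algebraMap A T (tr t) = ∑ c : C, c • t)
    (h : P →ₗ[GroupRingOne A τ ρ] P) : ∃ b : GroupRingOne A τ ρ, ∀ z, h z = b • z := by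
  obtain ⟨F, hF, hFsum⟩ := hπ.exists_dualBasis hsum hw
  choose k hk using fun j => hπ.surjective (h (π (w * x j)))
  refine ⟨∑ d : C, groupRingOneC τ ρ (tr (∑ j, y j * d⁻¹ • k j)) * groupRingOneOf τ ρ d,
    fun z => ?_⟩
  obtain ⟨t, rfl⟩ := hπ.surjective z
  conv_lhs => rw [← hFsum (π t), map_sum]
  simp_rw [map_smul, ← hk, hF, Finset.sum_smul, mul_smul, hπ.smul_of, hπ.smul_base, ← map_sum]
  congr 1
  simp_rw [Algebra.smul_def, htr, Finset.sum_mul, Finset.smul_sum, Finset.sum_mul, smul_mul']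
  have key (j : Fin m) : ∑ c : C, ∑ d : C, d • c⁻¹ • t * d • y j * c • k j =
      ∑ d : C, ∑ c : C, c • y j * c • d⁻¹ • k j * d • t := by
    rw [Finset.sum_comm]
    conv_rhs => rw [Finset.sum_comm]
    refine Finset.sum_congr rfl fun d _ => ?_
    refine Fintype.sum_equiv ((Equiv.inv C).trans (Equiv.mulLeft d)) _ _ fun c => ?_
    simp only [Equiv.trans_apply, Equiv.inv_apply, Equiv.coe_mulLeft, smul_smul, mul_inv_rev,
      inv_inv, mul_inv_cancel_comm_assoc]
    ring
  simp_rw [key]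
  rw [Finset.sum_comm]
  refine Finset.sum_congr rfl fun d _ => ?_
  rw [Finset.sum_comm]

end IsOneQuotient

/-! ### The normalization of `T(1)` -/

section TwistedTrace

variable {S C T : Type*} [CommRing S] [CommGroup C] [CommRing T] [Algebra S T]
  [MulSemiringAction C T] (τ : C) (a : S) (p : ℕ)

/-- The map `∑ i, a ^ (p - 1 - i) τ ^ i` on `T`. -/
def twistedTrace : T →+ T :=
  ∑ i ∈ range p, (DistribSMul.toAddMonoidHom T (a ^ (p - 1 - i))).comp
    (DistribSMul.toAddMonoidHom T (τ ^ i))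

theorem twistedTrace_apply (t : T) :
    twistedTrace τ a p t = ∑ i ∈ range p, a ^ (p - 1 - i) • τ ^ i • t := by
  simp [twistedTrace]

variable {τ a p}

theorem twistedTrace_smul [SMulCommClass C S T] (b : S) (t : T) :
    twistedTrace τ a p (b • t) = b • twistedTrace τ a p t := by
  simp_rw [twistedTrace_apply, Finset.smul_sum, smul_comm b, smul_comm _ b t]

theorem twistedTrace_tau (hp : 0 < p) (hτ : τ ^ p = 1) (ha : a ^ p = 1) (t : T) :
    twistedTrace τ a p (τ • t) = a • twistedTrace τ a p t := by
  obtain ⟨q, rfl⟩ := Nat.exists_eq_add_of_le' hp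
  rw [twistedTrace_apply, twistedTrace_apply, Finset.sum_range_succ, Finset.sum_range_succ',
    smul_add, Finset.smul_sum]
  congr 1
  · refine Finset.sum_congr rfl fun i hi => ?_
    rw [Finset.mem_range] at hi
    rw [smul_smul, ← pow_succ, smul_smul, ← pow_succ']
    congr 2
    omega
  · simp [smul_smul, ← pow_succ, ← pow_succ', hτ, ha]

theorem smul_twistedTrace [SMulCommClass C S T] (hp : 0 < p) (hτ : τ ^ p = 1) (ha : a ^ p = 1)
    (t : T) : τ • twistedTrace τ a p t = a • twistedTrace τ a p t := by
  rw [← twistedTrace_tau hp hτ ha, twistedTrace_apply, twistedTrace_apply, Finset.smul_sum]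
  refine Finset.sum_congr rfl fun i _ => ?_
  rw [smul_comm τ, smul_smul τ, smul_smul _ τ, mul_comm]

theorem smul_eq_pow_smul_of_mem_pow [SMulCommClass C S T] {M : Submodule S T}
    (hM : ∀ z ∈ M, τ • z = a • z) {k : ℕ} {z : T} (hz : z ∈ M ^ k) : τ • z = a ^ k • z := by
  induction hz using Submodule.pow_induction_on_left' with
  | algebraMap s => rw [Algebra.algebraMap_eq_smul_one, smul_comm, smul_one, pow_zero, one_smul]
  | add x y i _ _ hx hy => rw [smul_add, hx, hy, smul_add]
  | mem_mul m hm i x _ hx =>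
    rw [smul_mul', hM m hm, hx, smul_mul_smul_comm, Nat.succ_eq_add_one, pow_succ']

theorem twistedTrace_map {φ : S →+* S} {f : T →+* T}
    (hf : ∀ s, f (algebraMap S T s) = algebraMap S T (φ s)) (hfC : ∀ (c : C) t, f (c • t) = c • f t)
    (ha : φ a = a) (t : T) : f (twistedTrace τ a p t) = twistedTrace τ a p (f t) := by
  simp_rw [twistedTrace_apply, map_sum, Algebra.smul_def, map_mul, hf, hfC, map_pow, ha]

end TwistedTrace

namespace SemilinearAction

variable {R S C : Type*} {T : Type u} [CommRing R] [CommRing S] [Algebra R S] [CommGroup C]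
  [CommRing T] [Algebra S T] [MulSemiringAction C T] [SMulCommClass C S T]
  {σ : S ≃ₐ[R] S} {τ : C} {ρ : R} {p n : ℕ}
  {P : Type*} [AddCommGroup P] [Module S P] [Module (GroupRingOne S τ (algebraMap R S ρ)) P]
  {D : SemilinearAction σ P} {π : T →+ P} {f : T →+* T}

/-- The trace and the `ρ`-twisted trace are the maps from `T(1)` to `P₀ ≅ S` and to `P₁ ⊆ T`. Their
kernels are `(τ - 1) T(1)` and `(τ - ρ) T(1)` by `exists_of_sum_pow_smul_eq_zero`, which applies
alike to `a = 1` and `a = ρ`. -/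
theorem exists_normalization_powerInvariantsTrivial (hp : p.Prime)
    (hρ : (Polynomial.cyclotomic p R).IsRoot ρ) (hη : ρ - 1 ∈ nonZeroDivisors R)
    (hRS : Function.Injective (algebraMap R S))
    (hfix : ∀ s : S, σ s = s → ∃ c, algebraMap R S c = s) (hσ : ∀ s, σ^[n] s = s)
    (hτ : ∀ c : C, c ∈ Subgroup.zpowers τ) (hcard : Nat.card C = p)
    (hT : IsGaloisExtension C S T)
    (hreg : algebraMap S T (algebraMap R S (ρ - 1)) ∈ nonZeroDivisors T)
    (hf : ∀ s, f (algebraMap S T s) = algebraMap S T (σ s))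
    (hfC : ∀ (c : C) t, f (c • t) = c • f t) (hfn : ∀ t, f^[n] t = τ • t)
    (hπ : IsOneQuotient (τ := τ) (ρ := algebraMap R S ρ) π)
    (hsmul : ∀ (s : S) t, s • π t = π (s • t)) (htau : ∀ t, D.tau (π t) = π (τ • t))
    (hact : ∀ t, D.act (π t) = π (f t)) :
    ∃ ν : D.Normalization, PowerInvariantsTrivial ρ ν p := by
  have := hT.finite
  have := Fintype.ofFinite C
  rw [Nat.card_eq_fintype_card] at hcard
  obtain ⟨tr, htr⟩ := hT.exists_trace
  obtain ⟨w, hw⟩ := hT.exists_trace_eq_one htr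
  have hw' : ∑ c : C, c • w = 1 := by rw [← htr, hw, map_one]
  obtain ⟨d, x, y, h0, h1⟩ := hT.coordinates
  have hsum := sum_trace_mul htr h0 h1
  have hρp : (algebraMap R S ρ) ^ p = 1 := by rw [← map_pow, pow_eq_one_of_isRoot_cyclotomic hρ, map_one]
  have hτp : τ ^ p = 1 := by rw [← hcard, pow_card_eq_one]
  have hST := hT.injective
  have hinv {t : T} (ht : τ • t = t) : ∃ s, t = algebraMap S T s := by
    obtain ⟨s, hs⟩ := hT.fixed t fun c => by
      have : τ ∈ MulAction.stabilizer C t := ht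
      exact (Subgroup.zpowers_le.2 this) (hτ c)
    exact ⟨s, hs.symm⟩
  have htrace (t : T) : twistedTrace τ (1 : S) p t = algebraMap S T (tr t) := by
    rw [htr, twistedTrace_apply, ← sum_range_pow_eq_sum_univ hτ, hcard]
    simp
  have htrτ (t : T) : tr (τ • t) = tr t := hST (by
    rw [← htrace, ← htrace, twistedTrace_tau hp.pos hτp (one_pow _), one_smul])
  have htrf (t : T) : tr (f t) = σ (tr t) := hST (by
    rw [← hf, ← htrace, ← htrace]
    exact (twistedTrace_map (φ := (σ : S →+* S)) hf hfC (map_one _) t).symm)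
  have hN (t : T) : twistedTrace τ (algebraMap R S ρ) p (τ • t) = (algebraMap R S ρ) • twistedTrace τ (algebraMap R S ρ) p t :=
    twistedTrace_tau hp.pos hτp hρp t
  have hkill {a : S} (ha : a ^ p = 1) {t : T} (ht : twistedTrace τ a p t = 0) :
      ∃ t', t = τ • t' - a • t' :=
    exists_of_sum_pow_smul_eq_zero hsum hw' hτ hcard a (by rwa [twistedTrace_apply] at ht)
  -- the isomorphism `P₀ ≅ S`
  obtain ⟨g₀, hg₀⟩ := hπ.exists_lift tr.toAddMonoidHom (fun t => by
    change tr _ = tr _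
    rw [htrτ, map_smul, map_sub, htrτ, sub_self, smul_zero])
  replace hg₀ (t : T) : g₀ (π t) = tr t := hg₀ t
  let c₀ : P →ₗ[S] S :=
    { g₀ with
      map_smul' s z := by
        obtain ⟨t, rfl⟩ := hπ.surjective z
        change g₀ _ = _ • g₀ _
        rw [hsmul, hg₀, hg₀, map_smul, RingHom.id_apply] }
  have hc₀ (t : T) : c₀ (π t) = tr t := hg₀ t
  have hc₀s : Function.Surjective c₀ := fun s => ⟨π (s • w), by
    rw [hc₀, map_smul, hw, smul_eq_mul, mul_one]⟩
  have hker : LinearMap.range (D.tau - LinearMap.id) = LinearMap.ker c₀ := by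
    ext z
    constructor
    · rintro ⟨z, rfl⟩
      obtain ⟨t, rfl⟩ := hπ.surjective z
      rw [LinearMap.mem_ker, LinearMap.sub_apply, LinearMap.id_apply, htau, map_sub, hc₀, hc₀,
        htrτ, sub_self]
    · intro hz
      obtain ⟨t, rfl⟩ := hπ.surjective z
      rw [LinearMap.mem_ker, hc₀] at hz
      obtain ⟨t', rfl⟩ := hkill (one_pow p) (t := t) (by rw [htrace, hz, map_zero])
      exact ⟨π t', by rw [LinearMap.sub_apply, LinearMap.id_apply, htau, one_smul, map_sub]⟩
  let ν : D.Normalization :=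
    { equiv := (Submodule.quotEquivOfEq _ _ hker).trans (c₀.quotKerEquivOfSurjective hc₀s)
      map_act z := by
        obtain ⟨t, rfl⟩ := hπ.surjective z
        change c₀ (D.act (π t)) = σ (c₀ (π t))
        rw [hact, hc₀, hc₀, htrf] }
  have hν (t : T) : ν.coord (π t) = tr t := hc₀ t
  -- the embedding `P₁ ⊆ T`
  obtain ⟨g₁, hg₁⟩ := hπ.exists_lift (twistedTrace τ (algebraMap R S ρ) p) (fun t => by
    rw [hN, twistedTrace_smul])
  let c₁ : P →ₗ[S] T :=
    { g₁ with
      map_smul' s z := by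
        obtain ⟨t, rfl⟩ := hπ.surjective z
        change g₁ _ = _ • g₁ _
        rw [hsmul, hg₁, hg₁, twistedTrace_smul, RingHom.id_apply] }
  have hc₁ (t : T) : c₁ (π t) = twistedTrace τ (algebraMap R S ρ) p t := hg₁ t
  let m : D.POne ρ →ₗ[S] T := Submodule.liftQ _ c₁ (by
    rintro _ ⟨z, rfl⟩
    obtain ⟨t, rfl⟩ := hπ.surjective z
    rw [LinearMap.mem_ker, LinearMap.sub_apply, LinearMap.smul_apply, LinearMap.id_apply, htau,
      map_sub c₁, map_smul c₁, hc₁, hc₁, hN, sub_self])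
  have hm (t : T) : m (D.toOne ρ (π t)) = twistedTrace τ (algebraMap R S ρ) p t := hc₁ t
  have hlift (z : D.POne ρ) : ∃ t, D.toOne ρ (π t) = z := by
    obtain ⟨z, rfl⟩ := toOne_surjective z
    obtain ⟨t, rfl⟩ := hπ.surjective z
    exact ⟨t, rfl⟩
  have hpow {l : T} (hl : l ∈ LinearMap.range m ^ p) : ∃ s, l = algebraMap S T s := by
    refine hinv ?_
    rw [smul_eq_pow_smul_of_mem_pow (a := algebraMap R S ρ) ?_ hl, hρp, one_smul]
    rintro _ ⟨z, rfl⟩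
    obtain ⟨t, rfl⟩ := hlift z
    rw [hm, smul_twistedTrace hp.pos hτp hρp]
  obtain ⟨b, hb⟩ : ∃ b : Fin d → S,
      ∑ k, algebraMap S T (b k) * m (D.toOne ρ (π (x k))) ^ p = 1 := by
    have hspan : Ideal.span (Set.range fun k => m (D.toOne ρ (π (x k)))) = ⊤ := by
      obtain ⟨h0', h1'⟩ := sum_smul_mul_of_coordinates h0 h1
      -- Only the term `i = 0` of the twisted trace survives the coordinate relations. The
      -- eigenvectors therefore generate the unit ideal of `T`, and so do their `p`-th powers.
      have h2 : ∑ k, y k * m (D.toOne ρ (π (x k))) = algebraMap S T ((algebraMap R S ρ) ^ (p - 1)) := by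
        simp_rw [hm, twistedTrace_apply, Finset.mul_sum]
        rw [Finset.sum_comm, Finset.sum_eq_single_of_mem 0 (Finset.mem_range.2 hp.pos)]
        · simp_rw [tsub_zero, pow_zero, one_smul, mul_smul_comm ((algebraMap R S ρ) ^ _), ← Finset.smul_sum]
          rw [h0', Algebra.algebraMap_eq_smul_one (A := T)]
        · intro i hi hi0
          simp_rw [mul_smul_comm ((algebraMap R S ρ) ^ _), ← Finset.smul_sum]
          rw [h1', smul_zero]
          intro h
          rw [← orderOf_dvd_iff_pow_eq_one, orderOf_eq_card_of_forall_mem_zpowers hτ,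
            Nat.card_eq_fintype_card, hcard] at h
          exact hi0 (Nat.eq_zero_of_dvd_of_lt h (Finset.mem_range.1 hi))
      have h3 : IsUnit (algebraMap S T ((algebraMap R S ρ) ^ (p - 1))) :=
        ((IsUnit.of_pow_eq_one hρp hp.ne_zero).pow _).map _
      refine Ideal.eq_top_of_isUnit_mem _ ?_ h3
      rw [← h2]
      exact sum_mem fun k _ => Ideal.mul_mem_left _ _ (Ideal.subset_span ⟨k, rfl⟩)
    have h2 := Ideal.span_pow_eq_top _ hspan p
    rw [← Set.range_comp, Ideal.eq_top_iff_one, Ideal.mem_span_range_iff_exists_fun] at h2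
    obtain ⟨b, hb⟩ := h2
    have h3 (k : Fin d) := hpow (Submodule.pow_mem_pow _
      (LinearMap.mem_range_self m (D.toOne ρ (π (x k)))) p)
    choose q hq using h3
    -- The `p`-th powers lie in `S`, so the `S`-linear map `t ↦ tr (w * t)`, which sends `1` to `1`,
    -- moves the coefficients from `T` to `S`.
    refine ⟨fun k => tr (w * b k), ?_⟩
    have h4 : ∑ k, tr (w * b k) * q k = 1 := by
      have h5 := congrArg (fun t => tr (w * t)) hb
      simp only [Finset.mul_sum, map_sum, mul_one, hw] at h5
      rw [← h5]
      refine Finset.sum_congr rfl fun k _ => ?_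
      rw [Function.comp_apply, hq, ← mul_assoc, mul_comm _ (algebraMap S T _), ← Algebra.smul_def,
        map_smul, smul_eq_mul, mul_comm]
    simp_rw [hq, ← map_mul, ← map_sum]
    rw [h4, map_one]
  refine ⟨ν, powerInvariantsTrivial_of_linearMap (m := m) (a := b)
    (θ := fun k => D.toOne ρ (π (x k))) ν hp hρ hη hRS hfix hσ (fun z => ?_) hST hreg
    (fun t s ht => ?_) ?_ (fun z => ?_) (fun l hl => hpow hl) hb ?_⟩
  · obtain ⟨t, rfl⟩ := hπ.surjective z
    have (k : ℕ) : D.act^[k] (π t) = π (f^[k] t) := by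
      induction k with
      | zero => rfl
      | succ k ih => rw [Function.iterate_succ_apply', ih, hact, Function.iterate_succ_apply']
    rw [this, hfn, htau]
  -- `η ^ p t` lies in `S` and is fixed by `τ`. As `η` is regular on `T`, so is `t` itself fixed.
  · refine hinv ?_
    have h2 : algebraMap S T (algebraMap R S (ρ - 1)) ^ p * (τ • t - t) = 0 := by
      have h3 := congrArg (τ • ·) ht
      have h4 (s : S) : τ • algebraMap S T s = algebraMap S T s := by
        rw [Algebra.algebraMap_eq_smul_one, smul_comm, smul_one]
      simp only [smul_mul', ← map_pow (algebraMap S T), h4] at h3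
      rw [map_pow] at h3
      rw [mul_sub, h3, ht, sub_self]
    exact sub_eq_zero.1 ((mem_nonZeroDivisors_iff.1 (pow_mem hreg p)).1 _ h2)
  · rw [injective_iff_map_eq_zero]
    intro z hz
    obtain ⟨t, rfl⟩ := hlift z
    rw [hm] at hz
    obtain ⟨t', rfl⟩ := hkill hρp hz
    rw [map_sub π, map_sub, ← htau, toOne_tau, ← hsmul, map_smul, sub_self]
  · obtain ⟨t, rfl⟩ := hπ.surjective z
    -- The two traces differ by `∑ (ρ ^ (p - 1 - i) - 1) τ ^ i t`, and each coefficient is `η` times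
    -- a geometric sum.
    refine ⟨∑ i ∈ range p, (∑ j ∈ range (p - 1 - i), (algebraMap R S ρ) ^ j) • τ ^ i • t, ?_⟩
    rw [hm, hν, ← htrace, twistedTrace_apply, twistedTrace_apply, ← Finset.sum_sub_distrib,
      ← Algebra.smul_def, Finset.smul_sum]
    refine Finset.sum_congr rfl fun i _ => ?_
    rw [smul_smul, ← sub_smul, one_pow, map_sub, map_one, mul_geom_sum]
  · have h2 := congrArg f hb
    rw [map_sum, map_one] at h2
    rw [← h2]
    refine Finset.sum_congr rfl fun k _ => ?_
    rw [map_mul, hf, map_pow, actOne_toOne, hact, hm, hm]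
    congr 2
    exact (twistedTrace_map (φ := (σ : S →+* S)) hf hfC (by simp) _).symm

end SemilinearAction

/-! ### `T(1)` as a splitting module of `A(1)` -/

theorem IsOneQuotient.of_algebraMap {R S C : Type*} {T : Type u} [CommRing R] [CommRing S]
    [Algebra R S] [CommGroup C] [CommRing T] [Algebra R T] [Algebra S T] [IsScalarTower R S T]
    [MulSemiringAction C T] {τ : C} {ρ : R} {P : Type*} [AddCommGroup P]
    [Module (GroupRingOne S τ (algebraMap R S ρ)) P] [Module (GroupRingOne R τ ρ) P]
    [IsScalarTower (GroupRingOne R τ ρ) (GroupRingOne S τ (algebraMap R S ρ)) P] {π : T →+ P}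
    (hπ : IsOneQuotient (τ := τ) (ρ := algebraMap R S ρ) π) :
    IsOneQuotient (τ := τ) (ρ := ρ) π where
  surjective := hπ.surjective
  smul_base a t := by
    rw [← algebraMap_smul (GroupRingOne S τ (algebraMap R S ρ)), algebraMap_groupRingOneC,
      hπ.smul_base, algebraMap_smul]
  smul_of c t := by
    rw [← algebraMap_smul (GroupRingOne S τ (algebraMap R S ρ)), algebraMap_groupRingOneOf,
      hπ.smul_of]
  exists_of_eq_zero t ht := by
    obtain ⟨t', h⟩ := hπ.exists_of_eq_zero t ht
    exact ⟨t', by rwa [algebraMap_smul] at h⟩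

section AOneModule

variable {R S C : Type*} {T : Type u} [CommRing R] [CommRing S] [Algebra R S] [CommGroup C]
  [CommRing T] [Algebra R T] [Algebra S T] [IsScalarTower R S T] [MulSemiringAction C T]
  {φ : S ≃ₐ[R] S} {τ : C} {ρ : R} {n : ℕ} {P : Type*} [AddCommGroup P]
  [Module (GroupRingOne S τ (algebraMap R S ρ)) P] [Module (GroupRingOne R τ ρ) P]
  [IsScalarTower (GroupRingOne R τ ρ) (GroupRingOne S τ (algebraMap R S ρ)) P]
  {π : T →+ P} {f : T →+* T}

/-- The element `u` acts by the map which `f` induces on `T(1)`. It is semilinear over `S[C](1)`,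
and its `n`-th power is `τ`, so `CrossedProduct.lift_bijective` applies. -/
theorem exists_module_AOne (hπ : IsOneQuotient (τ := τ) (ρ := algebraMap R S ρ) π)
    (hf : ∀ s, f (algebraMap S T s) = algebraMap S T (φ s))
    (hfC : ∀ (c : C) t, f (c • t) = c • f t) (hfn : ∀ t, f^[n] t = τ • t)
    [FaithfulSMul (GroupRingOne S τ (algebraMap R S ρ)) P]
    (hend : ∀ h : P →ₗ[GroupRingOne S τ (algebraMap R S ρ)] P,
      ∃ b : GroupRingOne S τ (algebraMap R S ρ), ∀ x, h x = b • x)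
    (hn : 0 < n) (hφn : ∀ s, φ^[n] s = s)
    (htr : ∀ s, ∃ r, algebraMap R S r = ∑ i ∈ range n, φ^[i] s) {m : ℕ} {x y : Fin m → S}
    (hxy : ∀ i < n, ∑ l, x l * φ^[i] (y l) = if i = 0 then 1 else 0) :
    ∃ (_ : Module (AOne φ τ ρ n) P) (_ : IsScalarTower (GroupRingOne R τ ρ) (AOne φ τ ρ n) P),
      Function.Bijective (Algebra.lsmul (GroupRingOne R τ ρ) (GroupRingOne R τ ρ) P :
        AOne φ τ ρ n →ₐ[GroupRingOne R τ ρ] Module.End (GroupRingOne R τ ρ) P) ∧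
      (∀ t, AOne.u φ τ ρ n • π t = π (f t)) ∧
      (∀ s t, AOne.ofS φ τ ρ n s • π t = π (s • t)) ∧
      ∀ t, AOne.tau φ τ ρ n • π t = π (τ • t) := by
  have hπR : IsOneQuotient (τ := τ) (ρ := ρ) π := hπ.of_algebraMap
  have hfS (s : S) (t : T) : f (s • t) = φ s • f t := by
    rw [Algebra.smul_def, map_mul, hf, ← Algebra.smul_def]
  have hfR (r : R) (t : T) : f (r • t) = r • f t := by
    rw [← algebraMap_smul S, hfS, AlgEquiv.commutes, algebraMap_smul]
  obtain ⟨g, hg⟩ := hπR.exists_lift (π.comp f.toAddMonoidHom) (fun t => by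
    change π (f _) = π (f _)
    have h := hπR.map_eq_zero (f t)
    rw [map_sub π, sub_eq_zero] at h
    rw [hfC, hfR, map_sub f, hfC, h])
  replace hg (t : T) : g (π t) = π (f t) := hg t
  let v : Module.End (GroupRingOne R τ ρ) P :=
    { g with
      map_smul' := groupRingOne_map_smul g
        (fun a z => by
          obtain ⟨t, rfl⟩ := hπ.surjective z
          rw [hπR.smul_base, hg, hg, hπR.smul_base, hfR])
        (fun c z => by
          obtain ⟨t, rfl⟩ := hπ.surjective z
          rw [hπR.smul_of, hg, hg, hπR.smul_of, hfC]) }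
  have hv (t : T) : v (π t) = π (f t) := hg t
  have hvb (b : GroupRingOne S τ (algebraMap R S ρ)) (z : P) :
      v (b • z) = sigmaOne φ τ ρ b • v z := by
    induction b using groupRingOne_induction with
    | single c s =>
      obtain ⟨t, rfl⟩ := hπ.surjective z
      rw [mul_smul, hπ.smul_of, hπ.smul_base, hv, hfS, hfC, map_mul, sigmaOne_groupRingOneC,
        sigmaOne_groupRingOneOf, mul_smul, hv, hπ.smul_of, hπ.smul_base]
    | add b b' hb hb' => rw [add_smul, map_add, hb, hb', map_add, add_smul]
  have hskew (b : GroupRingOne S τ (algebraMap R S ρ)) :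
      v * Algebra.lsmul (GroupRingOne R τ ρ) (GroupRingOne R τ ρ) P b =
        Algebra.lsmul (GroupRingOne R τ ρ) (GroupRingOne R τ ρ) P (sigmaOne φ τ ρ b) * v :=
    LinearMap.ext fun z => hvb b z
  have hpow : v ^ n = algebraMap _ (Module.End (GroupRingOne R τ ρ) P) (tauOne τ ρ) := by
    refine LinearMap.ext fun z => ?_
    obtain ⟨t, rfl⟩ := hπ.surjective z
    have (k : ℕ) : (v ^ k) (π t) = π (f^[k] t) := by
      induction k with
      | zero => rfl
      | succ k ih =>
        rw [pow_succ', Module.End.mul_apply, ih, hv, Function.iterate_succ_apply']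
    rw [this, hfn, Module.algebraMap_end_apply, ← groupRingOneOf_self, hπR.smul_of]
  let F := CrossedProduct.lift (φ := sigmaOne φ τ ρ) (n := n) (a := tauOne τ ρ)
    (Algebra.lsmul (GroupRingOne R τ ρ) (GroupRingOne R τ ρ) P) v hskew hpow
  have hbij : Function.Bijective F := CrossedProduct.lift_bijective hend hn isUnit_tauOne
    (sigmaOne_pow_eq_one φ hφn) (exists_algebraMap_eq_sum_sigmaOne φ htr)
    (sigmaOne_coordinates φ hxy) v hskew hpow
  have hFb (b : GroupRingOne S τ (algebraMap R S ρ)) (z : P) :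
      F (CrossedProduct.ofBase _ n _ b) z = b • z := by
    exact LinearMap.congr_fun (CrossedProduct.lift_ofBase _ v hskew hpow b) z
  let _ : Module (AOne φ τ ρ n) P := Module.compHom P F.toRingHom
  have hsmul (z : AOne φ τ ρ n) (w : P) : z • w = F z w := rfl
  have hKA : IsScalarTower (GroupRingOne R τ ρ) (AOne φ τ ρ n) P := ⟨fun k z w => by
    rw [hsmul, hsmul, map_smul, LinearMap.smul_apply]⟩
  refine ⟨inferInstance, hKA, ?_, fun t => ?_, fun s t => ?_, fun t => ?_⟩
  · convert hbij using 1
    exact funext fun z => LinearMap.ext fun w => rfl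
  · rw [hsmul, ← hv]
    exact LinearMap.congr_fun (CrossedProduct.lift_u _ v hskew hpow) (π t)
  · rw [hsmul, AOne.ofS_apply, hFb, hπ.smul_base]
  · rw [hsmul, AOne.tau_eq, hFb, ← groupRingOneOf_self, hπ.smul_of]

end AOneModule

/-! ### From an extension to a splitting module -/

section GaloisTower

variable {R S G T : Type*} [CommRing R] [CommRing S] [CommGroup G] {C : Subgroup G}
  [CommRing T] [Algebra R T] [Algebra S T] [MulSemiringAction G T]

theorem IsGaloisExtension.of_subgroup [SMulCommClass G R T] [SMulCommClass C S T] (hT : IsGaloisExtension G R T)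
    (hST : Function.Injective (algebraMap S T))
    (hrange : Set.range (algebraMap S T) = {t : T | ∀ c ∈ C, c • t = t}) :
    IsGaloisExtension C S T where
  finite := by
    have := hT.finite
    infer_instance
  injective := hST
  fixed t ht := by
    rw [hrange]
    exact fun c hc => ht ⟨c, hc⟩
  coordinates := by
    obtain ⟨m, x, y, h0, h1⟩ := hT.coordinates
    exact ⟨m, x, y, h0, fun c hc => h1 c fun h => hc (Subtype.ext h)⟩

theorem smulCommClass_of_range
    (hrange : Set.range (algebraMap S T) = {t : T | ∀ c ∈ C, c • t = t}) :
    SMulCommClass C S T := ⟨fun c s t => by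
  have h : algebraMap S T s ∈ {t : T | ∀ c ∈ C, c • t = t} := hrange ▸ ⟨s, rfl⟩
  rw [Algebra.smul_def, smul_mul', Algebra.smul_def]
  congr 1
  exact h c c.2⟩

end GaloisTower

theorem IsSplitAzumaya.of_isSplittingModule {K : Type (max u v)} {A : Type*} [CommRing K] [Ring A]
    [Algebra K A] {P : Type u} [AddCommGroup P] [Module K P] [Module A P] [IsScalarTower K A P]
    [FaithfulSMul K P] (h : IsSplittingModule K A P) : IsSplitAzumaya K A := by
  obtain ⟨_, _, hbij⟩ := h
  let E : A ≃ₐ[K] Module.End K P := AlgEquiv.ofBijective _ hbij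
  -- A copy of `P` in the universe of `K`, where `IsSplitAzumaya` asks for it.
  let e : ULift.{v} P ≃ₗ[K] P := ULift.moduleEquiv
  have : IsAzumaya K (Module.End K P) := isAzumaya_end
  let E' := E.trans (e.symm.conjAlgEquiv K)
  refine ⟨IsAzumaya.of_AlgEquiv _ _ _ E.symm, ULift.{v} P, inferInstance,
    inferInstance, Module.Finite.equiv e.symm, Module.Projective.of_equiv e.symm, ⟨fun {a b} h => ?_⟩,
    ⟨E'⟩⟩
  exact FaithfulSMul.eq_of_smul_eq_smul (α := P) fun z => congrArg ULift.down (h ⟨z⟩)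

/-- Two traces on `T` are used. The trace of `G`, with values in `R`, gives finiteness, projectivity
and faithfulness of `T(1)` over `R[C](1)`. The trace of `C`, with values in `S`, gives faithfulness
over `S[C](1)` and shows that `S[C](1)`-endomorphisms are scalars. -/
theorem exists_splittingModule_of_extendsToGalois {p : ℕ} (hp : p.Prime) {r : ℕ}
    {R S : Type u} [CommRing R] [CommRing S] [Algebra R S]
    {ρ : R} (hρ : (Polynomial.cyclotomic p R).IsRoot ρ) (hη : ρ - 1 ∈ nonZeroDivisors R)
    {G : Type v} [CommGroup G] (hG : Nat.card G = p ^ (r + 1))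
    {σ : G} (hσ : ∀ g : G, g ∈ Subgroup.zpowers σ)
    {C : Subgroup G} (hC : Nat.card C = p) {τ : C} (hτ : (τ : G) = σ ^ p ^ r)
    [MulSemiringAction (G ⧸ C) S] [SMulCommClass (G ⧸ C) R S]
    (hS : IsGaloisExtension (G ⧸ C) R S)
    {φ : S ≃ₐ[R] S} (hφ : φ = MulSemiringAction.toAlgEquiv R S (σ : G ⧸ C))
    (hext : ExtendsToGalois C R S) :
    IsSplitAzumaya (GroupRingOne R τ ρ) (AOne φ τ ρ (p ^ r)) ∧
      ∃ (P : Type u) (_ : AddCommGroup P) (_ : Module (GroupRingOne R τ ρ) P)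
        (_ : Module (AOne φ τ ρ (p ^ r)) P)
        (_ : IsScalarTower (GroupRingOne R τ ρ) (AOne φ τ ρ (p ^ r)) P),
        IsSplittingModule (GroupRingOne R τ ρ) (AOne φ τ ρ (p ^ r)) P ∧
        IsNormalizedWithTrivialPower φ τ ρ (p ^ r) P p := by
  obtain ⟨T, _, _, _, _, _, _, hT, hST, hrange, hGS⟩ := hext
  have hn : 0 < p ^ r := pow_pos hp.pos r
  have hφn (s : S) : φ^[p ^ r] s = s := by
    rw [hφ, iterate_toAlgEquiv_eq hp hG hC _ s]
  obtain ⟨m', x', y', hxy'⟩ := hS.exists_cyclic_coordinates hp hG hσ hC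
  rw [← hφ] at hxy'
  have htr' := hS.exists_algebraMap_eq_sum hp hG hσ hC
  rw [← hφ] at htr'
  have hτC := mem_zpowers_tau hp hG hσ hC hτ
  have : SMulCommClass C S T := smulCommClass_of_range hrange
  have hTC : IsGaloisExtension C S T := hT.of_subgroup hST hrange
  have := hT.finite
  have := Fintype.ofFinite G
  have := Fintype.ofFinite C
  obtain ⟨trG, htrG⟩ := hT.exists_trace
  obtain ⟨wG, hwG⟩ := hT.exists_trace_eq_one htrG
  obtain ⟨tr, htr⟩ := hTC.exists_trace
  obtain ⟨w, hw⟩ := hTC.exists_trace_eq_one htr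
  have hw' : ∑ c : C, c • w = 1 := by rw [← htr, hw, map_one]
  obtain ⟨m, x, y, h0, h1⟩ := hT.coordinates
  have h1C (c : C) (hc : c ≠ 1) : ∑ i, x i * c • y i = 0 := h1 c fun h => hc (Subtype.ext h)
  have hsumG := sum_trace_mul htrG h0 h1
  have hsum := sum_trace_mul htr h0 h1C
  obtain ⟨P, _, _, π, hπ⟩ := exists_isOneQuotient τ (algebraMap R S ρ) T
  let _ : Module (GroupRingOne R τ ρ) P := Module.compHom P
    (algebraMap (GroupRingOne R τ ρ) (GroupRingOne S τ (algebraMap R S ρ)))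
  have : IsScalarTower (GroupRingOne R τ ρ) (GroupRingOne S τ (algebraMap R S ρ)) P :=
    ⟨fun a b z => by rw [Algebra.smul_def, mul_smul]; rfl⟩
  have hπR : IsOneQuotient (τ := τ) (ρ := ρ) π := hπ.of_algebraMap
  have hfin := hπR.finite hsumG hw'
  have hproj := hπR.projective hsumG hw'
  have hfaith := hπR.faithfulSMul hwG h0 h1C
  have hfaithS := hπ.faithfulSMul hw h0 h1C
  let f : T →+* T := MulSemiringAction.toRingHom G T σ
  have hf (s : S) : f (algebraMap S T s) = algebraMap S T (φ s) := by
    change σ • algebraMap S T s = _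
    rw [hGS, hφ]
    rfl
  have hfC (c : C) (t : T) : f (c • t) = c • f t := by
    change σ • (c : G) • t = (c : G) • σ • t
    rw [smul_smul, smul_smul, mul_comm]
  have hfn (t : T) : f^[p ^ r] t = τ • t := by
    have (k : ℕ) : f^[k] t = σ ^ k • t := by
      induction k with
      | zero => simp
      | succ k ih =>
        rw [Function.iterate_succ_apply', ih, pow_succ', mul_smul]
        rfl
    rw [this, ← hτ]
    rfl
  obtain ⟨_, _, hbij, hu, hofS, htau⟩ := exists_module_AOne hπ hf hfC hfn
    (hπ.exists_smul_of_linearMap hsum hw' htr) hn hφn htr' hxy'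
  have hsplit : IsSplittingModule (GroupRingOne R τ ρ) (AOne φ τ ρ (p ^ r)) P :=
    ⟨hfin, hproj, hbij⟩
  refine ⟨IsSplitAzumaya.of_isSplittingModule hsplit, P, _, _, _, inferInstance, hsplit, ?_⟩
  let _ := AOne.moduleS φ τ ρ (p ^ r) P
  refine SemilinearAction.exists_normalization_powerInvariantsTrivial hp hρ hη hS.injective
    (fun s hs => ?_) hφn hτC hC hTC ?_ hf hfC hfn hπ hofS htau hu
  · refine hS.fixed s fun g => ?_
    have : (σ : G ⧸ C) ∈ MulAction.stabilizer (G ⧸ C) s := by rw [hφ] at hs; exact hs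
    exact (Subgroup.zpowers_le.2 this) (mem_zpowers_mk hσ g)
  · rw [← IsScalarTower.algebraMap_apply]
    exact hT.regular hη

end AlbertCriterion

/-- Albert's criterion for commutative rings. -/
theorem mainTheorem6 (p : ℕ) (hp : p.Prime) (r : ℕ)
    (R S : Type u) [CommRing R] [CommRing S] [Algebra R S]
    (ρ : R) (hρ : (Polynomial.cyclotomic p R).IsRoot ρ) (hη : ρ - 1 ∈ nonZeroDivisors R)
    (G : Type v) [CommGroup G] (hG : Nat.card G = p ^ (r + 1))
    (σ : G) (hσ : ∀ g : G, g ∈ Subgroup.zpowers σ)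
    (C : Subgroup G) (hC : Nat.card C = p) (τ : C) (hτ : (τ : G) = σ ^ p ^ r)
    [MulSemiringAction (G ⧸ C) S] [SMulCommClass (G ⧸ C) R S]
    (hS : AlbertCriterion.IsGaloisExtension (G ⧸ C) R S) :
    AlbertCriterion.ExtendsToGalois C R S ↔
      AlbertCriterion.IsSplitAzumaya (AlbertCriterion.GroupRingOne R τ ρ)
        (AlbertCriterion.AOne (MulSemiringAction.toAlgEquiv R S (σ : G ⧸ C)) τ ρ (p ^ r)) ∧
      ∃ (P : Type u) (_ : AddCommGroup P) (_ : Module (AlbertCriterion.GroupRingOne R τ ρ) P)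
        (_ : Module
          (AlbertCriterion.AOne (MulSemiringAction.toAlgEquiv R S (σ : G ⧸ C)) τ ρ (p ^ r)) P)
        (_ : IsScalarTower (AlbertCriterion.GroupRingOne R τ ρ)
          (AlbertCriterion.AOne (MulSemiringAction.toAlgEquiv R S (σ : G ⧸ C)) τ ρ (p ^ r)) P),
        AlbertCriterion.IsSplittingModule (AlbertCriterion.GroupRingOne R τ ρ)
          (AlbertCriterion.AOne (MulSemiringAction.toAlgEquiv R S (σ : G ⧸ C)) τ ρ (p ^ r)) P ∧
        AlbertCriterion.IsNormalizedWithTrivialPower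
          (MulSemiringAction.toAlgEquiv R S (σ : G ⧸ C)) τ ρ (p ^ r) P p := by
  constructor
  · exact AlbertCriterion.exists_splittingModule_of_extendsToGalois hp hρ hη hG hσ hC hτ hS rfl
  · rintro ⟨hA, P, _, _, _, _, hP, hN⟩
    exact AlbertCriterion.extendsToGalois_of_splittingModule hp hρ hη hG hσ hC hτ hS rfl hA.1 hP hN
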